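/- **Setting.** A *context* is a finite family of objects labelled by a finite set of names (channels); $\Gamma,\Delta$ denotes the disjoint juxtaposition of contexts. A (symmetric) *polycategory* $P$ consists of a class of objects, a set $P(\Gamma;\Delta)$ of polymorphisms for all contexts $\Gamma,\Delta$ of objects, a functorial action of bijective (object-preserving) renamings of the channels of $\Gamma$ and of $\Delta$ (the symmetric action), identities $1_x\in P(x;x)$, and a cut $P(\Gamma;x,\Delta)\times P(x,\Gamma';\Delta')\to P(\Gamma,\Gamma';\Delta,\Delta')$, $(f,g)\mapsto f;g$, which commutes with renamings, has the $1_x$ as two-sided identities, is associative, and satisfies the two interchange laws: cutting two different output channels of one polymorphism against two others, or two different input channels of one polymorphism against two others, gives the same result in either order. A *morphism* of polycategories consists of a map on objects and maps on polymorphisms that preserve renaming, identities and cut. An object $S$ is a *poly-sum* of a family $(X_i)_{i\in I}$ if it comes with bijections $\prod_{i\in I}P(\Gamma,X_i;\Delta)\cong P(\Gamma,S;\Delta)$, $(f_i)_i\mapsto\{f_i\}_i$, that commute with renamings of the channels of $\Gamma$ and $\Delta$ and with cuts, on either side, along channels of $\Gamma$ and $\Delta$: $\{f_i\}_i;h=\{f_i;h\}_i$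 and $h;\{f_i\}_i=\{h;f_i\}_i$. *Poly-products* are dual, with bijections $\prod_{i\in I}P(\Gamma;Y_i,\Delta)\cong P(\Gamma;T,\Delta)$. Let $\mathbf A$ be a polycategory. *Formulas* are generated from the objects of $\mathbf A$ (atoms) by sums $\sum_{i\in I}X_i$ and products $\prod_{i\in I}X_i$ over finite, possibly empty, index sets $I$. *Derivations* of sequents $\Gamma\vdash\Delta$ (contexts of formulas) are generated by: an axiom for each polymorphism of $\mathbf A$ (among them the identity axiom $A\vdash A$ for each atom); renaming of channels; cotupling (from $\Gamma,X_i\vdash\Delta$ for all $i\in I$ infer $\Gamma,\sum_iX_i\vdash\Delta$); tupling (from $\Gamma\vdash Y_i,\Delta$ for all $i\in I$ infer $\Gamma\vdash\prod_iY_i,\Delta$); projection (from $\Gamma,X_k\vdash\Delta$ infer $\Gamma,\prod_iX_i\vdash\Delta$); injection (from $\Gamma\vdash Y_k,\Delta$ infer $\Gamma\vdash\sum_iY_i,\Delta$); and cut (from $\Gamma\vdash Z,\Delta$ and $Z,\Gamma'\vdash\Delta'$ infer $\Gamma,\Gamma'\vdash\Delta,\Delta'$). Let $\sim$ be the congruence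 on derivations of each sequent generated by the following. * Renaming is functorial, commutes with all rules, and acts on axioms as in $\mathbf A$; a cut of two axioms equals the axiom of their cut in $\mathbf A$. * *Reductions*: $f;1_A\sim f$ and $1_A;f\sim f$ for atoms $A$; a cut on a channel $\gamma$ commutes with a cotupling, tupling, injection or projection that is the last rule of the left or of the right premise and acts on a channel other than $\gamma$; an injection at $k$ on $\gamma$ applied to $f$, cut on $\gamma$ with a cotupling of $(g_i)_i$ on $\gamma$, is $\sim f;g_k$; and, dually, a tupling of $(f_i)_i$ on $\gamma$, cut on $\gamma$ with a projection at $k$ on $\gamma$ applied to $g$, is $\sim f_k;g$. * *Permuting conversions*: any two of the rules cotupling, tupling, injection and projection (possibly twice the same rule) that act on different channels commute. Let $\Sigma\Pi_{\mathbf A}$ have the formulas as objects and the $\sim$-classes of derivations of $\Gamma\vdash\Delta$ as polymorphisms $\Gamma\to\Delta$. Its cut and renaming are those of derivations. Its identity on an atom is the identity axiom; its identity on $\sum_iX_i$ is the cotupling of the derivations obtained from the identities of the $X_i$ by injection at $i$; and its identity on $\prod_iX_i$ is defined dually. Let $\mathcal I:\mathbf A\to\Sigma\Pi_{\mathbf A}$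 send objects to atoms and polymorphisms to (classes of) axioms. **Proposition.** For every polycategory $\mathbf A$: 1. $\Sigma\Pi_{\mathbf A}$ is a polycategory. 2. $\Sigma\Pi_{\mathbf A}$ has finite poly-sums and finite poly-products: for every finite family of formulas, the formula $\sum_iX_i$, with the operation induced by the cotupling rule, is a poly-sum, and the formula $\prod_iX_i$, with the operation induced by the tupling rule, is a poly-product. 3. $\Sigma\Pi_{\mathbf A}$ is the free polycategory with finite poly-sums and poly-products on $\mathbf A$: for every polycategory $\mathbf B$ with a choice of a poly-sum and a poly-product (with their correspondences) for every finite family of objects, and every morphism of polycategories $F:\mathbf A\to\mathbf B$, there is exactly one morphism of polycategories $G:\Sigma\Pi_{\mathbf A}\to\mathbf B$ with $G\circ\mathcal I=F$ that preserves the chosen poly-sums and poly-products, that is, $G(\sum_iX_i)=\sum_iGX_i$, $G\{f_i\}_i=\{Gf_i\}_i$, and dually for products. -/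

import Mathlib

/-!
Polymorphisms are handled with labelled wires: a string of objects is a finite family
of objects indexed by a finite set of wire names ("channels"), and the symmetric action is the
action of all bijective renamings of channels.
-/

universe u v u' v' u'' v''

set_option linter.checkUnivs false

namespace SigmaPi

/-! ### Contexts: finite families of objects labelled by channels -/

/-- A context `α₁ : X₁, …, αₙ : Xₙ`: a finite set of channels, each carrying an object. -/
structure Ctx (O : Type u) : Type (max 1 u) where
  chan : Type
  finite : Finite chan
  obj : chan → O

namespace Ctx

variable {O : Type u}

/-- The empty context. -/
def empty : Ctx O := ⟨Empty, inferInstance, Empty.elim⟩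

/-- The context with exactly one channel. -/
def single (x : O) : Ctx O := ⟨Unit, inferInstance, fun _ => x⟩

/-- Juxtaposition `Γ, Δ` (the channels of the two parts are made disjoint). -/
def append (Γ Δ : Ctx O) : Ctx O :=
  ⟨Γ.chan ⊕ Δ.chan, haveI := Γ.finite; haveI := Δ.finite; inferInstance, Sum.elim Γ.obj Δ.obj⟩

/-- The context `x, Γ`. -/
abbrev cons (x : O) (Γ : Ctx O) : Ctx O := append (single x) Γ

/-- Apply a function on objects to every entry of a context. -/
def map {O' : Type u'} (F : O → O') (Γ : Ctx O) : Ctx O' := ⟨Γ.chan, Γ.finite, fun i => F (Γ.obj i)⟩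

end Ctx

infixr:67 " ⧺ " => Ctx.append
infixr:67 " ∷ " => Ctx.cons

/-- A renaming of channels: a bijection of channels that preserves the objects they carry. -/
structure Renaming {O : Type u} (Γ Δ : Ctx O) where
  equiv : Γ.chan ≃ Δ.chan
  obj_eq : ∀ i, Δ.obj (equiv i) = Γ.obj i

namespace Renaming

variable {O : Type u} {Γ Γ' Δ Δ' Θ : Ctx O}

def refl (Γ : Ctx O) : Renaming Γ Γ := ⟨Equiv.refl _, fun _ => rfl⟩

def symm (σ : Renaming Γ Δ) : Renaming Δ Γ :=
  ⟨σ.equiv.symm, fun i => by rw [← σ.obj_eq, Equiv.apply_symm_apply]⟩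

def trans (σ : Renaming Γ Δ) (τ : Renaming Δ Θ) : Renaming Γ Θ :=
  ⟨σ.equiv.trans τ.equiv, fun i => by
    rw [Equiv.trans_apply, τ.obj_eq, σ.obj_eq]⟩

/-- Rename in both parts of a juxtaposition. -/
def append (σ : Renaming Γ Γ') (τ : Renaming Δ Δ') : Renaming (Γ ⧺ Δ) (Γ' ⧺ Δ') :=
  ⟨Equiv.sumCongr σ.equiv τ.equiv, by
    rintro (i | i)
    · exact σ.obj_eq i
    · exact τ.obj_eq i⟩

/-- Rename in `Γ`, leaving the channel of `x` alone. -/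
def cons (x : O) (σ : Renaming Γ Γ') : Renaming (x ∷ Γ) (x ∷ Γ') := append (refl _) σ

/-- Equal objects give the same one-channel context. -/
def single {x y : O} (h : x = y) : Renaming (Ctx.single x) (Ctx.single y) :=
  ⟨Equiv.refl _, fun _ => h.symm⟩

def assoc (Γ Δ Θ : Ctx O) : Renaming ((Γ ⧺ Δ) ⧺ Θ) (Γ ⧺ (Δ ⧺ Θ)) :=
  ⟨Equiv.sumAssoc _ _ _, by rintro ((i | i) | i) <;> rfl⟩

def comm (Γ Δ : Ctx O) : Renaming (Γ ⧺ Δ) (Δ ⧺ Γ) :=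
  ⟨Equiv.sumComm _ _, by rintro (i | i) <;> rfl⟩

def leftComm (Γ Δ Θ : Ctx O) : Renaming (Γ ⧺ (Δ ⧺ Θ)) (Δ ⧺ (Γ ⧺ Θ)) :=
  ((assoc Γ Δ Θ).symm.trans ((comm Γ Δ).append (refl Θ))).trans (assoc Δ Γ Θ)

def rightComm (Γ Δ Θ : Ctx O) : Renaming ((Γ ⧺ Δ) ⧺ Θ) ((Γ ⧺ Θ) ⧺ Δ) :=
  ((assoc Γ Δ Θ).trans ((refl Γ).append (comm Δ Θ))).trans (assoc Γ Θ Δ).symm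

def emptyAppend (Γ : Ctx O) : Renaming (Ctx.empty ⧺ Γ) Γ :=
  ⟨Equiv.emptySum Empty _, by rintro (i | i); exacts [i.elim, rfl]⟩

def appendEmpty (Γ : Ctx O) : Renaming (Γ ⧺ Ctx.empty) Γ :=
  ⟨Equiv.sumEmpty _ Empty, by rintro (i | i); exacts [rfl, i.elim]⟩

/-- `x` is `x, ∅`. -/
def unit (x : O) : Renaming (Ctx.single x) (x ∷ Ctx.empty) := (appendEmpty _).symm

def consAppend (x : O) (Γ Δ : Ctx O) : Renaming ((x ∷ Γ) ⧺ Δ) (x ∷ (Γ ⧺ Δ)) := assoc _ _ _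

def appendCons (Γ : Ctx O) (x : O) (Δ : Ctx O) : Renaming (Γ ⧺ (x ∷ Δ)) (x ∷ (Γ ⧺ Δ)) :=
  leftComm _ _ _

def swap (x y : O) (Γ : Ctx O) : Renaming (x ∷ y ∷ Γ) (y ∷ x ∷ Γ) := leftComm _ _ _

def map {O' : Type u'} (F : O → O') (σ : Renaming Γ Δ) : Renaming (Γ.map F) (Δ.map F) :=
  ⟨σ.equiv, fun i => congrArg F (σ.obj_eq i)⟩

def mapAppend {O' : Type u'} (F : O → O') (Γ Δ : Ctx O) :
    Renaming ((Γ ⧺ Δ).map F) (Γ.map F ⧺ Δ.map F) :=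
  ⟨Equiv.refl _, by rintro (i | i) <;> rfl⟩

def mapCons {O' : Type u'} (F : O → O') (x : O) (Γ : Ctx O) :
    Renaming ((x ∷ Γ).map F) (F x ∷ Γ.map F) := mapAppend F (Ctx.single x) Γ

end Renaming

open Renaming

/-! ### (Symmetric) polycategories -/

/-- The data of a symmetric polycategory: objects, polymorphisms `Γ ⟶ Δ`, the symmetric action
(renaming of channels), identities, and cut on one object. A cut at any other position is obtained
by renaming channels. -/
structure PolyData where
  Obj : Type u
  Hom : Ctx Obj → Ctx Obj → Type v
  ren : ∀ {Γ Γ' Δ Δ' : Ctx Obj}, Renaming Γ Γ' → Renaming Δ Δ' → Hom Γ Δ → Hom Γ' Δ'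
  id : ∀ x : Obj, Hom (Ctx.single x) (Ctx.single x)
  cut : ∀ {Γ Δ Γ' Δ' : Ctx Obj} {x : Obj},
    Hom Γ (x ∷ Δ) → Hom (x ∷ Γ') Δ' → Hom (Γ ⧺ Γ') (Δ ⧺ Δ')

namespace PolyData

/-- Rename channels in the domain only. -/
abbrev renL (P : PolyData.{u, v}) {Γ Γ' Δ : Ctx P.Obj} (σ : Renaming Γ Γ') (f : P.Hom Γ Δ) :
    P.Hom Γ' Δ := P.ren σ (refl Δ) f

/-- Rename channels in the codomain only. -/
abbrev renR (P : PolyData.{u, v}) {Γ Δ Δ' : Ctx P.Obj} (τ : Renaming Δ Δ') (f : P.Hom Γ Δ) :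
    P.Hom Γ Δ' := P.ren (refl Γ) τ f

/-- The laws of a symmetric polycategory. -/
structure IsPolycategory (P : PolyData.{u, v}) : Prop where
  ren_refl : ∀ {Γ Δ : Ctx P.Obj} (f : P.Hom Γ Δ), P.ren (refl Γ) (refl Δ) f = f
  ren_trans : ∀ {Γ Γ' Γ'' Δ Δ' Δ'' : Ctx P.Obj} (σ : Renaming Γ Γ') (σ' : Renaming Γ' Γ'')
    (τ : Renaming Δ Δ') (τ' : Renaming Δ' Δ'') (f : P.Hom Γ Δ),
    P.ren σ' τ' (P.ren σ τ f) = P.ren (σ.trans σ') (τ.trans τ') f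
  ren_cut : ∀ {Γ₁ Γ₁' Δ₁ Δ₁' Γ₂ Γ₂' Δ₂ Δ₂' : Ctx P.Obj} {x : P.Obj}
    (σ₁ : Renaming Γ₁ Γ₁') (τ₁ : Renaming Δ₁ Δ₁') (σ₂ : Renaming Γ₂ Γ₂') (τ₂ : Renaming Δ₂ Δ₂')
    (f : P.Hom Γ₁ (x ∷ Δ₁)) (g : P.Hom (x ∷ Γ₂) Δ₂),
    P.ren (σ₁.append σ₂) (τ₁.append τ₂) (P.cut f g)
      = P.cut (P.ren σ₁ (τ₁.cons x) f) (P.ren (σ₂.cons x) τ₂ g)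
  id_cut : ∀ {Γ Δ : Ctx P.Obj} {x : P.Obj} (f : P.Hom (x ∷ Γ) Δ),
    P.renR (emptyAppend Δ) (P.cut (P.renR (unit x) (P.id x)) f) = f
  cut_id : ∀ {Γ Δ : Ctx P.Obj} {x : P.Obj} (f : P.Hom Γ (x ∷ Δ)),
    P.ren (appendEmpty Γ) (comm Δ (Ctx.single x)) (P.cut f (P.renL (unit x) (P.id x))) = f
  cut_assoc : ∀ {Γ Δ Γ' Δ' Γ'' Δ'' : Ctx P.Obj} {x y : P.Obj}
    (f : P.Hom Γ (x ∷ Δ)) (g : P.Hom (x ∷ Γ') (y ∷ Δ')) (h : P.Hom (y ∷ Γ'') Δ''),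
    P.ren (assoc Γ Γ' Γ'') (assoc Δ Δ' Δ'') (P.cut (P.renR (appendCons Δ y Δ') (P.cut f g)) h)
      = P.cut f (P.renL (consAppend x Γ' Γ'') (P.cut g h))
  interchange_cod : ∀ {Γ Δ Γ' Δ' Γ'' Δ'' : Ctx P.Obj} {x y : P.Obj}
    (f : P.Hom Γ (x ∷ y ∷ Δ)) (g : P.Hom (x ∷ Γ') Δ') (h : P.Hom (y ∷ Γ'') Δ''),
    P.ren (rightComm Γ Γ' Γ'') (rightComm Δ Δ' Δ'')
        (P.cut (P.renR (consAppend y Δ Δ') (P.cut f g)) h)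
      = P.cut (P.renR (consAppend x Δ Δ'') (P.cut (P.renR (swap x y Δ) f) h)) g
  interchange_dom : ∀ {Γ Δ Γ' Δ' Γ'' Δ'' : Ctx P.Obj} {x y : P.Obj}
    (f : P.Hom Γ (x ∷ Δ)) (g : P.Hom Γ' (y ∷ Δ')) (h : P.Hom (x ∷ y ∷ Γ'') Δ''),
    P.ren (leftComm Γ' Γ Γ'') (leftComm Δ' Δ Δ'')
        (P.cut g (P.renL (appendCons Γ y Γ'') (P.cut f h)))
      = P.cut f (P.renL (appendCons Γ' x Γ'') (P.cut g (P.renL (swap x y Γ'') h)))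

end PolyData

/-- Morphisms of polycategories. -/
@[ext]
structure Morphism (P : PolyData.{u, v}) (Q : PolyData.{u', v'}) where
  obj : P.Obj → Q.Obj
  map : ∀ {Γ Δ : Ctx P.Obj}, P.Hom Γ Δ → Q.Hom (Γ.map obj) (Δ.map obj)
  map_id : ∀ x, map (P.id x) = Q.id (obj x)
  map_ren : ∀ {Γ Γ' Δ Δ' : Ctx P.Obj} (σ : Renaming Γ Γ') (τ : Renaming Δ Δ') (f : P.Hom Γ Δ),
    map (P.ren σ τ f) = Q.ren (σ.map obj) (τ.map obj) (map f)
  map_cut : ∀ {Γ Δ Γ' Δ' : Ctx P.Obj} {x : P.Obj} (f : P.Hom Γ (x ∷ Δ)) (g : P.Hom (x ∷ Γ') Δ'),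
    Q.ren (mapAppend obj Γ Γ') (mapAppend obj Δ Δ') (map (P.cut f g))
      = Q.cut (Q.renR (mapCons obj x Δ) (map f)) (Q.renL (mapCons obj x Γ') (map g))

/-- Composition of morphisms of polycategories, first `F`, then `G`. -/
def Morphism.comp {P : PolyData.{u, v}} {Q : PolyData.{u', v'}} {R : PolyData.{u'', v''}}
    (hR : R.IsPolycategory) (F : Morphism P Q) (G : Morphism Q R) : Morphism P R where
  obj x := G.obj (F.obj x)
  map f := G.map (F.map f)
  map_id x := by rw [F.map_id]; exact G.map_id _
  map_ren σ τ f := by rw [F.map_ren, G.map_ren]; rfl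
  map_cut {Γ Δ Γ' Δ' x} f g := by
    have h := congrArg (fun k => R.ren (mapAppend G.obj _ _) (mapAppend G.obj _ _) (G.map k))
      (F.map_cut f g)
    simp only [G.map_ren, G.map_cut, hR.ren_trans] at h
    exact h

/-! ### Poly-sums and poly-products -/

/-- `S` is a poly-sum of the `X i`: the operation `cot`, `{fᵢ}ᵢ ↦ α{fᵢ}ᵢ`, is a two-way and
poly-natural correspondence between families `Γ, α : X i ⟶ Δ` and polymorphisms `Γ, α : S ⟶ Δ`. -/
structure IsPolySum (P : PolyData.{u, v}) {I : Type} (X : I → P.Obj) (S : P.Obj)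
    (cot : ∀ {Γ Δ : Ctx P.Obj}, (∀ i, P.Hom (X i ∷ Γ) Δ) → P.Hom (S ∷ Γ) Δ) : Prop where
  bijective : ∀ Γ Δ : Ctx P.Obj, Function.Bijective (cot (Γ := Γ) (Δ := Δ))
  ren_cot : ∀ {Γ Γ' Δ Δ' : Ctx P.Obj} (σ : Renaming Γ Γ') (τ : Renaming Δ Δ')
    (f : ∀ i, P.Hom (X i ∷ Γ) Δ),
    P.ren (σ.cons S) τ (cot f) = cot (fun i => P.ren (σ.cons (X i)) τ (f i))
  cot_cut : ∀ {Γ Δ Γ' Δ' : Ctx P.Obj} {z : P.Obj}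
    (f : ∀ i, P.Hom (X i ∷ Γ) (z ∷ Δ)) (h : P.Hom (z ∷ Γ') Δ'),
    P.renL (consAppend S Γ Γ') (P.cut (cot f) h)
      = cot (fun i => P.renL (consAppend (X i) Γ Γ') (P.cut (f i) h))
  cut_cot : ∀ {Γ Δ Γ' Δ' : Ctx P.Obj} {z : P.Obj}
    (h : P.Hom Γ (z ∷ Δ)) (f : ∀ i, P.Hom (X i ∷ z ∷ Γ') Δ'),
    P.renL (appendCons Γ S Γ') (P.cut h (P.renL (swap S z Γ') (cot f)))
      = cot (fun i => P.renL (appendCons Γ (X i) Γ') (P.cut h (P.renL (swap (X i) z Γ') (f i))))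

/-- `T` is a poly-product of the `Y i`: the dual notion. -/
structure IsPolyProd (P : PolyData.{u, v}) {I : Type} (Y : I → P.Obj) (T : P.Obj)
    (tup : ∀ {Γ Δ : Ctx P.Obj}, (∀ i, P.Hom Γ (Y i ∷ Δ)) → P.Hom Γ (T ∷ Δ)) : Prop where
  bijective : ∀ Γ Δ : Ctx P.Obj, Function.Bijective (tup (Γ := Γ) (Δ := Δ))
  ren_tup : ∀ {Γ Γ' Δ Δ' : Ctx P.Obj} (σ : Renaming Γ Γ') (τ : Renaming Δ Δ')
    (f : ∀ i, P.Hom Γ (Y i ∷ Δ)),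
    P.ren σ (τ.cons T) (tup f) = tup (fun i => P.ren σ (τ.cons (Y i)) (f i))
  cut_tup : ∀ {Γ Δ Γ' Δ' : Ctx P.Obj} {z : P.Obj}
    (h : P.Hom Γ (z ∷ Δ)) (f : ∀ i, P.Hom (z ∷ Γ') (Y i ∷ Δ')),
    P.renR (appendCons Δ T Δ') (P.cut h (tup f))
      = tup (fun i => P.renR (appendCons Δ (Y i) Δ') (P.cut h (f i)))
  tup_cut : ∀ {Γ Δ Γ' Δ' : Ctx P.Obj} {z : P.Obj}
    (f : ∀ i, P.Hom Γ (Y i ∷ z ∷ Δ)) (h : P.Hom (z ∷ Γ') Δ'),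
    P.renR (consAppend T Δ Δ') (P.cut (P.renR (swap T z Δ) (tup f)) h)
      = tup (fun i => P.renR (consAppend (Y i) Δ Δ') (P.cut (P.renR (swap (Y i) z Δ) (f i)) h))

/-- A choice, for every finite family of objects, of two objects (the candidate poly-sum and
poly-product) and of a cotupling and a tupling operation. -/
structure SumProdData (P : PolyData.{u, v}) where
  sum : ∀ {I : Type} [Finite I], (I → P.Obj) → P.Obj
  cotuple : ∀ {I : Type} [Finite I] (X : I → P.Obj) {Γ Δ : Ctx P.Obj},
    (∀ i, P.Hom (X i ∷ Γ) Δ) → P.Hom (sum X ∷ Γ) Δ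
  prod : ∀ {I : Type} [Finite I], (I → P.Obj) → P.Obj
  tuple : ∀ {I : Type} [Finite I] (Y : I → P.Obj) {Γ Δ : Ctx P.Obj},
    (∀ i, P.Hom Γ (Y i ∷ Δ)) → P.Hom Γ (prod Y ∷ Δ)

/-- The chosen objects and operations are finite poly-sums and finite poly-products. -/
structure SumProdData.IsFiniteSumProd {P : PolyData.{u, v}} (S : SumProdData P) : Prop where
  isPolySum : ∀ {I : Type} [Finite I] (X : I → P.Obj), IsPolySum P X (S.sum X) (S.cotuple X)
  isPolyProd : ∀ {I : Type} [Finite I] (Y : I → P.Obj), IsPolyProd P Y (S.prod Y) (S.tuple Y)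

/-- A morphism of polycategories that preserves the chosen poly-sums and poly-products: on objects,
and together with the correspondences that exhibit them as such. -/
structure Morphism.PreservesSumProd {P : PolyData.{u, v}} {Q : PolyData.{u', v'}}
    (G : Morphism P Q) (S : SumProdData P) (T : SumProdData Q) : Prop where
  obj_sum : ∀ {I : Type} [Finite I] (X : I → P.Obj),
    G.obj (S.sum X) = T.sum (fun i => G.obj (X i))
  map_cotuple : ∀ {I : Type} [Finite I] (X : I → P.Obj) {Γ Δ : Ctx P.Obj}
    (f : ∀ i, P.Hom (X i ∷ Γ) Δ),
    Q.renL ((mapCons G.obj (S.sum X) Γ).trans ((single (obj_sum X)).append (refl (Γ.map G.obj))))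
        (G.map (S.cotuple X f))
      = T.cotuple (fun i => G.obj (X i)) (fun i => Q.renL (mapCons G.obj (X i) Γ) (G.map (f i)))
  obj_prod : ∀ {I : Type} [Finite I] (Y : I → P.Obj),
    G.obj (S.prod Y) = T.prod (fun i => G.obj (Y i))
  map_tuple : ∀ {I : Type} [Finite I] (Y : I → P.Obj) {Γ Δ : Ctx P.Obj}
    (f : ∀ i, P.Hom Γ (Y i ∷ Δ)),
    Q.renR ((mapCons G.obj (S.prod Y) Δ).trans ((single (obj_prod Y)).append (refl (Δ.map G.obj))))
        (G.map (S.tuple Y f))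
      = T.tuple (fun i => G.obj (Y i)) (fun i => Q.renR (mapCons G.obj (Y i) Δ) (G.map (f i)))

/-! ### The logic -/

/-- Formulas: atoms, and sums and products of finite families. -/
inductive Fml (O : Type u) : Type (max 1 u) where
  | atom : O → Fml O
  | sum {I : Type} [Finite I] (X : I → Fml O) : Fml O
  | prod {I : Type} [Finite I] (Y : I → Fml O) : Fml O

/-- Derivations over the polycategory `A`. The rule `ax` gives the non-logical axioms (the identity
axiom on an atom `a` is `ax (A.id a)`); `exch` renames channels; the other rules act on the first
channel of an antecedent or succedent. -/
inductive Deriv (A : PolyData.{u, v}) :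
    Ctx (Fml A.Obj) → Ctx (Fml A.Obj) → Type (max 1 u v) where
  | ax {Γ Δ : Ctx A.Obj} : A.Hom Γ Δ → Deriv A (Γ.map Fml.atom) (Δ.map Fml.atom)
  | exch {Γ Γ' Δ Δ' : Ctx (Fml A.Obj)} :
      Renaming Γ Γ' → Renaming Δ Δ' → Deriv A Γ Δ → Deriv A Γ' Δ'
  | cotuple {I : Type} [Finite I] {X : I → Fml A.Obj} {Γ Δ : Ctx (Fml A.Obj)} :
      (∀ i, Deriv A (X i ∷ Γ) Δ) → Deriv A (Fml.sum X ∷ Γ) Δ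
  | tuple {I : Type} [Finite I] {Y : I → Fml A.Obj} {Γ Δ : Ctx (Fml A.Obj)} :
      (∀ i, Deriv A Γ (Y i ∷ Δ)) → Deriv A Γ (Fml.prod Y ∷ Δ)
  | proj {I : Type} [Finite I] {X : I → Fml A.Obj} {Γ Δ : Ctx (Fml A.Obj)} (k : I) :
      Deriv A (X k ∷ Γ) Δ → Deriv A (Fml.prod X ∷ Γ) Δ
  | inj {I : Type} [Finite I] {Y : I → Fml A.Obj} {Γ Δ : Ctx (Fml A.Obj)} (k : I) :
      Deriv A Γ (Y k ∷ Δ) → Deriv A Γ (Fml.sum Y ∷ Δ)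
  | cut {Z : Fml A.Obj} {Γ Δ Γ' Δ' : Ctx (Fml A.Obj)} :
      Deriv A Γ (Z ∷ Δ) → Deriv A (Z ∷ Γ') Δ' → Deriv A (Γ ⧺ Γ') (Δ ⧺ Δ')

namespace Deriv

variable {A : PolyData.{u, v}}

abbrev exchL {Γ Γ' Δ : Ctx (Fml A.Obj)} (σ : Renaming Γ Γ') (f : Deriv A Γ Δ) : Deriv A Γ' Δ :=
  exch σ (refl Δ) f

abbrev exchR {Γ Δ Δ' : Ctx (Fml A.Obj)} (τ : Renaming Δ Δ') (f : Deriv A Γ Δ) : Deriv A Γ Δ' :=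
  exch (refl Γ) τ f

/-- The identity axiom on an atom. -/
def idAtom (a : A.Obj) : Deriv A (Ctx.single (Fml.atom a)) (Ctx.single (Fml.atom a)) :=
  ax (A.id a)

/-- The identity derivation on a formula. -/
def idDeriv : (X : Fml A.Obj) → Deriv A (Ctx.single X) (Ctx.single X)
  | .atom a => idAtom a
  | @Fml.sum _ _ _ X => exchL (unit _).symm
      (cotuple (X := X) fun i => exch (unit _) (unit _).symm (inj (Y := X) i (exchR (unit _) (idDeriv (X i)))))
  | @Fml.prod _ _ _ Y => exchR (unit _).symm
      (tuple (Y := Y) fun i => exch (unit _).symm (unit _) (proj (X := Y) i (exchL (unit _) (idDeriv (Y i)))))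

end Deriv

open Deriv

/-- The equivalence relation `∼` on derivations of a sequent: the congruence generated by the
cut-elimination reductions, the permuting conversions, the evaluation of cuts between axioms in `A`, and the fact that renaming of channels is functorial and commutes with all
rules. -/
inductive Conv (A : PolyData.{u, v}) :
    ∀ {Γ Δ : Ctx (Fml A.Obj)}, Deriv A Γ Δ → Deriv A Γ Δ → Prop
  -- equivalence relation
  | rfl {Γ Δ} (f : Deriv A Γ Δ) : Conv A f f
  | symm {Γ Δ} {f g : Deriv A Γ Δ} : Conv A f g → Conv A g f
  | trans {Γ Δ} {f g h : Deriv A Γ Δ} : Conv A f g → Conv A g h → Conv A f h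
  -- congruence
  | congr_exch {Γ Γ' Δ Δ'} (σ : Renaming Γ Γ') (τ : Renaming Δ Δ') {f g : Deriv A Γ Δ} :
      Conv A f g → Conv A (exch σ τ f) (exch σ τ g)
  | congr_cotuple {I : Type} [Finite I] {X : I → Fml A.Obj} {Γ Δ}
      {f g : ∀ i, Deriv A (X i ∷ Γ) Δ} :
      (∀ i, Conv A (f i) (g i)) → Conv A (cotuple f) (cotuple g)
  | congr_tuple {I : Type} [Finite I] {Y : I → Fml A.Obj} {Γ Δ}
      {f g : ∀ i, Deriv A Γ (Y i ∷ Δ)} :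
      (∀ i, Conv A (f i) (g i)) → Conv A (tuple f) (tuple g)
  | congr_proj {I : Type} [Finite I] {X : I → Fml A.Obj} {Γ Δ} (k : I)
      {f g : Deriv A (X k ∷ Γ) Δ} :
      Conv A f g → Conv A (proj (X := X) k f) (proj (X := X) k g)
  | congr_inj {I : Type} [Finite I] {Y : I → Fml A.Obj} {Γ Δ} (k : I)
      {f g : Deriv A Γ (Y k ∷ Δ)} :
      Conv A f g → Conv A (inj (Y := Y) k f) (inj (Y := Y) k g)
  | congr_cut {Z : Fml A.Obj} {Γ Δ Γ' Δ'} {f f' : Deriv A Γ (Z ∷ Δ)} {g g' : Deriv A (Z ∷ Γ') Δ'} :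
      Conv A f f' → Conv A g g' → Conv A (cut f g) (cut f' g')
  -- renaming of channels
  | exch_refl {Γ Δ} (f : Deriv A Γ Δ) : Conv A (exch (refl Γ) (refl Δ) f) f
  | exch_trans {Γ Γ' Γ'' Δ Δ' Δ''} (σ : Renaming Γ Γ') (σ' : Renaming Γ' Γ'')
      (τ : Renaming Δ Δ') (τ' : Renaming Δ' Δ'') (f : Deriv A Γ Δ) :
      Conv A (exch σ' τ' (exch σ τ f)) (exch (σ.trans σ') (τ.trans τ') f)
  | exch_ax {Γ Γ' Δ Δ' : Ctx A.Obj} (σ : Renaming Γ Γ') (τ : Renaming Δ Δ') (f : A.Hom Γ Δ) :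
      Conv A (exch (σ.map Fml.atom) (τ.map Fml.atom) (ax f)) (ax (A.ren σ τ f))
  | exch_cotuple {I : Type} [Finite I] {X : I → Fml A.Obj} {Γ Γ' Δ Δ'}
      (σ : Renaming Γ Γ') (τ : Renaming Δ Δ') (f : ∀ i, Deriv A (X i ∷ Γ) Δ) :
      Conv A (exch (σ.cons (Fml.sum X)) τ (cotuple f))
        (cotuple fun i => exch (σ.cons (X i)) τ (f i))
  | exch_tuple {I : Type} [Finite I] {Y : I → Fml A.Obj} {Γ Γ' Δ Δ'}
      (σ : Renaming Γ Γ') (τ : Renaming Δ Δ') (f : ∀ i, Deriv A Γ (Y i ∷ Δ)) :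
      Conv A (exch σ (τ.cons (Fml.prod Y)) (tuple f))
        (tuple fun i => exch σ (τ.cons (Y i)) (f i))
  | exch_proj {I : Type} [Finite I] {X : I → Fml A.Obj} {Γ Γ' Δ Δ'} (k : I)
      (σ : Renaming Γ Γ') (τ : Renaming Δ Δ') (f : Deriv A (X k ∷ Γ) Δ) :
      Conv A (exch (σ.cons (Fml.prod X)) τ (proj k f)) (proj k (exch (σ.cons (X k)) τ f))
  | exch_inj {I : Type} [Finite I] {Y : I → Fml A.Obj} {Γ Γ' Δ Δ'} (k : I)
      (σ : Renaming Γ Γ') (τ : Renaming Δ Δ') (f : Deriv A Γ (Y k ∷ Δ)) :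
      Conv A (exch σ (τ.cons (Fml.sum Y)) (inj k f)) (inj k (exch σ (τ.cons (Y k)) f))
  | exch_cut {Z : Fml A.Obj} {Γ₁ Γ₁' Δ₁ Δ₁' Γ₂ Γ₂' Δ₂ Δ₂'}
      (σ₁ : Renaming Γ₁ Γ₁') (τ₁ : Renaming Δ₁ Δ₁') (σ₂ : Renaming Γ₂ Γ₂') (τ₂ : Renaming Δ₂ Δ₂')
      (f : Deriv A Γ₁ (Z ∷ Δ₁)) (g : Deriv A (Z ∷ Γ₂) Δ₂) :
      Conv A (exch (σ₁.append σ₂) (τ₁.append τ₂) (cut f g))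
        (cut (exch σ₁ (τ₁.cons Z) f) (exch (σ₂.cons Z) τ₂ g))
  -- cuts between axioms are evaluated in `A`
  | ax_cut {Γ Δ Γ' Δ' : Ctx A.Obj} {a : A.Obj} (f : A.Hom Γ (a ∷ Δ)) (g : A.Hom (a ∷ Γ') Δ') :
      Conv A
        (cut (exchR (mapCons Fml.atom a Δ) (ax f)) (exchL (mapCons Fml.atom a Γ') (ax g)))
        (exch (mapAppend Fml.atom Γ Γ') (mapAppend Fml.atom Δ Δ') (ax (A.cut f g)))
  -- cut-elimination reductions
  | cut_idAtom {Γ Δ} {a : A.Obj} (f : Deriv A Γ (Fml.atom a ∷ Δ)) :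
      Conv A
        (exch (appendEmpty Γ) (comm Δ (Ctx.single (Fml.atom a)))
          (cut f (exchL (unit _) (idAtom a))))
        f
  | idAtom_cut {Γ Δ} {a : A.Obj} (f : Deriv A (Fml.atom a ∷ Γ) Δ) :
      Conv A (exchR (emptyAppend Δ) (cut (exchR (unit _) (idAtom a)) f)) f
  | cotuple_cut {I : Type} [Finite I] {X : I → Fml A.Obj} {Z : Fml A.Obj} {Γ Δ Γ' Δ'}
      (f : ∀ i, Deriv A (X i ∷ Γ) (Z ∷ Δ)) (g : Deriv A (Z ∷ Γ') Δ') :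
      Conv A (exchL (consAppend _ Γ Γ') (cut (cotuple f) g))
        (cotuple fun i => exchL (consAppend _ Γ Γ') (cut (f i) g))
  | cut_tuple {I : Type} [Finite I] {Y : I → Fml A.Obj} {Z : Fml A.Obj} {Γ Δ Γ' Δ'}
      (f : Deriv A Γ (Z ∷ Δ)) (g : ∀ i, Deriv A (Z ∷ Γ') (Y i ∷ Δ')) :
      Conv A (exchR (appendCons Δ _ Δ') (cut f (tuple g)))
        (tuple fun i => exchR (appendCons Δ _ Δ') (cut f (g i)))
  | inj_cut {I : Type} [Finite I] {Y : I → Fml A.Obj} {Z : Fml A.Obj} {Γ Δ Γ' Δ'} (k : I)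
      (f : Deriv A Γ (Y k ∷ Z ∷ Δ)) (g : Deriv A (Z ∷ Γ') Δ') :
      Conv A
        (exchR (consAppend _ Δ Δ') (cut (exchR (swap _ Z Δ) (inj (Y := Y) k f)) g))
        (inj k (exchR (consAppend _ Δ Δ') (cut (exchR (swap _ Z Δ) f) g)))
  | cut_proj {I : Type} [Finite I] {X : I → Fml A.Obj} {Z : Fml A.Obj} {Γ Δ Γ' Δ'} (k : I)
      (f : Deriv A Γ (Z ∷ Δ)) (g : Deriv A (X k ∷ Z ∷ Γ') Δ') :
      Conv A
        (exchL (appendCons Γ _ Γ') (cut f (exchL (swap _ Z Γ') (proj (X := X) k g))))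
        (proj k (exchL (appendCons Γ _ Γ') (cut f (exchL (swap _ Z Γ') g))))
  | proj_cut {I : Type} [Finite I] {X : I → Fml A.Obj} {Z : Fml A.Obj} {Γ Δ Γ' Δ'} (k : I)
      (f : Deriv A (X k ∷ Γ) (Z ∷ Δ)) (g : Deriv A (Z ∷ Γ') Δ') :
      Conv A (exchL (consAppend _ Γ Γ') (cut (proj (X := X) k f) g))
        (proj k (exchL (consAppend _ Γ Γ') (cut f g)))
  | cut_inj {I : Type} [Finite I] {Y : I → Fml A.Obj} {Z : Fml A.Obj} {Γ Δ Γ' Δ'} (k : I)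
      (f : Deriv A Γ (Z ∷ Δ)) (g : Deriv A (Z ∷ Γ') (Y k ∷ Δ')) :
      Conv A (exchR (appendCons Δ _ Δ') (cut f (inj (Y := Y) k g)))
        (inj k (exchR (appendCons Δ _ Δ') (cut f g)))
  | tuple_cut {I : Type} [Finite I] {Y : I → Fml A.Obj} {Z : Fml A.Obj} {Γ Δ Γ' Δ'}
      (f : ∀ i, Deriv A Γ (Y i ∷ Z ∷ Δ)) (g : Deriv A (Z ∷ Γ') Δ') :
      Conv A
        (exchR (consAppend _ Δ Δ') (cut (exchR (swap _ Z Δ) (tuple f)) g))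
        (tuple fun i => exchR (consAppend _ Δ Δ') (cut (exchR (swap _ Z Δ) (f i)) g))
  | cut_cotuple {I : Type} [Finite I] {X : I → Fml A.Obj} {Z : Fml A.Obj} {Γ Δ Γ' Δ'}
      (f : Deriv A Γ (Z ∷ Δ)) (g : ∀ i, Deriv A (X i ∷ Z ∷ Γ') Δ') :
      Conv A
        (exchL (appendCons Γ _ Γ') (cut f (exchL (swap _ Z Γ') (cotuple g))))
        (cotuple fun i => exchL (appendCons Γ _ Γ') (cut f (exchL (swap _ Z Γ') (g i))))
  | inj_cut_cotuple {I : Type} [Finite I] {X : I → Fml A.Obj} {Γ Δ Γ' Δ'} (k : I)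
      (f : Deriv A Γ (X k ∷ Δ)) (g : ∀ i, Deriv A (X i ∷ Γ') Δ') :
      Conv A (cut (inj k f) (cotuple g)) (cut f (g k))
  | tuple_cut_proj {I : Type} [Finite I] {X : I → Fml A.Obj} {Γ Δ Γ' Δ'} (k : I)
      (f : ∀ i, Deriv A Γ (X i ∷ Δ)) (g : Deriv A (X k ∷ Γ') Δ') :
      Conv A (cut (tuple f) (proj k g)) (cut (f k) g)
  -- permuting conversions
  | cotuple_cotuple {I J : Type} [Finite I] [Finite J] {X : I → Fml A.Obj} {Y : J → Fml A.Obj} {Γ Δ}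
      (f : ∀ i j, Deriv A (X i ∷ Y j ∷ Γ) Δ) :
      Conv A
        (cotuple fun i => exchL (swap _ _ Γ) (cotuple fun j => exchL (swap _ _ Γ) (f i j)))
        (exchL (swap _ _ Γ) (cotuple fun j => exchL (swap _ _ Γ) (cotuple fun i => f i j)))
  | tuple_tuple {I J : Type} [Finite I] [Finite J] {X : I → Fml A.Obj} {Y : J → Fml A.Obj} {Γ Δ}
      (f : ∀ i j, Deriv A Γ (X i ∷ Y j ∷ Δ)) :
      Conv A
        (tuple fun i => exchR (swap _ _ Δ) (tuple fun j => exchR (swap _ _ Δ) (f i j)))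
        (exchR (swap _ _ Δ) (tuple fun j => exchR (swap _ _ Δ) (tuple fun i => f i j)))
  | cotuple_inj {I J : Type} [Finite I] [Finite J] {X : I → Fml A.Obj} {Y : J → Fml A.Obj} {Γ Δ} (k : J)
      (f : ∀ i, Deriv A (X i ∷ Γ) (Y k ∷ Δ)) :
      Conv A (cotuple fun i => inj (Y := Y) k (f i)) (inj k (cotuple f))
  | proj_tuple {I J : Type} [Finite I] [Finite J] {X : I → Fml A.Obj} {Y : J → Fml A.Obj} {Γ Δ} (k : I)
      (g : ∀ j, Deriv A (X k ∷ Γ) (Y j ∷ Δ)) :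
      Conv A (proj (X := X) k (tuple g)) (tuple fun j => proj k (g j))
  | cotuple_proj {I J : Type} [Finite I] [Finite J] {X : I → Fml A.Obj} {Y : J → Fml A.Obj} {Γ Δ} (k : J)
      (f : ∀ i, Deriv A (X i ∷ Y k ∷ Γ) Δ) :
      Conv A
        (cotuple fun i => exchL (swap _ _ Γ) (proj (X := Y) k (exchL (swap _ _ Γ) (f i))))
        (exchL (swap _ _ Γ) (proj k (exchL (swap _ _ Γ) (cotuple f))))
  | inj_tuple {I J : Type} [Finite I] [Finite J] {X : I → Fml A.Obj} {Y : J → Fml A.Obj} {Γ Δ} (k : I)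
      (g : ∀ j, Deriv A Γ (X k ∷ Y j ∷ Δ)) :
      Conv A
        (inj (Y := X) k (exchR (swap _ _ Δ) (tuple fun j => exchR (swap _ _ Δ) (g j))))
        (exchR (swap _ _ Δ) (tuple fun j => exchR (swap _ _ Δ) (inj k (g j))))
  | cotuple_tuple {I J : Type} [Finite I] [Finite J] {X : I → Fml A.Obj} {Y : J → Fml A.Obj} {Γ Δ}
      (f : ∀ i j, Deriv A (X i ∷ Γ) (Y j ∷ Δ)) :
      Conv A (cotuple fun i => tuple fun j => f i j) (tuple fun j => cotuple fun i => f i j)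
  | inj_inj {I J : Type} [Finite I] [Finite J] {X : I → Fml A.Obj} {Y : J → Fml A.Obj} {Γ Δ}
      (k : I) (l : J) (f : Deriv A Γ (X k ∷ Y l ∷ Δ)) :
      Conv A
        (inj (Y := X) k (exchR (swap _ _ Δ) (inj (Y := Y) l (exchR (swap _ _ Δ) f))))
        (exchR (swap _ _ Δ) (inj l (exchR (swap _ _ Δ) (inj k f))))
  | proj_proj {I J : Type} [Finite I] [Finite J] {X : I → Fml A.Obj} {Y : J → Fml A.Obj} {Γ Δ}
      (k : I) (l : J) (f : Deriv A (X k ∷ Y l ∷ Γ) Δ) :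
      Conv A
        (proj (X := X) k (exchL (swap _ _ Γ) (proj (X := Y) l (exchL (swap _ _ Γ) f))))
        (exchL (swap _ _ Γ) (proj l (exchL (swap _ _ Γ) (proj k f))))
  | inj_proj {I J : Type} [Finite I] [Finite J] {X : I → Fml A.Obj} {Y : J → Fml A.Obj} {Γ Δ}
      (k : I) (l : J) (f : Deriv A (Y l ∷ Γ) (X k ∷ Δ)) :
      Conv A (inj (Y := X) k (proj (X := Y) l f)) (proj l (inj k f))

/-- `∼` as a setoid on the derivations of a sequent. -/
def convSetoid (A : PolyData.{u, v}) (Γ Δ : Ctx (Fml A.Obj)) : Setoid (Deriv A Γ Δ) :=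
  ⟨Conv A, ⟨Conv.rfl, Conv.symm, Conv.trans⟩⟩

/-- The data of `ΣΠ_A`: formulas, derivations modulo `∼`, renaming, identity derivations, cut. -/
def sigmaPi (A : PolyData.{u, v}) : PolyData.{max 1 u, max 1 u v} where
  Obj := Fml A.Obj
  Hom Γ Δ := Quotient (convSetoid A Γ Δ)
  ren σ τ := Quotient.map (exch σ τ) fun _ _ h => Conv.congr_exch σ τ h
  id X := Quotient.mk _ (idDeriv X)
  cut := Quotient.map₂ cut fun _ _ hf _ _ hg => Conv.congr_cut hf hg

/-- The sum and product formulas, with the operations induced by the cotuple and tuple rules. -/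
noncomputable def sigmaPiSumProd (A : PolyData.{u, v}) : SumProdData (sigmaPi A) where
  sum X := Fml.sum X
  cotuple _ _ Δ f := Quotient.mk (convSetoid A _ Δ) (cotuple fun i => (f i).out)
  prod Y := Fml.prod Y
  tuple _ Γ _ f := Quotient.mk (convSetoid A Γ _) (tuple fun i => (f i).out)

/-- The chosen operation on classes is the class of the cotuple rule, on any representatives. -/
theorem sigmaPiSumProd_cotuple_mk (A : PolyData.{u, v}) {I : Type} [Finite I] (X : I → Fml A.Obj)
    {Γ Δ : Ctx (Fml A.Obj)} (f : ∀ i, Deriv A (X i ∷ Γ) Δ) :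
    (sigmaPiSumProd A).cotuple X (fun i => Quotient.mk (convSetoid A _ Δ) (f i))
      = Quotient.mk (convSetoid A _ Δ) (cotuple f) :=
  Quotient.sound (s := convSetoid A _ Δ) (Conv.congr_cotuple fun _ =>
    Quotient.exact (s := convSetoid A _ Δ) (Quotient.out_eq _))

/-- The chosen operation on classes is the class of the tuple rule, on any representatives. -/
theorem sigmaPiSumProd_tuple_mk (A : PolyData.{u, v}) {I : Type} [Finite I] (Y : I → Fml A.Obj)
    {Γ Δ : Ctx (Fml A.Obj)} (f : ∀ i, Deriv A Γ (Y i ∷ Δ)) :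
    (sigmaPiSumProd A).tuple Y (fun i => Quotient.mk (convSetoid A Γ _) (f i))
      = Quotient.mk (convSetoid A Γ _) (tuple f) :=
  Quotient.sound (s := convSetoid A Γ _) (Conv.congr_tuple fun _ =>
    Quotient.exact (s := convSetoid A Γ _) (Quotient.out_eq _))

/-- The canonical morphism `A ⟶ ΣΠ_A`: objects to atoms, polymorphisms to axioms. -/
def inclusion (A : PolyData.{u, v}) : Morphism A (sigmaPi A) where
  obj := Fml.atom
  map {Γ Δ} f := Quotient.mk (convSetoid A (Γ.map Fml.atom) (Δ.map Fml.atom)) (ax f)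
  map_id _ := rfl
  map_ren σ τ f := (Quotient.sound (s := convSetoid A _ _) (Conv.exch_ax σ τ f)).symm
  map_cut f g := (Quotient.sound (s := convSetoid A _ _) (Conv.ax_cut f g)).symm

end SigmaPi

open SigmaPi

/-! The theorem describes a term model. Derivations modulo `∼` satisfy the laws because every class
is built without cuts, and they are universal because every conversion holds in any polycategory
with poly-sums and poly-products.

Duality and the symmetric action are absorbed first. Sequents get polarised channels, and `scut`
cuts along two channels of opposite polarity, in either order. Associativity and the two interchange
laws then become the sign patterns of one law, `ScutAssocAt`, and the two identity laws become
`SidScutAt`. Cotupling and tupling are one operation `tup`, injection and projection one operation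
`sel`, and each is a `ChanOp`: an operation on one channel that commutes with renamings and with
cuts on other channels.

Cut elimination (`CutFree.scut`) is an induction on the cut formula and then on both premises. A
rule on another channel commutes with the cut, two axioms are evaluated in `A`, and a selection
against a tupling leaves a cut on an immediate subformula. Associativity (`scutAssocAt_sigmaPi`) is
then a nested induction on the two cut formulas and on cut-free forms of the three polymorphisms.
Rules away from the cut channels pass through both sides of the law. Once the outer polymorphisms
end on their cut channels and the middle one ends on one of the two, a principal reduction leads to
the law at a subformula; three axioms lead to the law in `A`. The identity laws
(`sidScutAt_sigmaPi`) follow the same pattern. As the identity on a compound formula is a tupling of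
selections, every polymorphism is the tupling of its cuts with those selections, which gives part 2
(`tup_bijective`).

For part 3, `B` is pulled back along the interpretation of formulas, so that the interpretation of a
derivation has the sequent of the derivation as its type. The components of the identity on a sum or
product (`leg`) are the injections or projections, and `sel` is a cut with them. Naturality and
bijectivity of tupling yield the principal reductions and the permuting conversions, hence soundness
(`eval_eq_of_conv`). For uniqueness, two morphisms that preserve tuplings agree on identities, hence
on their components, hence on every selection, which is a cut with such a component; the rest is an
induction on derivations. -/

namespace SigmaPi
open Renaming

/-! ### Two-sided sequents with polarised channels -/

namespace Renaming

variable {O : Type u} {Γ Γ' Δ Δ' : Ctx O}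

theorem ext_equiv {σ τ : Renaming Γ Δ} (h : ∀ i, σ.equiv i = τ.equiv i) : σ = τ := by
  obtain ⟨e, he⟩ := σ
  obtain ⟨e', he'⟩ := τ
  obtain rfl : e = e' := Equiv.ext h
  rfl

end Renaming

/-- A sequent `L ⊢ R`. -/
structure Sequent (O : Type u) : Type (max 1 u) where
  L : Ctx O
  R : Ctx O

namespace Sequent

variable {O : Type u}

/-- The empty sequent. -/
def nil : Sequent O := ⟨Ctx.empty, Ctx.empty⟩

/-- Juxtaposition of sequents. -/
def append (S T : Sequent O) : Sequent O := ⟨S.L ⧺ T.L, S.R ⧺ T.R⟩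

/-- Add a channel carrying `x`: on the left if `p = false`, on the right if `p = true`. -/
def cons (p : Bool) (x : O) (S : Sequent O) : Sequent O :=
  match p with
  | false => ⟨x ∷ S.L, S.R⟩
  | true => ⟨S.L, x ∷ S.R⟩

/-- The channels of a sequent. -/
def Chan (S : Sequent O) : Type := S.L.chan ⊕ S.R.chan

/-- The distinguished channel of `cons p x S`. -/
def here {p : Bool} {x : O} {S : Sequent O} : (cons p x S).Chan :=
  match p with
  | false => .inl (.inl ())
  | true => .inr (.inl ())

/-- The other channels of `cons p x S`. -/
def there {p : Bool} {x : O} {S : Sequent O} (c : S.Chan) : (cons p x S).Chan :=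
  match p with
  | false => c.elim (fun i => .inl (.inr i)) .inr
  | true => c.elim .inl (fun i => .inr (.inr i))

def inL {S T : Sequent O} (c : S.Chan) : (append S T).Chan :=
  c.elim (fun i => .inl (.inl i)) (fun i => .inr (.inl i))

def inR {S T : Sequent O} (c : T.Chan) : (append S T).Chan :=
  c.elim (fun i => .inl (.inr i)) (fun i => .inr (.inr i))

-- Channels are exhausted by `here`, `there`, `inL` and `inR`. Together with `ext_app` and the
-- evaluation lemmas for `app`, this lets `simp` prove the equalities of renamings that arise as
-- side conditions.
@[simp] theorem forall_cons {p : Bool} {x : O} {S : Sequent O} {Q : (cons p x S).Chan → Prop} :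
    (∀ c, Q c) ↔ Q here ∧ ∀ c, Q (there c) := by
  refine ⟨fun h => ⟨h _, fun c => h _⟩, fun h => ?_⟩
  cases p
  · rintro ((_ | i) | i)
    exacts [h.1, h.2 (.inl i), h.2 (.inr i)]
  · rintro (i | (_ | i))
    exacts [h.2 (.inl i), h.1, h.2 (.inr i)]

@[simp] theorem forall_append {S T : Sequent O} {Q : (append S T).Chan → Prop} :
    (∀ c, Q c) ↔ (∀ c, Q (inL c)) ∧ ∀ c, Q (inR c) := by
  refine ⟨fun h => ⟨fun c => h _, fun c => h _⟩, fun h => ?_⟩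
  rintro ((i | i) | (i | i))
  exacts [h.1 (.inl i), h.2 (.inl i), h.1 (.inr i), h.2 (.inr i)]

@[simp] theorem forall_nil {Q : (nil : Sequent O).Chan → Prop} : (∀ c, Q c) ↔ True := by
  refine ⟨fun _ => trivial, fun _ => ?_⟩
  rintro (i | i) <;> exact i.elim

/-- Apply a function to all objects of a sequent. -/
def map {O' : Type u'} (F : O → O') (S : Sequent O) : Sequent O' := ⟨S.L.map F, S.R.map F⟩

/-- The channels of `S.map F` are those of `S`. -/
def mapChan {O' : Type u'} (F : O → O') {S : Sequent O} (c : S.Chan) : (S.map F).Chan := c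

@[simp] theorem forall_map {O' : Type u'} {F : O → O'} {S : Sequent O}
    {Q : (S.map F).Chan → Prop} : (∀ c, Q c) ↔ ∀ c : S.Chan, Q (mapChan F c) := Iff.rfl

end Sequent

/-! ### Renamings of sequents and their action on channels -/

open Sequent

/-- Renamings of sequents. -/
@[ext]
structure SRen {O : Type u} (S T : Sequent O) where
  l : Renaming S.L T.L
  r : Renaming S.R T.R

namespace SRen

variable {O : Type u} {S S' T T' U U' : Sequent O} {p q r : Bool} {x y z : O}

/-- The action of a renaming on channels. -/
def app (σ : SRen S T) : S.Chan → T.Chan := Sum.map σ.l.equiv σ.r.equiv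

/-- Preservation of objects is a proposition, so only the two bijections of channels matter. -/
theorem ext_app {σ τ : SRen S T} : σ = τ ↔ ∀ c, σ.app c = τ.app c := by
  refine ⟨fun h _ => h ▸ rfl, fun h => SRen.ext ?_ ?_⟩
  · exact ext_equiv fun i => Sum.inl.inj (h (.inl i))
  · exact ext_equiv fun i => Sum.inr.inj (h (.inr i))

protected def refl (S : Sequent O) : SRen S S := ⟨Renaming.refl _, Renaming.refl _⟩

protected def symm (σ : SRen S T) : SRen T S := ⟨σ.l.symm, σ.r.symm⟩

protected def trans (σ : SRen S T) (τ : SRen T U) : SRen S U := ⟨σ.l.trans τ.l, σ.r.trans τ.r⟩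

protected def cons (p : Bool) (x : O) (σ : SRen S T) : SRen (cons p x S) (cons p x T) :=
  match p with
  | false => ⟨σ.l.cons x, σ.r⟩
  | true => ⟨σ.l, σ.r.cons x⟩

protected def append (σ : SRen S S') (τ : SRen T T') : SRen (S.append T) (S'.append T') :=
  ⟨σ.l.append τ.l, σ.r.append τ.r⟩

protected def assoc (S T U : Sequent O) : SRen ((S.append T).append U) (S.append (T.append U)) :=
  ⟨assoc _ _ _, assoc _ _ _⟩

protected def comm (S T : Sequent O) : SRen (S.append T) (T.append S) := ⟨comm _ _, comm _ _⟩

protected def nilAppend (S : Sequent O) : SRen (nil.append S) S :=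
  ⟨emptyAppend _, emptyAppend _⟩

protected def consAppend (p : Bool) (x : O) (S T : Sequent O) :
    SRen ((cons p x S).append T) (cons p x (S.append T)) :=
  match p with
  | false => ⟨consAppend _ _ _, Renaming.refl _⟩
  | true => ⟨Renaming.refl _, consAppend _ _ _⟩

protected def appendCons (p : Bool) (x : O) (S T : Sequent O) :
    SRen (S.append (cons p x T)) (cons p x (S.append T)) :=
  match p with
  | false => ⟨appendCons _ _ _, Renaming.refl _⟩
  | true => ⟨Renaming.refl _, appendCons _ _ _⟩

protected def leftComm (S T U : Sequent O) :
    SRen (S.append (T.append U)) (T.append (S.append U)) :=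
  ⟨leftComm _ _ _, leftComm _ _ _⟩

protected def rightComm (S T U : Sequent O) :
    SRen ((S.append T).append U) ((S.append U).append T) :=
  ⟨rightComm _ _ _, rightComm _ _ _⟩

protected def swap (p : Bool) (x : O) (q : Bool) (y : O) (S : Sequent O) :
    SRen (cons p x (cons q y S)) (cons q y (cons p x S)) :=
  match p, q with
  | false, false => ⟨swap _ _ _, Renaming.refl _⟩
  | false, true => SRen.refl _
  | true, false => SRen.refl _
  | true, true => ⟨Renaming.refl _, swap _ _ _⟩

protected def map {O' : Type u'} (F : O → O') (σ : SRen S T) : SRen (S.map F) (T.map F) :=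
  ⟨σ.l.map F, σ.r.map F⟩

/-- Applying a function to the objects commutes with adding a channel. -/
protected def mapCons {O' : Type u'} (F : O → O') (p : Bool) (x : O) (S : Sequent O) :
    SRen ((cons p x S).map F) (cons p (F x) (S.map F)) :=
  match p with
  | false => ⟨mapCons F x S.L, Renaming.refl _⟩
  | true => ⟨Renaming.refl _, mapCons F x S.R⟩

protected def mapAppend {O' : Type u'} (F : O → O') (S T : Sequent O) :
    SRen ((S.append T).map F) ((S.map F).append (T.map F)) :=
  ⟨mapAppend F _ _, mapAppend F _ _⟩

@[simp] theorem app_refl (c : S.Chan) : (SRen.refl S).app c = c := by rcases c with c | c <;> rfl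

@[simp] theorem app_trans (σ : SRen S T) (τ : SRen T U) (c : S.Chan) :
    (σ.trans τ).app c = τ.app (σ.app c) := by rcases c with c | c <;> rfl

@[simp] theorem app_symm_app (σ : SRen S T) (c : S.Chan) : σ.symm.app (σ.app c) = c := by
  rcases c with c | c
  · exact congrArg Sum.inl (σ.l.equiv.symm_apply_apply c)
  · exact congrArg Sum.inr (σ.r.equiv.symm_apply_apply c)

@[simp] theorem app_app_symm (σ : SRen S T) (c : T.Chan) : σ.app (σ.symm.app c) = c := by
  rcases c with c | c
  · exact congrArg Sum.inl (σ.l.equiv.apply_symm_apply c)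
  · exact congrArg Sum.inr (σ.r.equiv.apply_symm_apply c)

theorem app_symm_eq (σ : SRen S T) {c : T.Chan} {d : S.Chan} (h : σ.app d = c) :
    σ.symm.app c = d := by rw [← h, app_symm_app]

@[simp] theorem app_cons_here (σ : SRen S T) : (σ.cons p x).app here = here := by
  cases p <;> rfl

@[simp] theorem app_cons_there (σ : SRen S T) (c : S.Chan) :
    (σ.cons p x).app (there c) = there (σ.app c) := by
  cases p <;> rcases c with c | c <;> rfl

@[simp] theorem app_append_inL (σ : SRen S S') (τ : SRen T T') (c : S.Chan) :
    (σ.append τ).app (inL c) = inL (σ.app c) := by rcases c with c | c <;> rfl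

@[simp] theorem app_append_inR (σ : SRen S S') (τ : SRen T T') (c : T.Chan) :
    (σ.append τ).app (inR c) = inR (τ.app c) := by rcases c with c | c <;> rfl

@[simp] theorem app_assoc_inL_inL (c : S.Chan) :
    (SRen.assoc S T U).app (inL (inL c)) = inL c := by rcases c with c | c <;> rfl

@[simp] theorem app_assoc_inL_inR (c : T.Chan) :
    (SRen.assoc S T U).app (inL (inR c)) = inR (inL c) := by rcases c with c | c <;> rfl

@[simp] theorem app_assoc_inR (c : U.Chan) :
    (SRen.assoc S T U).app (inR c) = inR (inR c) := by rcases c with c | c <;> rfl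

@[simp] theorem app_comm_inL (c : S.Chan) : (SRen.comm S T).app (inL c) = inR c := by
  rcases c with c | c <;> rfl

@[simp] theorem app_comm_inR (c : T.Chan) : (SRen.comm S T).app (inR c) = inL c := by
  rcases c with c | c <;> rfl

@[simp] theorem app_nilAppend_inR (c : S.Chan) : (SRen.nilAppend S).app (inR c) = c := by
  rcases c with c | c <;> rfl

@[simp] theorem app_consAppend_here :
    (SRen.consAppend p x S T).app (inL here) = here := by cases p <;> rfl

@[simp] theorem app_consAppend_there (c : S.Chan) :
    (SRen.consAppend p x S T).app (inL (there c)) = there (inL c) := by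
  cases p <;> rcases c with c | c <;> rfl

@[simp] theorem app_consAppend_inR (c : T.Chan) :
    (SRen.consAppend p x S T).app (inR c) = there (inR c) := by
  cases p <;> rcases c with c | c <;> rfl

@[simp] theorem app_appendCons_here :
    (SRen.appendCons p x S T).app (inR here) = here := by cases p <;> rfl

@[simp] theorem app_appendCons_there (c : T.Chan) :
    (SRen.appendCons p x S T).app (inR (there c)) = there (inR c) := by
  cases p <;> rcases c with c | c <;> rfl

@[simp] theorem app_appendCons_inL (c : S.Chan) :
    (SRen.appendCons p x S T).app (inL c) = there (inL c) := by
  cases p <;> rcases c with c | c <;> rfl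

@[simp] theorem app_leftComm_inL (c : S.Chan) :
    (SRen.leftComm S T U).app (inL c) = inR (inL c) := by rcases c with c | c <;> rfl

@[simp] theorem app_leftComm_inR_inL (c : T.Chan) :
    (SRen.leftComm S T U).app (inR (inL c)) = inL c := by rcases c with c | c <;> rfl

@[simp] theorem app_leftComm_inR_inR (c : U.Chan) :
    (SRen.leftComm S T U).app (inR (inR c)) = inR (inR c) := by rcases c with c | c <;> rfl

@[simp] theorem app_rightComm_inL_inL (c : S.Chan) :
    (SRen.rightComm S T U).app (inL (inL c)) = inL (inL c) := by rcases c with c | c <;> rfl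

@[simp] theorem app_rightComm_inL_inR (c : T.Chan) :
    (SRen.rightComm S T U).app (inL (inR c)) = inR c := by rcases c with c | c <;> rfl

@[simp] theorem app_rightComm_inR (c : U.Chan) :
    (SRen.rightComm S T U).app (inR c) = inL (inR c) := by rcases c with c | c <;> rfl

@[simp] theorem app_swap_here : (SRen.swap p x q y S).app here = there here := by
  cases p <;> cases q <;> rfl

@[simp] theorem app_swap_there_here : (SRen.swap p x q y S).app (there here) = here := by
  cases p <;> cases q <;> rfl

@[simp] theorem app_swap_there_there (c : S.Chan) :
    (SRen.swap p x q y S).app (there (there c)) = there (there c) := by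
  cases p <;> cases q <;> rcases c with c | c <;> rfl

@[simp] theorem app_swap_swap (c : (cons p x (cons q y S)).Chan) :
    (SRen.swap q y p x S).app ((SRen.swap p x q y S).app c) = c := by
  revert c
  simp

@[simp] theorem app_symm_consAppend_here :
    (SRen.consAppend p x S T).symm.app here = inL here := app_symm_eq _ (by simp)

@[simp] theorem app_symm_consAppend_there_inL (c : S.Chan) :
    (SRen.consAppend p x S T).symm.app (there (inL c)) = inL (there c) := app_symm_eq _ (by simp)

@[simp] theorem app_symm_consAppend_there_inR (c : T.Chan) :
    (SRen.consAppend p x S T).symm.app (there (inR c)) = inR c := app_symm_eq _ (by simp)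

@[simp] theorem app_symm_appendCons_here :
    (SRen.appendCons p x S T).symm.app here = inR here := app_symm_eq _ (by simp)

@[simp] theorem app_symm_appendCons_there_inL (c : S.Chan) :
    (SRen.appendCons p x S T).symm.app (there (inL c)) = inL c := app_symm_eq _ (by simp)

@[simp] theorem app_symm_appendCons_there_inR (c : T.Chan) :
    (SRen.appendCons p x S T).symm.app (there (inR c)) = inR (there c) := app_symm_eq _ (by simp)

@[simp] theorem app_map {O' : Type u'} {F : O → O'} (σ : SRen S T) (c : S.Chan) :
    (σ.map F).app (mapChan F c) = mapChan F (σ.app c) := by rcases c with c | c <;> rfl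

@[simp] theorem app_mapCons_here {O' : Type u'} {F : O → O'} :
    (SRen.mapCons F p x S).app (mapChan F here) = here := by cases p <;> rfl

@[simp] theorem app_mapCons_there {O' : Type u'} {F : O → O'} (c : S.Chan) :
    (SRen.mapCons F p x S).app (mapChan F (there c)) = there (mapChan F c) := by
  cases p <;> rcases c with c | c <;> rfl

@[simp] theorem app_symm_mapCons_here {O' : Type u'} {F : O → O'} :
    (SRen.mapCons F p x S).symm.app here = mapChan F here := app_symm_eq _ (by simp)

@[simp] theorem app_symm_mapCons_there {O' : Type u'} {F : O → O'} (c : S.Chan) :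
    (SRen.mapCons F p x S).symm.app (there (mapChan F c)) = mapChan F (there c) :=
  app_symm_eq _ (by simp)

@[simp] theorem app_mapAppend_inL {O' : Type u'} {F : O → O'} (c : S.Chan) :
    (SRen.mapAppend F S T).app (mapChan F (inL c)) = inL (mapChan F c) := by
  rcases c with c | c <;> rfl

@[simp] theorem app_mapAppend_inR {O' : Type u'} {F : O → O'} (c : T.Chan) :
    (SRen.mapAppend F S T).app (mapChan F (inR c)) = inR (mapChan F c) := by
  rcases c with c | c <;> rfl

/-- `x` alone and `x, ∅` with another sequent appended. -/
protected def consNilAppend (p : Bool) (x : O) (S : Sequent O) :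
    SRen ((cons p x nil).append S) (cons p x S) :=
  (SRen.consAppend p x nil S).trans ((SRen.nilAppend S).cons p x)

@[simp] theorem app_consNilAppend_here :
    (SRen.consNilAppend p x S).app (inL here) = here := by simp [SRen.consNilAppend]

@[simp] theorem app_consNilAppend_inR (c : S.Chan) :
    (SRen.consNilAppend p x S).app (inR c) = there c := by simp [SRen.consNilAppend]

end SRen

/-! ### Polymorphisms over sequents, and the one-sided form of cut -/

namespace PolyData

variable (P : PolyData.{u, v})

/-- The laws of a functorial action of renamings that commutes with cut. -/
class RenLaws : Prop where
  ren_refl : ∀ {Γ Δ : Ctx P.Obj} (f : P.Hom Γ Δ), P.ren (refl Γ) (refl Δ) f = f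
  ren_trans : ∀ {Γ Γ' Γ'' Δ Δ' Δ'' : Ctx P.Obj} (σ : Renaming Γ Γ') (σ' : Renaming Γ' Γ'')
    (τ : Renaming Δ Δ') (τ' : Renaming Δ' Δ'') (f : P.Hom Γ Δ),
    P.ren σ' τ' (P.ren σ τ f) = P.ren (σ.trans σ') (τ.trans τ') f
  ren_cut : ∀ {Γ₁ Γ₁' Δ₁ Δ₁' Γ₂ Γ₂' Δ₂ Δ₂' : Ctx P.Obj} {x : P.Obj}
    (σ₁ : Renaming Γ₁ Γ₁') (τ₁ : Renaming Δ₁ Δ₁') (σ₂ : Renaming Γ₂ Γ₂') (τ₂ : Renaming Δ₂ Δ₂')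
    (f : P.Hom Γ₁ (x ∷ Δ₁)) (g : P.Hom (x ∷ Γ₂) Δ₂),
    P.ren (σ₁.append σ₂) (τ₁.append τ₂) (P.cut f g)
      = P.cut (P.ren σ₁ (τ₁.cons x) f) (P.ren (σ₂.cons x) τ₂ g)

theorem IsPolycategory.renLaws {P : PolyData.{u, v}} (hP : P.IsPolycategory) : P.RenLaws :=
  ⟨hP.ren_refl, hP.ren_trans, hP.ren_cut⟩

/-- Polymorphisms of type `S`. -/
abbrev H (S : Sequent P.Obj) : Type v := P.Hom S.L S.R

variable {P} {S S' T T' U : Sequent P.Obj} {p q r : Bool} {x y z : P.Obj}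

/-- Rename the channels of a polymorphism. -/
def sren (σ : SRen S T) (f : P.H S) : P.H T := P.ren σ.l σ.r f

/-- Cut along an output channel of the first and an input channel of the second polymorphism. -/
def rcut (f : P.H (cons true x S)) (g : P.H (cons false x T)) : P.H (S.append T) :=
  P.cut (Γ := S.L) (Δ := S.R) (Γ' := T.L) (Δ' := T.R) f g

/-- Cut along channels of opposite polarity. -/
def scut {p q : Bool} (h : p ≠ q) (f : P.H (cons p x S)) (g : P.H (cons q x T)) :
    P.H (S.append T) :=
  match p, q, h with
  | true, false, _ => rcut f g
  | false, true, _ => sren (SRen.comm T S) (rcut g f)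
  | true, true, h => absurd rfl h
  | false, false, h => absurd rfl h

/-- The identity with its two channels in either order. -/
def sid {p q : Bool} (h : p ≠ q) (x : P.Obj) : P.H (cons p x (cons q x nil)) :=
  match p, q, h with
  | true, false, _ => P.ren (unit x) (unit x) (P.id x)
  | false, true, _ => P.ren (unit x) (unit x) (P.id x)
  | true, true, h => absurd rfl h
  | false, false, h => absurd rfl h

theorem sren_congr {σ τ : SRen S T} (h : ∀ c, σ.app c = τ.app c) (f : P.H S) :
    sren σ f = sren τ f := by rw [SRen.ext_app.2 h]

variable [P.RenLaws]

theorem sren_refl (f : P.H S) : sren (SRen.refl S) f = f := RenLaws.ren_refl f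

@[simp] theorem sren_sren (σ : SRen S T) (τ : SRen T U) (f : P.H S) :
    sren τ (sren σ f) = sren (σ.trans τ) f := RenLaws.ren_trans _ _ _ _ f

theorem sren_eq_self {σ : SRen S S} (h : ∀ c, σ.app c = c) (f : P.H S) : sren σ f = f := by
  rw [show σ = SRen.refl S by simpa [SRen.ext_app] using h, sren_refl]

/-- Renamings are invertible; an equation may therefore be proved after renaming both sides. -/
theorem sren_injective (σ : SRen S T) : Function.Injective (sren (P := P) σ) := fun f g h => by
  have := congrArg (sren σ.symm) h
  rwa [sren_sren, sren_sren, sren_eq_self (by simp), sren_eq_self (by simp)] at this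

theorem sren_rcut (σ : SRen S S') (τ : SRen T T') (f : P.H (cons true x S))
    (g : P.H (cons false x T)) :
    sren (σ.append τ) (rcut f g) = rcut (sren (σ.cons true x) f) (sren (τ.cons false x) g) :=
  RenLaws.ren_cut _ _ _ _ _ _

theorem rcut_sren_left (σ : SRen S S') (f : P.H (cons true x S)) (g : P.H (cons false x T)) :
    rcut (sren (σ.cons true x) f) g = sren (σ.append (SRen.refl T)) (rcut f g) := by
  rw [sren_rcut, sren_eq_self (f := g) (by simp)]

theorem rcut_sren_right (σ : SRen T T') (f : P.H (cons true x S)) (g : P.H (cons false x T)) :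
    rcut f (sren (σ.cons false x) g) = sren ((SRen.refl S).append σ) (rcut f g) := by
  rw [sren_rcut, sren_eq_self (f := f) (by simp)]

theorem sren_scut (h : p ≠ q) (σ : SRen S S') (τ : SRen T T') (f : P.H (cons p x S))
    (g : P.H (cons q x T)) :
    sren (σ.append τ) (scut h f g) = scut h (sren (σ.cons p x) f) (sren (τ.cons q x) g) := by
  match p, q, h with
  | true, false, _ => exact sren_rcut σ τ f g
  | false, true, _ =>
    change sren _ (sren _ _) = sren _ (rcut (sren (τ.cons true x) g) (sren (σ.cons false x) f))
    rw [← sren_rcut, sren_sren, sren_sren]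
    congr 1
    simp [SRen.ext_app]
  | true, true, h => exact absurd rfl h
  | false, false, h => exact absurd rfl h

/-- For one polarity this is the definition of `scut`; for the other, two exchanges of the parts
cancel. It transfers statements about one premise of a cut to the other premise. -/
theorem scut_comm (h : p ≠ q) (f : P.H (cons p x S)) (g : P.H (cons q x T)) :
    sren (SRen.comm S T) (scut h f g) = scut h.symm g f := by
  match p, q, h with
  | true, false, _ => rfl
  | false, true, _ =>
    refine (sren_sren _ _ _).trans (sren_eq_self ?_ _)
    simp
  | true, true, h => exact absurd rfl h
  | false, false, h => exact absurd rfl h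

theorem scut_sren_left (h : p ≠ q) (σ : SRen S S') (f : P.H (cons p x S)) (g : P.H (cons q x T)) :
    scut h (sren (σ.cons p x) f) g = sren (σ.append (SRen.refl T)) (scut h f g) := by
  rw [sren_scut, sren_eq_self (f := g) (by simp)]

theorem scut_sren_right (h : p ≠ q) (σ : SRen T T') (f : P.H (cons p x S))
    (g : P.H (cons q x T)) :
    scut h f (sren (σ.cons q x) g) = sren ((SRen.refl S).append σ) (scut h f g) := by
  rw [sren_scut, sren_eq_self (f := f) (by simp)]

/-- One-sided form of associativity and of the interchange laws. -/
def ScutAssocAt {P : PolyData.{u, v}} {S T U : Sequent P.Obj} {p p' q q' : Bool} {x y : P.Obj}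
    (hp : p ≠ p') (hq : q ≠ q') (f : P.H (cons p x S)) (g : P.H (cons p' x (cons q y T)))
    (h : P.H (cons q' y U)) : Prop :=
  sren (SRen.assoc S T U) (scut hq (sren (SRen.appendCons q y S T) (scut hp f g)) h)
    = scut hp f (sren (SRen.consAppend p' x T U) (scut hq (sren (SRen.swap p' x q y T) g) h))

/-- One-sided form of the identity laws. -/
def SidScutAt {P : PolyData.{u, v}} {S : Sequent P.Obj} {p q : Bool} {x : P.Obj} (h : p ≠ q)
    (f : P.H (cons q x S)) : Prop :=
  sren (SRen.consNilAppend q x S) (scut h (sid h x) f) = f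

end PolyData
end SigmaPi

/-! ### Equivalence of the one-sided and the two-sided laws -/

namespace SigmaPi
open Renaming Sequent

namespace PolyData

variable {P : PolyData.{u, v}} [P.RenLaws] {S T U : Sequent P.Obj} {x y : P.Obj}

/-- Commutativity of `scut` turns the two iterated cuts of `f`, `g`, `h` into those of `h`, `g`,
`f`, with the two sides of the law exchanged. -/
theorem scutAssocAt_symm {p p' q q' : Bool} (hp : p ≠ p') (hq : q ≠ q') (f : P.H (cons p x S))
    (g : P.H (cons p' x (cons q y T))) (h : P.H (cons q' y U)) (H : ScutAssocAt hp hq f g h) :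
    ScutAssocAt hq.symm hp.symm h (sren (SRen.swap p' x q y T) g) f := by
  unfold ScutAssocAt at H ⊢
  rw [sren_sren (SRen.swap _ _ _ _ _), sren_eq_self (f := g) (by simp), ← scut_comm hp f g,
    ← scut_comm hq _ h, ← scut_comm hp f, ← scut_comm hq _ h, sren_sren, sren_sren, sren_sren,
    show (SRen.comm (cons p' x T) U).trans (SRen.appendCons p' x U T) =
      (SRen.consAppend p' x T U).trans ((SRen.comm T U).cons p' x) by simp [SRen.ext_app],
    show (SRen.comm S (cons q y T)).trans (SRen.consAppend q y T S) =
      (SRen.appendCons q y S T).trans ((SRen.comm S T).cons q y) by simp [SRen.ext_app],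
    ← sren_sren (SRen.consAppend _ _ _ _), ← sren_sren (SRen.appendCons _ _ _ _), scut_sren_left,
    scut_sren_right, ← H]
  simp only [sren_sren]
  exact sren_congr (by simp) _

/-- Associativity of cut, one-sided and two-sided. -/
theorem scutAssocAt_iff_assoc (f : P.H (cons true x S)) (g : P.H (cons false x (cons true y T)))
    (h : P.H (cons false y U)) :
    ScutAssocAt (by decide) (by decide) f g h ↔
      sren (SRen.assoc S T U) (rcut (sren (SRen.appendCons true y S T) (rcut f g)) h)
        = rcut f (sren (SRen.consAppend false x T U)
            (rcut (S := cons false x T) (show P.H (cons true y (cons false x T)) from g) h)) := by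
  -- An input and an output channel lie in different contexts, so they can be added in either order
  -- with definitionally the same result, and the swap is the identity renaming.
  have e : sren (SRen.swap false x true y T) g = g := sren_refl g
  unfold ScutAssocAt
  rw [e]
  rfl

/-- Interchange of cuts on two output channels, one-sided and two-sided. -/
theorem scutAssocAt_iff_interchange_cod (f : P.H (cons true x (cons true y S)))
    (g : P.H (cons false x T)) (h : P.H (cons false y U)) :
    ScutAssocAt (by decide) (by decide) g f h ↔
      sren (SRen.rightComm S T U)
        (rcut (sren (SRen.consAppend true y S T) (rcut f g)) h)
        = rcut (sren (SRen.consAppend true x S U)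
            (rcut (sren (SRen.swap true x true y S) f) h)) g := by
  change sren (SRen.assoc T S U) (rcut (sren (SRen.appendCons true y T S)
      (sren (SRen.comm _ _) (rcut f g))) h) = sren (SRen.comm _ _) (rcut (sren _ _) _) ↔ _
  -- The right side carries an exchange of the parts, caused by the reversed polarity of the outer
  -- cut; applying the inverse exchange to both sides removes it.
  rw [← (sren_injective (SRen.comm (S.append U) T)).eq_iff, sren_sren,
    show (SRen.comm (cons true y S) T).trans (SRen.appendCons true y T S) =
      (SRen.consAppend true y S T).trans ((SRen.comm S T).cons true y) by simp [SRen.ext_app],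
    ← sren_sren, rcut_sren_left, sren_sren, sren_sren]
  exact iff_of_eq (congrArg (· = _) (sren_congr (by simp) _))

/-- Interchange of cuts on two input channels, one-sided and two-sided. -/
theorem scutAssocAt_iff_interchange_dom (f : P.H (cons true x S)) (g : P.H (cons true y T))
    (h : P.H (cons false x (cons false y U))) :
    ScutAssocAt (by decide) (by decide) f h g ↔
      sren (SRen.leftComm T S U)
        (rcut g (sren (SRen.appendCons false y S U) (rcut f h)))
        = rcut f (sren (SRen.appendCons false x T U)
            (rcut g (sren (SRen.swap false x false y U) h))) := by
  change sren (SRen.assoc S U T) (sren (SRen.comm _ _) (rcut g (sren (SRen.appendCons false y S U)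
      (rcut f h)))) = rcut _ (sren _ (sren (SRen.comm _ _) (rcut _ _))) ↔ _
  rw [← (sren_injective ((SRen.refl S).append (SRen.comm T U))).eq_iff, sren_sren, sren_sren,
    sren_sren,
    show (SRen.comm T (cons false x U)).trans (SRen.consAppend false x U T) =
      (SRen.appendCons false x T U).trans ((SRen.comm T U).cons false x) by simp [SRen.ext_app],
    ← sren_sren (SRen.appendCons _ _ _ _), rcut_sren_right]
  exact iff_of_eq (congrArg (· = _) (sren_congr (by simp) _))

/-- The middle polymorphism is cut on two channels: one input and one output (associativity, read
from either end), two outputs, or two inputs (the interchange laws). -/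
theorem IsPolycategory.scutAssocAt (hP : P.IsPolycategory) {p p' q q' : Bool} (hp : p ≠ p')
    (hq : q ≠ q') (f : P.H (cons p x S)) (g : P.H (cons p' x (cons q y T)))
    (h : P.H (cons q' y U)) : ScutAssocAt hp hq f g h := by
  match p, p', q, q', hp, hq with
  | true, false, true, false, _, _ =>
    exact (scutAssocAt_iff_assoc f g h).2 (hP.cut_assoc _ _ _)
  | false, true, true, false, _, _ =>
    exact (scutAssocAt_iff_interchange_cod g f h).2 (hP.interchange_cod _ _ _)
  | true, false, false, true, _, _ =>
    exact (scutAssocAt_iff_interchange_dom f h g).2 (hP.interchange_dom _ _ _)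
  | false, true, false, true, _, _ =>
    have := scutAssocAt_symm (by decide) (by decide) h (sren (SRen.swap true x false y T) g) f
      ((scutAssocAt_iff_assoc h _ f).2 (hP.cut_assoc _ _ _))
    rwa [sren_sren, sren_eq_self (by simp)] at this
  | true, true, _, _, hp, _ => exact absurd rfl hp
  | false, false, _, _, hp, _ => exact absurd rfl hp
  | _, _, true, true, _, hq => exact absurd rfl hq
  | _, _, false, false, _, hq => exact absurd rfl hq

theorem sidScutAt_true_iff (f : P.H (cons false x S)) :
    SidScutAt (p := true) (q := false) (by decide) f ↔
      P.renR (emptyAppend S.R) (P.cut (Γ' := S.L) (P.renR (unit x) (P.id x)) f) = f := by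
  -- `sid` renames both channels of the identity, the law of a polycategory only one. The other
  -- renaming acts away from the cut channel and can be taken out of the cut.
  have e : (sid (by decide) x : P.H (cons true x (cons false x nil))) =
      sren ((⟨unit x, refl _⟩ : SRen ⟨Ctx.single x, Ctx.empty⟩ (cons false x nil)).cons true x)
        (show P.H (cons true x ⟨Ctx.single x, Ctx.empty⟩) from P.renR (unit x) (P.id x)) := by
    refine Eq.trans ?_
      (RenLaws.ren_trans (refl _) (unit x) (unit x) ((refl Ctx.empty).cons x) (P.id x)).symm
    exact congrArg (P.ren (unit x) · (P.id x)) (ext_equiv fun _ => rfl)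
  unfold SidScutAt
  rw [e, scut_sren_left, sren_sren]
  refine iff_of_eq (congrArg (· = _) ?_)
  exact sren_congr (τ := (⟨refl _, emptyAppend _⟩ :
      SRen (Sequent.append ⟨Ctx.single x, Ctx.empty⟩ S) (cons false x S)))
    (by rintro ((c | c) | (c | c)) <;> rfl) _

theorem sidScutAt_false_iff (f : P.H (cons true x S)) :
    SidScutAt (p := false) (q := true) (by decide) f ↔
      P.ren (appendEmpty S.L) (comm S.R (Ctx.single x))
        (P.cut (Δ := S.R) f (P.renL (unit x) (P.id x))) = f := by
  have e : (sid (by decide) x : P.H (cons false x (cons true x nil))) =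
      sren ((⟨refl _, unit x⟩ : SRen ⟨Ctx.empty, Ctx.single x⟩ (cons true x nil)).cons false x)
        (show P.H (cons false x ⟨Ctx.empty, Ctx.single x⟩) from P.renL (unit x) (P.id x)) := by
    refine Eq.trans ?_
      (RenLaws.ren_trans (unit x) ((refl Ctx.empty).cons x) (refl _) (unit x) (P.id x)).symm
    exact congrArg (P.ren · (unit x) (P.id x)) (ext_equiv fun _ => rfl)
  unfold SidScutAt
  rw [e, scut_sren_left, ← scut_comm (p := true) (q := false) (by decide), sren_sren, sren_sren]
  refine iff_of_eq (congrArg (· = _) ?_)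
  exact sren_congr (τ := (⟨appendEmpty _, comm _ _⟩ :
      SRen (Sequent.append S ⟨Ctx.empty, Ctx.single x⟩) (cons true x S)))
    (by rintro ((c | c) | (c | c)) <;> rfl) _

theorem IsPolycategory.sidScutAt (hP : P.IsPolycategory) {p q : Bool} (h : p ≠ q)
    (f : P.H (cons q x S)) : SidScutAt h f := by
  match p, q, h with
  | true, false, _ => exact (sidScutAt_true_iff f).2 (hP.id_cut _)
  | false, true, _ => exact (sidScutAt_false_iff f).2 (hP.cut_id _)
  | true, true, h => exact absurd rfl h
  | false, false, h => exact absurd rfl h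

/-- The laws of a polycategory from their one-sided forms. -/
theorem isPolycategory_of_scut
    (hassoc : ∀ {S T U : Sequent P.Obj} {p p' q q' : Bool} {x y : P.Obj} (hp : p ≠ p')
      (hq : q ≠ q') (f : P.H (cons p x S)) (g : P.H (cons p' x (cons q y T)))
      (h : P.H (cons q' y U)), ScutAssocAt hp hq f g h)
    (hid : ∀ {S : Sequent P.Obj} {p q : Bool} {x : P.Obj} (h : p ≠ q) (f : P.H (cons q x S)),
      SidScutAt h f) : P.IsPolycategory where
  ren_refl := RenLaws.ren_refl
  ren_trans := RenLaws.ren_trans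
  ren_cut := RenLaws.ren_cut
  id_cut {Γ Δ _} f := (sidScutAt_true_iff (S := ⟨Γ, Δ⟩) f).1 (hid _ _)
  cut_id {Γ Δ _} f := (sidScutAt_false_iff (S := ⟨Γ, Δ⟩) f).1 (hid _ _)
  cut_assoc {Γ Δ Γ' Δ' Γ'' Δ'' _ _} f g h :=
    (scutAssocAt_iff_assoc (S := ⟨Γ, Δ⟩) (T := ⟨Γ', Δ'⟩) (U := ⟨Γ'', Δ''⟩) f g h).1
      (hassoc _ _ _ _ _)
  interchange_cod {Γ Δ Γ' Δ' Γ'' Δ'' _ _} f g h :=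
    (scutAssocAt_iff_interchange_cod (S := ⟨Γ, Δ⟩) (T := ⟨Γ', Δ'⟩) (U := ⟨Γ'', Δ''⟩) f g h).1
      (hassoc _ _ _ _ _)
  interchange_dom {Γ Δ Γ' Δ' Γ'' Δ'' _ _} f g h :=
    (scutAssocAt_iff_interchange_dom (S := ⟨Γ, Δ⟩) (T := ⟨Γ', Δ'⟩) (U := ⟨Γ'', Δ''⟩) f g h).1
      (hassoc _ _ _ _ _)

end PolyData
end SigmaPi

/-! ### Operations on one channel -/

namespace SigmaPi
open Renaming Sequent

namespace PolyData

variable {P : PolyData.{u, v}} [P.RenLaws] {S T U : Sequent P.Obj} {x y : P.Obj}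

/-- An operation on a channel that commutes with renamings and with cuts on other channels. -/
structure ChanOp (P : PolyData.{u, v}) where
  pol : Bool
  K : Type
  X : K → P.Obj
  z : P.Obj
  op : ∀ {S : Sequent P.Obj}, (∀ k, P.H (cons pol (X k) S)) → P.H (cons pol z S)
  sren_op : ∀ {S T : Sequent P.Obj} (σ : SRen S T) (f : ∀ k, P.H (cons pol (X k) S)),
    sren (σ.cons pol z) (op f) = op fun k => sren (σ.cons pol (X k)) (f k)
  rcut_op : ∀ {S T : Sequent P.Obj} {x : P.Obj} (g : P.H (cons true x T))
    (f : ∀ k, P.H (cons pol (X k) (cons false x S))),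
    sren (SRen.appendCons pol z T S) (rcut g (sren (SRen.swap pol z false x S) (op f)))
      = op fun k => sren (SRen.appendCons pol (X k) T S)
          (rcut g (sren (SRen.swap pol (X k) false x S) (f k)))
  op_rcut : ∀ {S T : Sequent P.Obj} {x : P.Obj}
    (f : ∀ k, P.H (cons pol (X k) (cons true x S))) (g : P.H (cons false x T)),
    sren (SRen.consAppend pol z S T) (rcut (sren (SRen.swap pol z true x S) (op f)) g)
      = op fun k => sren (SRen.consAppend pol (X k) S T)
          (rcut (sren (SRen.swap pol (X k) true x S) (f k)) g)

namespace ChanOp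

/-- When the channel cut in the first premise is an input, `scut` is an exchanged `rcut`; the laws
`op_rcut` and `rcut_op` thus cover the two polarities. -/
theorem op_scut (o : ChanOp P) {p q : Bool} (h : p ≠ q)
    (f : ∀ k, P.H (cons o.pol (o.X k) (cons p x S))) (g : P.H (cons q x T)) :
    sren (SRen.consAppend o.pol o.z S T) (scut h (sren (SRen.swap o.pol o.z p x S) (o.op f)) g)
      = o.op fun k => sren (SRen.consAppend o.pol (o.X k) S T)
          (scut h (sren (SRen.swap o.pol (o.X k) p x S) (f k)) g) := by
  match p, q, h with
  | true, false, _ => exact o.op_rcut f g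
  | false, true, _ =>
    change sren _ (sren (SRen.comm _ _) (rcut _ _)) =
      o.op fun k => sren _ (sren (SRen.comm _ _) (rcut _ _))
    have e : ∀ w, (SRen.comm T (cons o.pol w S)).trans (SRen.consAppend o.pol w S T) =
        (SRen.appendCons o.pol w T S).trans ((SRen.comm T S).cons o.pol w) := fun w => by
      simp [SRen.ext_app]
    simp only [sren_sren (SRen.comm _ _), e]
    simp only [← sren_sren (SRen.appendCons _ _ _ _)]
    rw [o.rcut_op, o.sren_op]
  | true, true, h => exact absurd rfl h
  | false, false, h => exact absurd rfl h

theorem scut_op (o : ChanOp P) {p q : Bool} (h : p ≠ q) (g : P.H (cons p x T))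
    (f : ∀ k, P.H (cons o.pol (o.X k) (cons q x S))) :
    sren (SRen.appendCons o.pol o.z T S) (scut h g (sren (SRen.swap o.pol o.z q x S) (o.op f)))
      = o.op fun k => sren (SRen.appendCons o.pol (o.X k) T S)
          (scut h g (sren (SRen.swap o.pol (o.X k) q x S) (f k))) := by
  have e : ∀ w, (SRen.comm (cons o.pol w S) T).trans (SRen.appendCons o.pol w T S) =
      (SRen.consAppend o.pol w S T).trans ((SRen.comm S T).cons o.pol w) := fun w => by
    simp [SRen.ext_app]
  simp only [← scut_comm h.symm _ g, sren_sren (SRen.comm _ _), e]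
  simp only [← sren_sren (SRen.consAppend _ _ _ _)]
  rw [o.op_scut, o.sren_op]

/-- An operation that commutes with one-sided cuts. -/
def ofScut (pol : Bool) (K : Type) (X : K → P.Obj) (z : P.Obj)
    (op : ∀ {S : Sequent P.Obj}, (∀ k, P.H (cons pol (X k) S)) → P.H (cons pol z S))
    (sren_op : ∀ {S T : Sequent P.Obj} (σ : SRen S T) (f : ∀ k, P.H (cons pol (X k) S)),
      sren (σ.cons pol z) (op f) = op fun k => sren (σ.cons pol (X k)) (f k))
    (op_scut : ∀ {p q : Bool} {S T : Sequent P.Obj} {x : P.Obj} (h : p ≠ q)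
      (f : ∀ k, P.H (cons pol (X k) (cons p x S))) (g : P.H (cons q x T)),
      sren (SRen.consAppend pol z S T) (scut h (sren (SRen.swap pol z p x S) (op f)) g)
        = op fun k => sren (SRen.consAppend pol (X k) S T)
            (scut h (sren (SRen.swap pol (X k) p x S) (f k)) g)) : ChanOp P where
  pol := pol
  K := K
  X := X
  z := z
  op := op
  sren_op := sren_op
  op_rcut f g := op_scut (p := true) (q := false) (by decide) f g
  rcut_op {S T x} g f := by
    have e : ∀ w, (SRen.comm (cons pol w S) T).trans (SRen.appendCons pol w T S) =
        (SRen.consAppend pol w S T).trans ((SRen.comm S T).cons pol w) := fun w => by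
      simp [SRen.ext_app]
    have H := congrArg (sren ((SRen.comm S T).cons pol z))
      (op_scut (p := false) (q := true) (by decide) f g)
    rw [sren_op, sren_sren, ← e] at H
    simp only [sren_sren, ← e] at H
    simp only [← scut_comm (p := true) (q := false) (by decide) g, sren_sren] at H
    refine Eq.trans (sren_congr ?_ _) (H.trans (congrArg op (funext fun k => sren_congr ?_ _)))
    all_goals simp

/-- The operation on a distinguished channel followed by another one. -/
theorem side_scut (o : ChanOp P) {p q : Bool} (h : p ≠ q)
    (f : ∀ k, P.H (cons p x (cons o.pol (o.X k) S))) (g : P.H (cons q x T)) :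
    scut h (sren (SRen.swap o.pol o.z p x S)
        (o.op fun k => sren (SRen.swap p x o.pol (o.X k) S) (f k))) g
      = sren (SRen.consAppend o.pol o.z S T).symm
          (o.op fun k => sren (SRen.consAppend o.pol (o.X k) S T) (scut h (f k) g)) := by
  apply sren_injective (SRen.consAppend o.pol o.z S T)
  rw [o.op_scut, sren_sren, sren_eq_self (σ := SRen.trans _ _) (by simp)]
  congr 1; funext k
  rw [sren_sren, sren_eq_self (σ := SRen.trans _ _) (by simp)]

theorem scut_side (o : ChanOp P) {p q : Bool} (h : p ≠ q) (g : P.H (cons p x T))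
    (f : ∀ k, P.H (cons q x (cons o.pol (o.X k) S))) :
    scut h g (sren (SRen.swap o.pol o.z q x S)
        (o.op fun k => sren (SRen.swap q x o.pol (o.X k) S) (f k)))
      = sren (SRen.appendCons o.pol o.z T S).symm
          (o.op fun k => sren (SRen.appendCons o.pol (o.X k) T S) (scut h g (f k))) := by
  apply sren_injective (SRen.appendCons o.pol o.z T S)
  rw [o.scut_op, sren_sren, sren_eq_self (σ := SRen.trans _ _) (by simp)]
  congr 1; funext k
  rw [sren_sren, sren_eq_self (σ := SRen.trans _ _) (by simp)]

end ChanOp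

end PolyData

open PolyData

/-! ### Cotupling and tupling as one operation -/

namespace SumProdData

variable {P : PolyData.{u, v}} (T : SumProdData P)

/-- The sum (`p = false`) or the product (`p = true`) of a family. -/
def conn (p : Bool) {I : Type} [Finite I] (X : I → P.Obj) : P.Obj :=
  match p with
  | false => T.sum X
  | true => T.prod X

/-- Cotupling (`p = false`) or tupling (`p = true`). -/
def tup (p : Bool) {I : Type} [Finite I] (X : I → P.Obj) {S : Sequent P.Obj}
    (f : ∀ i, P.H (cons p (X i) S)) : P.H (cons p (T.conn p X) S) :=
  match p with
  | false => T.cotuple (Γ := S.L) (Δ := S.R) X f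
  | true => T.tuple (Γ := S.L) (Δ := S.R) X f

/-- The compatibility of the chosen operations with renaming and cut. -/
structure Natural : Prop where
  ren_cot : ∀ {I : Type} [Finite I] (X : I → P.Obj) {Γ Γ' Δ Δ' : Ctx P.Obj} (σ : Renaming Γ Γ')
    (τ : Renaming Δ Δ') (f : ∀ i, P.Hom (X i ∷ Γ) Δ),
    P.ren (σ.cons _) τ (T.cotuple X f) = T.cotuple X (fun i => P.ren (σ.cons (X i)) τ (f i))
  cot_cut : ∀ {I : Type} [Finite I] (X : I → P.Obj) {Γ Δ Γ' Δ' : Ctx P.Obj} {z : P.Obj}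
    (f : ∀ i, P.Hom (X i ∷ Γ) (z ∷ Δ)) (h : P.Hom (z ∷ Γ') Δ'),
    P.renL (consAppend _ Γ Γ') (P.cut (T.cotuple X f) h)
      = T.cotuple X (fun i => P.renL (consAppend (X i) Γ Γ') (P.cut (f i) h))
  cut_cot : ∀ {I : Type} [Finite I] (X : I → P.Obj) {Γ Δ Γ' Δ' : Ctx P.Obj} {z : P.Obj}
    (h : P.Hom Γ (z ∷ Δ)) (f : ∀ i, P.Hom (X i ∷ z ∷ Γ') Δ'),
    P.renL (appendCons Γ _ Γ') (P.cut h (P.renL (swap _ z Γ') (T.cotuple X f)))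
      = T.cotuple X
          (fun i => P.renL (appendCons Γ (X i) Γ') (P.cut h (P.renL (swap (X i) z Γ') (f i))))
  ren_tup : ∀ {I : Type} [Finite I] (Y : I → P.Obj) {Γ Γ' Δ Δ' : Ctx P.Obj} (σ : Renaming Γ Γ')
    (τ : Renaming Δ Δ') (f : ∀ i, P.Hom Γ (Y i ∷ Δ)),
    P.ren σ (τ.cons _) (T.tuple Y f) = T.tuple Y (fun i => P.ren σ (τ.cons (Y i)) (f i))
  cut_tup : ∀ {I : Type} [Finite I] (Y : I → P.Obj) {Γ Δ Γ' Δ' : Ctx P.Obj} {z : P.Obj}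
    (h : P.Hom Γ (z ∷ Δ)) (f : ∀ i, P.Hom (z ∷ Γ') (Y i ∷ Δ')),
    P.renR (appendCons Δ _ Δ') (P.cut h (T.tuple Y f))
      = T.tuple Y (fun i => P.renR (appendCons Δ (Y i) Δ') (P.cut h (f i)))
  tup_cut : ∀ {I : Type} [Finite I] (Y : I → P.Obj) {Γ Δ Γ' Δ' : Ctx P.Obj} {z : P.Obj}
    (f : ∀ i, P.Hom Γ (Y i ∷ z ∷ Δ)) (h : P.Hom (z ∷ Γ') Δ'),
    P.renR (consAppend _ Δ Δ') (P.cut (P.renR (swap _ z Δ) (T.tuple Y f)) h)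
      = T.tuple Y
          (fun i => P.renR (consAppend (Y i) Δ Δ') (P.cut (P.renR (swap (Y i) z Δ) (f i)) h))

variable {T}

theorem IsFiniteSumProd.natural (hT : T.IsFiniteSumProd) : T.Natural where
  ren_cot X := (hT.isPolySum X).ren_cot
  cot_cut X := (hT.isPolySum X).cot_cut
  cut_cot X := (hT.isPolySum X).cut_cot
  ren_tup X := (hT.isPolyProd X).ren_tup
  cut_tup X := (hT.isPolyProd X).cut_tup
  tup_cut X := (hT.isPolyProd X).tup_cut

variable [P.RenLaws]

/-- Cotupling or tupling as an operation on a channel. -/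
def tupOp (hT : T.Natural) (p : Bool) {I : Type} [Finite I] (X : I → P.Obj) : ChanOp P where
  pol := p
  K := I
  X := X
  z := T.conn p X
  op := T.tup p X
  sren_op {S S'} σ f := by
    cases p
    · exact hT.ren_cot X σ.l σ.r f
    · exact hT.ren_tup X σ.l σ.r f
  rcut_op {S S' x} g f := by
    cases p
    · exact hT.cut_cot (Γ := S'.L) (Δ := S'.R) (Γ' := S.L) (Δ' := S.R) X g f
    · have e : ∀ (w : P.Obj) (f : P.H (cons true w (cons false x S))),
        sren (SRen.swap true w false x S) f = f := fun w f => sren_refl f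
      simp only [e]
      exact hT.cut_tup (Γ := S'.L) (Δ := S'.R) (Γ' := S.L) (Δ' := S.R) X g f
  op_rcut {S S' x} f g := by
    cases p
    · have e : ∀ (w : P.Obj) (f : P.H (cons false w (cons true x S))),
        sren (SRen.swap false w true x S) f = f := fun w f => sren_refl f
      simp only [e]
      exact hT.cot_cut (Γ := S.L) (Δ := S.R) (Γ' := S'.L) (Δ' := S'.R) X f g
    · exact hT.tup_cut (Γ := S.L) (Δ := S.R) (Γ' := S'.L) (Δ' := S'.R) X f g

end SumProdData
end SigmaPi

namespace SigmaPi
open Renaming Sequent PolyData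

/-! ### Renamings between contexts with distinguished channels -/

theorem Equiv.exists_pull {α : Type} (c : α) :
    ∃ e : α ≃ Unit ⊕ {i // i ≠ c}, e c = .inl () ∧ ∀ i, e.symm (.inr i) = i := by
  classical
  refine ⟨⟨fun i => if h : i = c then .inl () else .inr ⟨i, h⟩, Sum.elim (fun _ => c) (fun i => i),
    fun i => ?_, fun j => ?_⟩, by simp, fun i => rfl⟩
  · by_cases h : i = c <;> simp [h]
  · rcases j with j | ⟨j, hj⟩
    · simp
    · simp [hj]

/-- A bijection that matches the two extra points restricts to their complements. -/
theorem Equiv.exists_cancel {α β : Type} (e : Unit ⊕ α ≃ Unit ⊕ β) (h : e (.inl ()) = .inl ()) :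
    ∃ t : α ≃ β, ∀ i, e (.inr i) = .inr (t i) := by
  have h1 : ∀ i, ∃ j, e (.inr i) = .inr j := fun i => by
    rcases E : e (.inr i) with j | j
    · exact absurd (e.injective (E.trans h.symm)) (by simp)
    · exact ⟨j, rfl⟩
  have h2 : ∀ j, ∃ i, e.symm (.inr j) = .inr i := fun j => by
    rcases E : e.symm (.inr j) with i | i
    · rw [Equiv.symm_apply_eq] at E
      exact absurd (E.trans h) (by simp)
    · exact ⟨i, rfl⟩
  choose t ht using h1
  choose s hs using h2
  refine ⟨⟨t, s, fun i => ?_, fun j => ?_⟩, ht⟩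
  · have := hs (t i)
    rw [← ht, Equiv.symm_apply_apply] at this
    exact (Sum.inr.inj this).symm
  · have := ht (s j)
    rw [← hs, Equiv.apply_symm_apply] at this
    exact (Sum.inr.inj this).symm

theorem Renaming.exists_pull {O : Type u} (Γ : Ctx O) (c : Γ.chan) :
    ∃ (W : Ctx O) (τ : Renaming Γ (Γ.obj c ∷ W)), τ.equiv c = Sum.inl () := by
  obtain ⟨e, h1, h2⟩ := Equiv.exists_pull c
  have := Γ.finite
  refine ⟨⟨{i // i ≠ c}, inferInstance, fun i => Γ.obj i⟩, ⟨e, fun i => ?_⟩, h1⟩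
  obtain ⟨j, rfl⟩ := e.symm.surjective i
  refine (congrArg (Ctx.obj _) (e.apply_symm_apply j)).trans ?_
  rcases j with j | j
  · exact congrArg Γ.obj (e.symm_apply_eq.2 h1.symm).symm
  · exact congrArg Γ.obj (h2 j).symm

theorem Renaming.exists_cancel {O : Type u} {Γ Δ : Ctx O} {x y : O}
    (σ : Renaming (x ∷ Γ) (y ∷ Δ)) (h : σ.equiv (.inl ()) = .inl ()) :
    x = y ∧ ∃ τ : Renaming Γ Δ, ∀ i, σ.equiv (.inr i) = .inr (τ.equiv i) := by
  obtain ⟨t, ht⟩ := Equiv.exists_cancel σ.equiv h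
  refine ⟨(σ.obj_eq (.inl ())).symm.trans (by rw [h]; rfl), ⟨t, fun i => ?_⟩, ht⟩
  exact (congrArg (y ∷ Δ).obj (ht i)).symm.trans (σ.obj_eq (.inr i))

namespace SRen

variable {O : Type u} {S S' T : Sequent O} {p r : Bool} {x z : O}

/-- Any channel, of either polarity, can be brought into the distinguished position; this is why it
suffices to state rules and cuts for distinguished channels. -/
theorem exists_pull (c : S.Chan) : ∃ (r : Bool) (z : O) (W : Sequent O) (τ : SRen S (cons r z W)),
    τ.app c = here := by
  rcases c with c | c
  · obtain ⟨W, τ, h⟩ := Renaming.exists_pull S.L c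
    exact ⟨false, _, ⟨W, S.R⟩, ⟨τ, Renaming.refl _⟩, congrArg Sum.inl h⟩
  · obtain ⟨W, τ, h⟩ := Renaming.exists_pull S.R c
    exact ⟨true, _, ⟨S.L, W⟩, ⟨Renaming.refl _, τ⟩, congrArg Sum.inr h⟩

/-- The target of `σ` has the form of that of `σ'.cons r z` only after the polarities and objects
have been identified, hence the heterogeneous equality. -/
theorem exists_cancel (σ : SRen (cons r z S) (cons p x S')) (h : σ.app here = here) :
    r = p ∧ z = x ∧ ∃ σ' : SRen S S', HEq σ (σ'.cons r z) := by
  cases r <;> cases p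
  · obtain ⟨rfl, τ, h⟩ := Renaming.exists_cancel σ.l (Sum.inl.inj h)
    refine ⟨rfl, rfl, ⟨τ, σ.r⟩, heq_of_eq (SRen.ext (ext_equiv ?_) rfl)⟩
    rintro (i | i)
    · exact Sum.inl.inj ‹_›
    · exact h i
  · cases h
  · cases h
  · obtain ⟨rfl, τ, h⟩ := Renaming.exists_cancel σ.r (Sum.inr.inj h)
    refine ⟨rfl, rfl, ⟨σ.l, τ⟩, heq_of_eq (SRen.ext rfl (ext_equiv ?_))⟩
    rintro (i | i)
    · exact Sum.inr.inj ‹_›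
    · exact h i

/-- A renaming between sequents with a distinguished channel either matches the two channels or
moves them past each other. -/
theorem split (σ : SRen (cons r z S) (cons p x S')) :
    (r = p ∧ z = x ∧ ∃ σ' : SRen S S', HEq σ (σ'.cons r z)) ∨
      ∃ (W : Sequent O) (τ : SRen S (cons p x W)) (ρ : SRen (cons r z W) S'),
        σ = ((τ.cons r z).trans (SRen.swap r z p x W)).trans (ρ.cons p x) := by
  by_cases h : σ.app here = here
  · exact .inl (σ.exists_cancel h)
  · right
    obtain ⟨c, hc⟩ : ∃ c, σ.app here = there c := by
      have : ∀ d : (cons p x S').Chan, d ≠ here → ∃ c, d = there c :=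
        forall_cons.2 ⟨fun h => absurd rfl h, fun c _ => ⟨c, rfl⟩⟩
      exact this _ h
    -- `W` is what remains when both distinguished channels are removed. After the image of the
    -- first channel has been pulled out of `S'` and swapped to the front, the composite matches the
    -- distinguished channels and cancels to `τ`.
    obtain ⟨r', z', W, ρ, hρ⟩ := exists_pull c
    obtain ⟨rfl, rfl, τ, hτ⟩ := exists_cancel
      ((σ.trans (ρ.cons p x)).trans (SRen.swap p x r' z' W)) (by simp [hc, hρ])
    refine ⟨W, τ, ρ.symm, ?_⟩
    rw [← eq_of_heq hτ, ext_app]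
    intro c
    simp only [app_trans]
    generalize σ.app c = d
    revert d
    refine forall_cons.2 ⟨by simp, fun c => ?_⟩
    obtain ⟨c, rfl⟩ : ∃ d, c = ρ.symm.app d := ⟨ρ.app c, by simp⟩
    revert c
    simp

end SRen

/-- A renaming out of a sequent of images of `F` is, on the distinguished channel, the image of a
renaming. -/
theorem SRen.exists_map_cons {O : Type u} {O' : Type u'} {F : O → O'} {S : Sequent O} {p : Bool}
    {x : O'} {S' : Sequent O'} (σ : SRen (S.map F) (cons p x S')) :
    ∃ (a : O) (S₁ : Sequent O) (ρ : SRen S (cons p a S₁)) (τ : SRen (S₁.map F) S'), F a = x ∧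
      HEq σ (((ρ.map F).trans (SRen.mapCons F p a S₁)).trans (τ.cons p (F a))) := by
  -- `c` is the channel that `σ` makes distinguished. It already exists in `S`, so it can be pulled
  -- to the front before `F` is applied, and what is left of `σ` cancels.
  obtain ⟨c, hc⟩ : ∃ c : S.Chan, σ.app (mapChan F c) = here := ⟨_, SRen.app_app_symm σ here⟩
  obtain ⟨r, a, S₁, ρ, hρ⟩ := SRen.exists_pull c
  have h : σ.app (mapChan F (ρ.symm.app here)) = here := by
    rw [← hρ, SRen.app_symm_app, hc]
  obtain ⟨rfl, rfl, τ, hτ⟩ := SRen.exists_cancel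
    (((SRen.mapCons F r a S₁).symm.trans (ρ.symm.map F)).trans σ) (by simp [h])
  refine ⟨a, S₁, ρ, τ, rfl, heq_of_eq ?_⟩
  rw [← eq_of_heq hτ, SRen.ext_app]
  simp

end SigmaPi

namespace SigmaPi
open Renaming Sequent PolyData Deriv

/-! ### The operations of `ΣΠ_A` -/

section Operations

variable {A : PolyData.{u, v}}

/-- Atoms as objects of `ΣΠ_A`. -/
def atom : A.Obj → (sigmaPi A).Obj := Fml.atom

/-- The class of a derivation. -/
def cls {S : Sequent (sigmaPi A).Obj} (d : Deriv A S.L S.R) : (sigmaPi A).H S :=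
  Quotient.mk (convSetoid A _ _) d

theorem cls_eq {S : Sequent (sigmaPi A).Obj} {d e : Deriv A S.L S.R} (h : Conv A d e) :
    cls d = cls e := Quotient.sound (s := convSetoid A _ _) h

theorem exists_cls {S : Sequent (sigmaPi A).Obj} (f : (sigmaPi A).H S) : ∃ d, cls d = f :=
  Quotient.exists_rep f

/-- The cotuple and tuple rules take families of derivations, so representatives of a family of
classes have to be chosen simultaneously. -/
theorem exists_cls_family {K : Type} {S : K → Sequent (sigmaPi A).Obj}
    (f : ∀ k, (sigmaPi A).H (S k)) : ∃ d : ∀ k, Deriv A (S k).L (S k).R, f = fun k => cls (d k) := by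
  choose d hd using fun k => exists_cls (f k)
  exact ⟨d, funext fun k => (hd k).symm⟩

instance : (sigmaPi A).RenLaws where
  ren_refl := by
    rintro Γ Δ ⟨f⟩
    exact Quotient.sound (s := convSetoid A _ _) (Conv.exch_refl f)
  ren_trans := by
    rintro Γ Γ' Γ'' Δ Δ' Δ'' σ σ' τ τ' ⟨f⟩
    exact Quotient.sound (s := convSetoid A _ _) (Conv.exch_trans σ σ' τ τ' f)
  ren_cut := by
    rintro Γ₁ Γ₁' Δ₁ Δ₁' Γ₂ Γ₂' Δ₂ Δ₂' x σ₁ τ₁ σ₂ τ₂ ⟨f⟩ ⟨g⟩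
    exact Quotient.sound (s := convSetoid A _ _) (Conv.exch_cut σ₁ τ₁ σ₂ τ₂ f g)

/-- Projection (`q = true`) or injection (`q = false`) at `k`, on a channel of polarity `p`. -/
noncomputable def sel {p q : Bool} (h : p ≠ q) {I : Type} [Finite I] {X : I → (sigmaPi A).Obj} (k : I)
    {S : Sequent (sigmaPi A).Obj} (f : (sigmaPi A).H (cons p (X k) S)) :
    (sigmaPi A).H (cons p ((sigmaPiSumProd A).conn q X) S) :=
  match p, q, h with
  | false, true, _ => Quotient.map (proj (X := X) k) (fun _ _ => Conv.congr_proj k) f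
  | true, false, _ => Quotient.map (inj (Y := X) k) (fun _ _ => Conv.congr_inj k) f
  | true, true, h => absurd rfl h
  | false, false, h => absurd rfl h

/-- On chosen representatives each law is one generating conversion; `sigmaPiSumProd_cotuple_mk` and
`sigmaPiSumProd_tuple_mk` eliminate the `Quotient.out` in the definition of the operations. -/
theorem sigmaPiSumProd_natural : (sigmaPiSumProd A).Natural where
  ren_cot {I _} X Γ Γ' Δ Δ' σ τ f := by
    obtain ⟨d, rfl⟩ := exists_cls_family (S := fun i => ⟨X i ∷ Γ, Δ⟩) f
    refine (congrArg ((sigmaPi A).ren _ _) (sigmaPiSumProd_cotuple_mk A X d)).trans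
      (Eq.trans ?_ (sigmaPiSumProd_cotuple_mk A X fun i => exch (σ.cons (X i)) τ (d i)).symm)
    exact Quotient.sound (s := convSetoid A _ _) (Conv.exch_cotuple σ τ d)
  ren_tup {I _} X Γ Γ' Δ Δ' σ τ f := by
    obtain ⟨d, rfl⟩ := exists_cls_family (S := fun i => ⟨Γ, X i ∷ Δ⟩) f
    refine (congrArg ((sigmaPi A).ren _ _) (sigmaPiSumProd_tuple_mk A X d)).trans
      (Eq.trans ?_ (sigmaPiSumProd_tuple_mk A X fun i => exch σ (τ.cons (X i)) (d i)).symm)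
    exact Quotient.sound (s := convSetoid A _ _) (Conv.exch_tuple σ τ d)
  cot_cut {I _} X Γ Δ Γ' Δ' z f h := by
    obtain ⟨d, rfl⟩ := exists_cls_family (S := fun i => ⟨X i ∷ Γ, z ∷ Δ⟩) f
    obtain ⟨h, rfl⟩ := exists_cls (S := ⟨z ∷ Γ', Δ'⟩) h
    refine (congrArg (fun t => (sigmaPi A).renL (consAppend _ Γ Γ')
        ((sigmaPi A).cut (Γ := Fml.sum X ∷ Γ) t (cls (S := ⟨z ∷ Γ', Δ'⟩) h)))
      (sigmaPiSumProd_cotuple_mk A X d)).trans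
      (Eq.trans ?_ (sigmaPiSumProd_cotuple_mk A X fun i =>
        exchL (consAppend _ Γ Γ') (cut (d i) h)).symm)
    exact Quotient.sound (s := convSetoid A _ _) (Conv.cotuple_cut d h)
  cut_cot {I _} X Γ Δ Γ' Δ' z h f := by
    obtain ⟨d, rfl⟩ := exists_cls_family (S := fun i => ⟨X i ∷ z ∷ Γ', Δ'⟩) f
    obtain ⟨h, rfl⟩ := exists_cls (S := ⟨Γ, z ∷ Δ⟩) h
    refine (congrArg (fun t => (sigmaPi A).renL (appendCons Γ _ Γ')
        ((sigmaPi A).cut (cls (S := ⟨Γ, z ∷ Δ⟩) h) ((sigmaPi A).renL (swap (Fml.sum X) z Γ') t)))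
      (sigmaPiSumProd_cotuple_mk A X d)).trans
      (Eq.trans ?_ (sigmaPiSumProd_cotuple_mk A X fun i =>
        exchL (appendCons Γ _ Γ') (cut h (exchL (swap _ z Γ') (d i)))).symm)
    exact Quotient.sound (s := convSetoid A _ _) (Conv.cut_cotuple h d)
  cut_tup {I _} X Γ Δ Γ' Δ' z h f := by
    obtain ⟨d, rfl⟩ := exists_cls_family (S := fun i => ⟨z ∷ Γ', X i ∷ Δ'⟩) f
    obtain ⟨h, rfl⟩ := exists_cls (S := ⟨Γ, z ∷ Δ⟩) h
    refine (congrArg (fun t => (sigmaPi A).renR (appendCons Δ _ Δ')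
        ((sigmaPi A).cut (Δ' := Fml.prod X ∷ Δ') (cls (S := ⟨Γ, z ∷ Δ⟩) h) t))
      (sigmaPiSumProd_tuple_mk A X d)).trans
      (Eq.trans ?_ (sigmaPiSumProd_tuple_mk A X fun i =>
        exchR (appendCons Δ _ Δ') (cut h (d i))).symm)
    exact Quotient.sound (s := convSetoid A _ _) (Conv.cut_tuple h d)
  tup_cut {I _} X Γ Δ Γ' Δ' z f h := by
    obtain ⟨d, rfl⟩ := exists_cls_family (S := fun i => ⟨Γ, X i ∷ z ∷ Δ⟩) f
    obtain ⟨h, rfl⟩ := exists_cls (S := ⟨z ∷ Γ', Δ'⟩) h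
    refine (congrArg (fun t => (sigmaPi A).renR (consAppend _ Δ Δ')
        ((sigmaPi A).cut ((sigmaPi A).renR (swap (Fml.prod X) z Δ) t) (cls (S := ⟨z ∷ Γ', Δ'⟩) h)))
      (sigmaPiSumProd_tuple_mk A X d)).trans
      (Eq.trans ?_ (sigmaPiSumProd_tuple_mk A X fun i =>
        exchR (consAppend _ Δ Δ') (cut (exchR (swap _ z Δ) (d i)) h)).symm)
    exact Quotient.sound (s := convSetoid A _ _) (Conv.tuple_cut d h)

/-- Cotupling or tupling in `ΣΠ_A`. -/
noncomputable abbrev tup (p : Bool) {I : Type} [Finite I] (X : I → (sigmaPi A).Obj)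
    {S : Sequent (sigmaPi A).Obj} (f : ∀ i, (sigmaPi A).H (cons p (X i) S)) :
    (sigmaPi A).H (cons p ((sigmaPiSumProd A).conn p X) S) := (sigmaPiSumProd A).tup p X f

/-- Projection or injection as an operation on a channel. -/
noncomputable def selOp {p q : Bool} (h : p ≠ q) {I : Type} [Finite I] (X : I → (sigmaPi A).Obj) (k : I) :
    ChanOp (sigmaPi A) where
  pol := p
  K := Unit
  X _ := X k
  z := (sigmaPiSumProd A).conn q X
  op f := sel h k (f ())
  sren_op {S S'} σ f := by
    obtain ⟨d, rfl⟩ := exists_cls_family f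
    match p, q, h with
    | false, true, _ => exact cls_eq (S := cons false _ _) (Conv.exch_proj k σ.l σ.r (d ()))
    | true, false, _ => exact cls_eq (S := cons true _ _) (Conv.exch_inj k σ.l σ.r (d ()))
    | true, true, h => exact absurd rfl h
    | false, false, h => exact absurd rfl h
  rcut_op {S S' x} g f := by
    obtain ⟨d, rfl⟩ := exists_cls_family f
    obtain ⟨g, rfl⟩ := exists_cls g
    match p, q, h with
    | false, true, _ =>
      exact cls_eq (S := cons false _ (S'.append S)) (Conv.cut_proj (Γ' := S.L) (Δ' := S.R) k g (d ()))
    | true, false, _ =>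
      -- The general law of a `ChanOp` contains a swap, which `Conv.cut_inj` omits because it is the
      -- identity for channels of opposite polarity.
      have e : ∀ (w : (sigmaPi A).Obj) (f : (sigmaPi A).H (cons true w (cons false x S))),
        sren (SRen.swap true w false x S) f = f := fun w f => sren_refl f
      refine (congrArg (fun t => sren _ (rcut _ t)) (e _ _)).trans
        (Eq.trans ?_ (congrArg (fun t => sel _ k (sren _ (rcut _ t))) (e _ _)).symm)
      exact cls_eq (S := cons true _ (S'.append S)) (Conv.cut_inj (Γ' := S.L) (Δ' := S.R) k g (d ()))
    | true, true, h => exact absurd rfl h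
    | false, false, h => exact absurd rfl h
  op_rcut {S S' x} f g := by
    obtain ⟨d, rfl⟩ := exists_cls_family f
    obtain ⟨g, rfl⟩ := exists_cls g
    match p, q, h with
    | false, true, _ =>
      have e : ∀ (w : (sigmaPi A).Obj) (f : (sigmaPi A).H (cons false w (cons true x S))),
        sren (SRen.swap false w true x S) f = f := fun w f => sren_refl f
      refine (congrArg (fun t => sren _ (rcut t _)) (e _ _)).trans
        (Eq.trans ?_ (congrArg (fun t => sel _ k (sren _ (rcut t _))) (e _ _)).symm)
      exact cls_eq (S := cons false _ (S.append S')) (Conv.proj_cut (Γ := S.L) (Δ := S.R) k (d ()) g)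
    | true, false, _ =>
      exact cls_eq (S := cons true _ (S.append S')) (Conv.inj_cut (Γ := S.L) (Δ := S.R) k (d ()) g)
    | true, true, h => exact absurd rfl h
    | false, false, h => exact absurd rfl h

theorem cls_cotuple {I : Type} [Finite I] {X : I → (sigmaPi A).Obj} {Γ Δ : Ctx (sigmaPi A).Obj}
    (d : ∀ i, Deriv A (X i ∷ Γ) Δ) :
    cls (S := cons false (Fml.sum X) ⟨Γ, Δ⟩) (cotuple d) =
      tup false X fun i => cls (S := cons false (X i) ⟨Γ, Δ⟩) (d i) :=
  (sigmaPiSumProd_cotuple_mk A X d).symm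

theorem cls_tuple {I : Type} [Finite I] {X : I → (sigmaPi A).Obj} {Γ Δ : Ctx (sigmaPi A).Obj}
    (d : ∀ i, Deriv A Γ (X i ∷ Δ)) :
    cls (S := cons true (Fml.prod X) ⟨Γ, Δ⟩) (tuple d) =
      tup true X fun i => cls (S := cons true (X i) ⟨Γ, Δ⟩) (d i) :=
  (sigmaPiSumProd_tuple_mk A X d).symm

/-- The principal reduction. -/
theorem sel_scut_tup {p q : Bool} (h : p ≠ q) {I : Type} [Finite I] {X : I → (sigmaPi A).Obj} (k : I)
    {S T : Sequent (sigmaPi A).Obj} (f : (sigmaPi A).H (cons p (X k) S))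
    (g : ∀ i, (sigmaPi A).H (cons q (X i) T)) :
    scut h (sel h k f) (tup q X g) = scut h f (g k) := by
  obtain ⟨f, rfl⟩ := exists_cls f
  obtain ⟨g, rfl⟩ := exists_cls_family g
  match p, q, h with
  | false, true, _ =>
    refine (congrArg (scut _ _) (cls_tuple (Γ := T.L) (Δ := T.R) g).symm).trans ?_
    exact congrArg (sren _) (cls_eq (S := T.append S) (Conv.tuple_cut_proj (Γ := T.L) (Δ := T.R)
      (Γ' := S.L) (Δ' := S.R) k g f))
  | true, false, _ =>
    refine (congrArg (scut _ _) (cls_cotuple (Γ := T.L) (Δ := T.R) g).symm).trans ?_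
    exact cls_eq (S := S.append T) (Conv.inj_cut_cotuple (Γ := S.L) (Δ := S.R)
      (Γ' := T.L) (Δ' := T.R) k f g)
  | true, true, h => exact absurd rfl h
  | false, false, h => exact absurd rfl h

/-- The class of an axiom. -/
def sax {S : Sequent A.Obj} (u : A.H S) : (sigmaPi A).H (S.map atom) :=
  cls (S := S.map atom) (ax u)

theorem sren_sax {S T : Sequent A.Obj} (σ : SRen S T) (u : A.H S) :
    sren (σ.map atom) (sax u) = sax (sren σ u) :=
  cls_eq (S := T.map atom) (Conv.exch_ax σ.l σ.r u)

/-- The class of an axiom with a distinguished channel. -/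
def saxCons {p : Bool} {a : A.Obj} {S : Sequent A.Obj} (u : A.H (cons p a S)) :
    (sigmaPi A).H (cons p (atom a) (S.map atom)) := sren (SRen.mapCons atom p a S) (sax u)

/-- The evaluation rule `Conv.ax_cut` covers an output against an input; the other order follows by
exchanging the parts both in `A` and in the term model. -/
theorem scut_saxCons {p q : Bool} (h : p ≠ q) {a : A.Obj} {S T : Sequent A.Obj}
    (u : A.H (cons p a S)) (w : A.H (cons q a T)) :
    scut h (saxCons u) (saxCons w) = sren (SRen.mapAppend atom S T) (sax (scut h u w)) := by
  match p, q, h with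
  | true, false, _ =>
    exact cls_eq (S := (S.map atom).append (T.map atom)) (Conv.ax_cut (Γ := S.L) (Δ := S.R)
      (Γ' := T.L) (Δ' := T.R) u w)
  | false, true, _ =>
    change sren _ (rcut _ _) = sren _ (sax (sren _ _))
    have : rcut (saxCons w) (saxCons u) = sren (SRen.mapAppend _ T S) (sax (rcut w u)) :=
      cls_eq (S := (T.map atom).append (S.map atom)) (Conv.ax_cut (Γ := T.L) (Δ := T.R)
        (Γ' := S.L) (Δ' := S.R) w u)
    rw [this, ← sren_sax, sren_sren]
    have e : (SRen.mapAppend atom T S).trans (SRen.comm _ _) =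
        ((SRen.comm T S).map atom).trans (SRen.mapAppend atom S T) := by
      simp [SRen.ext_app]
    exact (congrArg (fun σ => sren (P := sigmaPi A) σ _) e).trans (sren_sren _ _ _).symm
  | true, true, h => exact absurd rfl h
  | false, false, h => exact absurd rfl h

end Operations

end SigmaPi

namespace SigmaPi
open Renaming Sequent PolyData Deriv

/-! ### Cut elimination -/

section CutElimination

variable {A : PolyData.{u, v}}

/-- The logical rules. -/
inductive IsRule : ChanOp (sigmaPi A) → Prop
  | tup (p : Bool) {I : Type} [Finite I] (X : I → (sigmaPi A).Obj) :
      IsRule (SumProdData.tupOp sigmaPiSumProd_natural p X)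
  | sel {p q : Bool} (h : p ≠ q) {I : Type} [Finite I] (X : I → (sigmaPi A).Obj) (k : I) :
      IsRule (selOp h X k)

/-- Classes of cut-free derivations. -/
inductive CutFree : ∀ {S : Sequent (sigmaPi A).Obj}, (sigmaPi A).H S → Prop
  | ax {S : Sequent A.Obj} (u : A.H S) : CutFree (sax u)
  | ren {S T : Sequent (sigmaPi A).Obj} (σ : SRen S T) {f : (sigmaPi A).H S} :
      CutFree f → CutFree (sren σ f)
  | op (o : ChanOp (sigmaPi A)) (ho : IsRule o) {S : Sequent (sigmaPi A).Obj}
      (f : ∀ k, (sigmaPi A).H (cons o.pol (o.X k) S)) : (∀ k, CutFree (f k)) → CutFree (o.op f)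

/-- Classes of cut-free derivations whose last rule is an axiom or acts on the distinguished
channel. -/
inductive Main : ∀ (p : Bool) (x : (sigmaPi A).Obj) {S : Sequent (sigmaPi A).Obj},
    (sigmaPi A).H (cons p x S) → Prop
  | ax {p : Bool} {a : A.Obj} {S : Sequent A.Obj} (u : A.H (cons p a S)) :
      Main p (atom a) (saxCons u)
  | op (o : ChanOp (sigmaPi A)) (ho : IsRule o) {S : Sequent (sigmaPi A).Obj}
      (f : ∀ k, (sigmaPi A).H (cons o.pol (o.X k) S)) : (∀ k, CutFree (f k)) →
      Main o.pol o.z (o.op f)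

/-- Cut-free derivations analysed up to the rule that introduces the distinguished channel. -/
inductive Focused (p : Bool) (x : (sigmaPi A).Obj) : ∀ {S : Sequent (sigmaPi A).Obj},
    (sigmaPi A).H (cons p x S) → Prop
  | main {S : Sequent (sigmaPi A).Obj} {f : (sigmaPi A).H (cons p x S)} : Main p x f → Focused p x f
  | ren {S T : Sequent (sigmaPi A).Obj} (σ : SRen S T) {f : (sigmaPi A).H (cons p x S)} :
      Focused p x f → Focused p x (sren (σ.cons p x) f)
  | side (o : ChanOp (sigmaPi A)) (ho : IsRule o) {S : Sequent (sigmaPi A).Obj}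
      (f : ∀ k, (sigmaPi A).H (cons p x (cons o.pol (o.X k) S))) : (∀ k, Focused p x (f k)) →
      Focused p x (sren (SRen.swap o.pol o.z p x S)
        (o.op fun k => sren (SRen.swap p x o.pol (o.X k) S) (f k)))

/-- Every channel of an axiom carries an atom, so the renaming factors through one that exposes the
channel already in `A`; the axiom is then principal on it. -/
theorem Focused.ax {S : Sequent A.Obj} (u : A.H S) {p : Bool} {x : (sigmaPi A).Obj}
    {S' : Sequent (sigmaPi A).Obj} (σ : SRen (S.map atom) (cons p x S')) :
    Focused p x (sren (P := sigmaPi A) σ (sax u)) := by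
  obtain ⟨a, S₁, ρ, τ, rfl, h⟩ := σ.exists_map_cons
  obtain rfl := eq_of_heq h
  have e : sren (P := sigmaPi A) (((ρ.map atom).trans (SRen.mapCons atom p a S₁)).trans
      (τ.cons p _)) (sax u) = sren (P := sigmaPi A) (τ.cons p _) (saxCons (sren ρ u)) := by
    rw [saxCons, ← sren_sax, ← sren_sren, ← sren_sren]
  rw [e]
  exact .ren τ (.main (.ax _))

/-- Any channel of a cut-free class may serve as the cut channel. By `SRen.split`, the last logical
rule either acts on it, and is principal, or acts on another channel and becomes a side rule. -/
theorem CutFree.focused {S : Sequent (sigmaPi A).Obj} {f : (sigmaPi A).H S} (hf : CutFree f)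
    {p : Bool} {x : (sigmaPi A).Obj} {S' : Sequent (sigmaPi A).Obj} (σ : SRen S (cons p x S')) :
    Focused p x (sren (P := sigmaPi A) σ f) := by
  induction hf generalizing S' with
  | ax u => exact .ax u σ
  | ren τ _ ih => rw [sren_sren]; exact ih _
  | op o ho f hf ih =>
    rcases σ.split with ⟨rfl, rfl, σ, h⟩ | ⟨W, τ, ρ, rfl⟩
    · obtain rfl := eq_of_heq h
      exact .ren σ (.main (.op o ho f hf))
    · rw [← sren_sren, ← sren_sren, o.sren_op]
      refine .ren ρ ?_
      have := Focused.side o ho (S := W) (p := p) (x := x)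
        (fun k => sren (SRen.swap o.pol (o.X k) p x W) (sren (τ.cons _ _) (f k)))
        (fun k => by rw [sren_sren]; exact ih k _)
      have e : (fun k => sren (SRen.swap p x o.pol (o.X k) W)
          (sren (SRen.swap o.pol (o.X k) p x W) (sren (τ.cons _ _) (f k)))) =
          fun k => sren (τ.cons _ _) (f k) := funext fun k => by
        rw [sren_sren (SRen.swap _ _ _ _ _)]; exact sren_eq_self (by simp) _
      rwa [e] at this

/-- Inductions on `Focused` deliver focused subderivations, while cut elimination is stated for
cut-free ones; this is the way back. -/
theorem CutFree.of_focused {p : Bool} {x : (sigmaPi A).Obj} {S : Sequent (sigmaPi A).Obj}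
    {f : (sigmaPi A).H (cons p x S)} (hf : Focused p x f) : CutFree f := by
  induction hf with
  | main h =>
    cases h with
    | ax u => exact .ren _ (.ax u)
    | op o ho f hf => exact .op o ho f hf
  | ren σ _ ih => exact .ren _ ih
  | side o ho f _ ih => exact .ren _ (.op o ho _ fun k => .ren _ (ih k))

theorem CutFree.focused_cons {p : Bool} {x : (sigmaPi A).Obj} {S : Sequent (sigmaPi A).Obj}
    {f : (sigmaPi A).H (cons p x S)} (hf : CutFree f) : Focused p x f := by
  have := hf.focused (SRen.refl _)
  rwa [sren_refl] at this

/-- The immediate subformula relation. -/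
inductive Fml.Sub {O : Type u} : Fml O → Fml O → Prop
  | sum {I : Type} [Finite I] (X : I → Fml O) (i : I) : Sub (X i) (.sum X)
  | prod {I : Type} [Finite I] (X : I → Fml O) (i : I) : Sub (X i) (.prod X)

theorem Fml.wf_sub {O : Type u} : WellFounded (Fml.Sub (O := O)) := by
  refine ⟨fun x => ?_⟩
  induction x with
  | atom a => exact ⟨_, fun y h => nomatch h⟩
  | sum X ih => exact ⟨_, fun y h => by cases h; exact ih _⟩
  | prod X ih => exact ⟨_, fun y h => by cases h; exact ih _⟩

/-- The immediate subformula relation on the objects of `ΣΠ_A`. -/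
def Sub : (sigmaPi A).Obj → (sigmaPi A).Obj → Prop := Fml.Sub

theorem wf_sub : WellFounded (Sub (A := A)) := Fml.wf_sub

theorem sub_conn (p : Bool) {I : Type} [Finite I] (X : I → (sigmaPi A).Obj) (i : I) :
    Sub (X i) ((sigmaPiSumProd A).conn p X) := by
  cases p
  · exact Fml.Sub.sum X i
  · exact Fml.Sub.prod X i

theorem conn_ne_atom (p : Bool) {I : Type} [Finite I] (X : I → (sigmaPi A).Obj) (a : A.Obj) :
    (sigmaPiSumProd A).conn p X ≠ atom a := by
  cases p <;> exact fun h => nomatch h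

theorem eq_of_ne_of_ne {p q r : Bool} (h : p ≠ q) (h' : q ≠ r) : r = p := by
  revert p q r; decide

/-- The principal cases: two axioms, or a selection against a tupling. -/
theorem Main.pair_elim {p q : Bool} (hpq : p ≠ q)
    {motive : ∀ {x : (sigmaPi A).Obj} {S T : Sequent (sigmaPi A).Obj}, (sigmaPi A).H (cons p x S) →
      (sigmaPi A).H (cons q x T) → Prop}
    (ax : ∀ {a : A.Obj} {S T : Sequent A.Obj} (u : A.H (cons p a S)) (w : A.H (cons q a T)),
      motive (saxCons u) (saxCons w))
    (sel_tup : ∀ {I : Type} [Finite I] {X : I → (sigmaPi A).Obj} (k : I) {S T : Sequent (sigmaPi A).Obj}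
      (f : (sigmaPi A).H (cons p (X k) S)) (g : ∀ i, (sigmaPi A).H (cons q (X i) T)),
      CutFree f → (∀ i, CutFree (g i)) → motive (sel hpq k f) (tup q X g))
    (tup_sel : ∀ {I : Type} [Finite I] {X : I → (sigmaPi A).Obj} (k : I) {S T : Sequent (sigmaPi A).Obj}
      (f : ∀ i, (sigmaPi A).H (cons p (X i) S)) (g : (sigmaPi A).H (cons q (X k) T)),
      (∀ i, CutFree (f i)) → CutFree g → motive (tup p X f) (sel hpq.symm k g))
    {x : (sigmaPi A).Obj} {S T : Sequent (sigmaPi A).Obj} {f : (sigmaPi A).H (cons p x S)}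
    {g : (sigmaPi A).H (cons q x T)} (hf : Main p x f) (hg : Main q x g) : motive f g := by
  -- The two premises are inverted separately, with the equality of their cut formulas kept as `e`.
  -- Then `cases e` either identifies the two families or refutes a sum against a product, which
  -- disposes of two tuplings and of two selections.
  suffices ∀ {x y : (sigmaPi A).Obj} (e : x = y) {f : (sigmaPi A).H (cons p x S)}
      {g : (sigmaPi A).H (cons q y T)}, Main p x f → Main q y g → motive (e ▸ f) g from
    this rfl hf hg
  intro x y e f g hf hg
  cases hf with
  | ax u =>
    cases hg with
    | ax w => cases e; exact ax u w
    | op o ho g hg =>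
      cases ho with
      | tup => exact absurd e.symm (conn_ne_atom _ _ _)
      | sel => exact absurd e.symm (conn_ne_atom _ _ _)
  | op o ho f hf =>
    cases hg with
    | ax w =>
      cases ho with
      | tup => exact absurd e (conn_ne_atom _ _ _)
      | sel => exact absurd e (conn_ne_atom _ _ _)
    | op o' ho' g hg =>
      cases ho with
      | tup p X =>
        cases ho' with
        | tup q Y => cases p <;> cases q <;> first | exact absurd rfl hpq | cases e
        | @sel q r h _ _ Y k =>
          obtain rfl : r = p := eq_of_ne_of_ne hpq h
          cases r <;> cases e <;> exact tup_sel k _ _ hf (hg ())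
      | @sel p r h _ _ X k =>
        cases ho' with
        | tup q Y =>
          obtain rfl : r = q := eq_of_ne_of_ne hpq.symm h
          cases r <;> cases e <;> exact sel_tup k _ _ (hf ()) hg
        | @sel q r' h' _ _ Y l =>
          cases p <;> cases q <;> cases r <;> cases r' <;>
            first | exact absurd rfl hpq | exact absurd rfl h | exact absurd rfl h' | cases e

/-- Induction on the cut formula, then on the first and on the second premise, each analysed up to
the rule on the cut channel. Since being cut-free is a property of classes, commuting a side rule
with the cut is a rewriting; only the principal pairs use the hypothesis on subformulas. That
hypothesis covers both orders of polarity, as the third principal case exchanges the premises. -/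
theorem CutFree.scut {x : (sigmaPi A).Obj} : ∀ {p q : Bool} (h : p ≠ q) {S T : Sequent (sigmaPi A).Obj}
    {f : (sigmaPi A).H (cons p x S)} {g : (sigmaPi A).H (cons q x T)}, CutFree f → CutFree g →
    CutFree (scut h f g) := by
  induction x using wf_sub.induction with
  | _ x IH
  intro p q h S T f g hf hg
  induction hf.focused_cons generalizing T with
  | ren σ hf' ih =>
    rw [scut_sren_left]
    exact .ren _ (ih (.of_focused hf') hg)
  | side o ho f hf' ih =>
    rw [o.side_scut]
    exact .ren _ (.op o ho _ fun k => .ren _ (ih k (.of_focused (hf' k)) hg))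
  | main hf' =>
    clear hf
    induction hg.focused_cons with
    | ren σ hg' ih =>
      rw [scut_sren_right]
      exact .ren _ (ih (.of_focused hg'))
    | side o ho g hg' ih =>
      rw [o.scut_side]
      exact .ren _ (.op o ho _ fun k => .ren _ (ih k (.of_focused (hg' k))))
    | main hg' =>
      clear hg
      -- The hypothesis on subformulas goes into the motive because the case analysis replaces `x`
      -- by a specific formula.
      revert IH
      refine Main.pair_elim (motive := fun {x _ _} f g => (∀ y, Sub y x → ∀ {p q : Bool}
        (h : p ≠ q) {S T : Sequent (sigmaPi A).Obj} {f : (sigmaPi A).H (cons p y S)}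
        {g : (sigmaPi A).H (cons q y T)}, CutFree f → CutFree g → CutFree (PolyData.scut h f g)) →
        CutFree (PolyData.scut h f g)) h ?_ ?_ ?_ hf' hg'
      · intro a S T u w _
        rw [scut_saxCons]
        exact .ren _ (.ax _)
      · intro I _ X k S T f g hf hg IH
        rw [sel_scut_tup]
        exact IH _ (sub_conn _ X k) h hf (hg k)
      · intro I _ X k S T f g hf hg IH
        rw [← scut_comm h.symm, sel_scut_tup]
        exact .ren _ (IH _ (sub_conn _ X k) h.symm hg (hf k))

theorem cutFree_cls {Γ Δ : Ctx (sigmaPi A).Obj} (d : Deriv A Γ Δ) : CutFree (cls (S := ⟨Γ, Δ⟩) d) := by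
  induction d with
  | ax u => exact .ax (S := ⟨_, _⟩) u
  | exch σ τ d ih => exact .ren (S := ⟨_, _⟩) (T := ⟨_, _⟩) ⟨σ, τ⟩ ih
  | @cotuple I _ X Γ Δ d ih =>
    exact (cls_cotuple d).symm ▸ CutFree.op _ (.tup false X) (S := ⟨Γ, Δ⟩) _ ih
  | @tuple I _ X Γ Δ d ih =>
    exact (cls_tuple d).symm ▸ CutFree.op _ (.tup true X) (S := ⟨Γ, Δ⟩) _ ih
  | @proj I _ X Γ Δ k d ih =>
    exact CutFree.op _ (.sel (p := false) (q := true) (by decide) X k) (S := ⟨Γ, Δ⟩)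
      (fun _ => cls (S := cons false (X k) ⟨Γ, Δ⟩) d) fun _ => ih
  | @inj I _ X Γ Δ k d ih =>
    exact CutFree.op _ (.sel (p := true) (q := false) (by decide) X k) (S := ⟨Γ, Δ⟩)
      (fun _ => cls (S := cons true (X k) ⟨Γ, Δ⟩) d) fun _ => ih
  | @cut Z Γ Δ Γ' Δ' d e ihd ihe =>
    exact CutFree.scut (p := true) (q := false) (by decide) (S := ⟨Γ, Δ⟩) (T := ⟨Γ', Δ'⟩) ihd ihe

/-- Cut elimination. -/
theorem cutFree {S : Sequent (sigmaPi A).Obj} (f : (sigmaPi A).H S) : CutFree f := by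
  obtain ⟨d, rfl⟩ := exists_cls f
  exact cutFree_cls d

end CutElimination

end SigmaPi

namespace SigmaPi
open Renaming Sequent PolyData Deriv

/-! ### Associativity of cut under operations on a channel -/

namespace PolyData

variable {P : PolyData.{u, v}} [P.RenLaws] {S S' T T' U : Sequent P.Obj} {x y : P.Obj}

/-- Two ways of renaming before and after an operation agree as soon as a renaming `v` of the
remaining channels intertwines them, by naturality of the operation. This reduces coherence below a
rule to a check on channels. -/
theorem ChanOp.sren_op_congr (o : ChanOp P) {V V' Θ : Sequent P.Obj} {Ξ : o.K → Sequent P.Obj}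
    (v : SRen V V') {e : SRen (cons o.pol o.z V) Θ} {e' : SRen (cons o.pol o.z V') Θ}
    {d : ∀ k, SRen (Ξ k) (cons o.pol (o.X k) V)} {d' : ∀ k, SRen (Ξ k) (cons o.pol (o.X k) V')}
    (F : ∀ k, P.H (Ξ k)) (h : ∀ c, e.app c = e'.app ((v.cons o.pol o.z).app c))
    (hd : ∀ k c, (d' k).app c = (v.cons o.pol (o.X k)).app ((d k).app c)) :
    sren e (o.op fun k => sren (d k) (F k)) = sren e' (o.op fun k => sren (d' k) (F k)) := by
  have h1 : ∀ k, sren (d' k) (F k) = sren (v.cons o.pol (o.X k)) (sren (d k) (F k)) := fun k => by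
    rw [sren_sren]; exact sren_congr (by simpa using hd k) _
  simp only [h1]
  rw [← o.sren_op, sren_sren]
  exact sren_congr (by simpa using h) _

variable {p p' q q' : Bool} {hp : p ≠ p'} {hq : q ≠ q'}

namespace ScutAssocAt

theorem ren_left {f : P.H (cons p x S)} {g : P.H (cons p' x (cons q y T))} {h : P.H (cons q' y U)}
    (H : ScutAssocAt hp hq f g h) (σ : SRen S S') :
    ScutAssocAt hp hq (sren (σ.cons p x) f) g h := by
  unfold ScutAssocAt at H ⊢
  rw [scut_sren_left, scut_sren_left, ← H, sren_sren,
    show (σ.append (SRen.refl _)).trans (SRen.appendCons q y S' T) =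
      (SRen.appendCons q y S T).trans ((σ.append (SRen.refl _)).cons q y) by
        simp [SRen.ext_app], ← sren_sren, scut_sren_left, sren_sren, sren_sren]
  exact sren_congr (by simp) _

/-- The rule `o` acts away from both cut channels, so it comes out of the iterated cuts on both
sides; beneath it stands the law for the premises `f k`, up to renaming. -/
theorem side_left (o : ChanOp P) {f : ∀ k, P.H (cons p x (cons o.pol (o.X k) S))}
    {g : P.H (cons p' x (cons q y T))} {h : P.H (cons q' y U)}
    (H : ∀ k, ScutAssocAt hp hq (f k) g h) :
    ScutAssocAt hp hq (sren (SRen.swap o.pol o.z p x S)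
      (o.op fun k => sren (SRen.swap p x o.pol (o.X k) S) (f k))) g h := by
  unfold ScutAssocAt at H ⊢
  -- After the first cut `y` must be exposed for the second one; this restores the shape to which
  -- `side_scut` applies.
  have step : sren (SRen.appendCons q y (cons o.pol o.z S) T)
      (sren (SRen.consAppend o.pol o.z S (cons q y T)).symm
        (o.op fun k => sren (SRen.consAppend o.pol (o.X k) S (cons q y T)) (scut hp (f k) g))) =
      sren ((SRen.consAppend o.pol o.z S T).symm.cons q y) (sren (SRen.swap o.pol o.z q y _)
        (o.op fun k => sren (SRen.swap q y o.pol (o.X k) _)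
          (sren ((SRen.consAppend o.pol (o.X k) S T).cons q y)
            (sren (SRen.appendCons q y _ T) (scut hp (f k) g))))) := by
    simp only [sren_sren]
    exact o.sren_op_congr (SRen.appendCons q y S T) _ (by simp) (by simp)
  rw [o.side_scut, step, scut_sren_left, o.side_scut, o.side_scut]
  simp only [scut_sren_left, ← H]
  simp only [sren_sren]
  exact o.sren_op_congr (SRen.assoc S T U) _ (by simp) (by simp)

theorem ren_mid {f : P.H (cons p x S)} {g : P.H (cons p' x (cons q y T))} {h : P.H (cons q' y U)}
    (H : ScutAssocAt hp hq f g h) (σ : SRen T T') :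
    ScutAssocAt hp hq f (sren ((σ.cons q y).cons p' x) g) h := by
  unfold ScutAssocAt at H ⊢
  rw [scut_sren_right, sren_sren, sren_sren,
    show ((SRen.refl S).append (σ.cons q y)).trans (SRen.appendCons q y S T') =
      (SRen.appendCons q y S T).trans (((SRen.refl S).append σ).cons q y) by
        simp [SRen.ext_app],
    show ((σ.cons q y).cons p' x).trans (SRen.swap p' x q y T') =
      (SRen.swap p' x q y T).trans ((σ.cons p' x).cons q y) by
        simp [SRen.ext_app], ← sren_sren, scut_sren_left, ← sren_sren (SRen.swap _ _ _ _ _),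
    scut_sren_left, sren_sren, sren_sren,
    show ((σ.cons p' x).append (SRen.refl U)).trans (SRen.consAppend p' x T' U) =
      (SRen.consAppend p' x T U).trans ((σ.append (SRen.refl U)).cons p' x) by
        simp [SRen.ext_app], ← sren_sren (SRen.consAppend _ _ _ _), scut_sren_right, ← H, sren_sren]
  exact sren_congr (by simp) _

/-- The same argument as for `side_left`, but here the channel of `o` has to move past both `x` and
`y`. The three auxiliary equations expose the next cut channel: after the cut with `f`, before the
cut with `h`, and after the cut with `h`. -/
theorem side_mid (o : ChanOp P) {f : P.H (cons p x S)}
    {g : ∀ k, P.H (cons p' x (cons q y (cons o.pol (o.X k) T)))} {h : P.H (cons q' y U)}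
    (H : ∀ k, ScutAssocAt hp hq f (g k) h) :
    ScutAssocAt hp hq f (sren ((SRen.swap o.pol o.z q y T).cons p' x)
      (sren (SRen.swap o.pol o.z p' x (cons q y T))
        (o.op fun k => sren (SRen.swap p' x o.pol (o.X k) (cons q y T))
          (sren ((SRen.swap q y o.pol (o.X k) T).cons p' x) (g k))))) h := by
  unfold ScutAssocAt at H ⊢
  have step : sren (SRen.appendCons q y S (cons o.pol o.z T))
      (sren ((SRen.refl S).append (SRen.swap o.pol o.z q y T))
        (sren (SRen.appendCons o.pol o.z S (cons q y T)).symm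
          (o.op fun k => sren (SRen.appendCons o.pol (o.X k) S (cons q y T))
            (sren ((SRen.refl S).append (SRen.swap q y o.pol (o.X k) T)) (scut hp f (g k)))))) =
      sren ((SRen.appendCons o.pol o.z S T).symm.cons q y) (sren (SRen.swap o.pol o.z q y _)
        (o.op fun k => sren (SRen.swap q y o.pol (o.X k) _)
          (sren ((SRen.appendCons o.pol (o.X k) S T).cons q y)
            (sren (SRen.appendCons q y S _) (scut hp f (g k)))))) := by
    simp only [sren_sren]
    exact o.sren_op_congr (SRen.appendCons q y S T) _ (by simp) (by simp)
  have step' : sren (SRen.swap p' x q y (cons o.pol o.z T))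
      (sren ((SRen.swap o.pol o.z q y T).cons p' x) (sren (SRen.swap o.pol o.z p' x (cons q y T))
        (o.op fun k => sren (SRen.swap p' x o.pol (o.X k) (cons q y T))
          (sren ((SRen.swap q y o.pol (o.X k) T).cons p' x) (g k))))) =
      sren ((SRen.swap o.pol o.z p' x T).cons q y)
        (sren (SRen.swap o.pol o.z q y (cons p' x T))
          (o.op fun k => sren (SRen.swap q y o.pol (o.X k) (cons p' x T))
            (sren ((SRen.swap p' x o.pol (o.X k) T).cons q y)
              (sren (SRen.swap p' x q y _) (g k))))) := by
    simp only [sren_sren]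
    exact o.sren_op_congr (SRen.swap p' x q y T) _ (by simp) (by simp)
  have step'' : ∀ (F : ∀ k, P.H (append (cons p' x (cons o.pol (o.X k) T)) U)),
      sren (SRen.consAppend p' x (cons o.pol o.z T) U)
        (sren ((SRen.swap o.pol o.z p' x T).append (SRen.refl U))
          (sren (SRen.consAppend o.pol o.z (cons p' x T) U).symm
            (o.op fun k => sren (SRen.consAppend o.pol (o.X k) (cons p' x T) U)
              (sren ((SRen.swap p' x o.pol (o.X k) T).append (SRen.refl U)) (F k))))) =
      sren ((SRen.consAppend o.pol o.z T U).symm.cons p' x) (sren (SRen.swap o.pol o.z p' x _)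
        (o.op fun k => sren (SRen.swap p' x o.pol (o.X k) _)
          (sren ((SRen.consAppend o.pol (o.X k) T U).cons p' x)
            (sren (SRen.consAppend p' x _ U) (F k))))) := fun F => by
    simp only [sren_sren]
    exact o.sren_op_congr (SRen.consAppend p' x T U) _ (by simp) (by simp)
  rw [scut_sren_right, o.scut_side]
  simp only [scut_sren_right]
  rw [step, scut_sren_left, o.side_scut, step', scut_sren_left, o.side_scut]
  simp only [scut_sren_left]
  rw [step'', scut_sren_right, o.scut_side]
  simp only [scut_sren_right]
  simp only [← H]
  simp only [sren_sren]
  exact o.sren_op_congr (SRen.assoc S T U) _ (by simp) (by simp)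

/-- Swapping twice is the identity, so reversing the law is an equivalence; closure properties in
`h` follow from those in `f`. -/
theorem symm_iff {f : P.H (cons p x S)} {g : P.H (cons p' x (cons q y T))} {h : P.H (cons q' y U)} :
    ScutAssocAt hq.symm hp.symm h (sren (SRen.swap p' x q y T) g) f ↔ ScutAssocAt hp hq f g h := by
  refine ⟨fun H => ?_, scutAssocAt_symm hp hq f g h⟩
  have := scutAssocAt_symm _ _ _ _ _ H
  rwa [sren_sren, sren_eq_self (by simp)] at this

theorem ren_right {f : P.H (cons p x S)} {g : P.H (cons p' x (cons q y T))}
    {h : P.H (cons q' y U)} (H : ScutAssocAt hp hq f g h) (σ : SRen U S') :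
    ScutAssocAt hp hq f g (sren (σ.cons q' y) h) :=
  symm_iff.1 ((symm_iff.2 H).ren_left σ)

theorem side_right (o : ChanOp P) {f : P.H (cons p x S)}
    {g : P.H (cons p' x (cons q y T))} {h : ∀ k, P.H (cons q' y (cons o.pol (o.X k) U))}
    (H : ∀ k, ScutAssocAt hp hq f g (h k)) :
    ScutAssocAt hp hq f g (sren (SRen.swap o.pol o.z q' y U)
      (o.op fun k => sren (SRen.swap q' y o.pol (o.X k) U) (h k))) :=
  symm_iff.1 (side_left o fun k => symm_iff.2 (H k))

end ScutAssocAt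

end PolyData

end SigmaPi

namespace SigmaPi
open Renaming Sequent PolyData Deriv

/-! ### Associativity of cut in `ΣΠ_A` -/

section Associativity

variable {A : PolyData.{u, v}}

/-- Cut-free derivations analysed up to the rule that introduces one of the first two channels. -/
inductive Focused₂ (p : Bool) (x : (sigmaPi A).Obj) (q : Bool) (y : (sigmaPi A).Obj) :
    ∀ {T : Sequent (sigmaPi A).Obj}, (sigmaPi A).H (cons p x (cons q y T)) → Prop
  | ax {a b : A.Obj} (hx : x = atom a) (hy : y = atom b) {S : Sequent A.Obj}
      (u : A.H (cons p a (cons q b S))) {T : Sequent (sigmaPi A).Obj} (σ : SRen (S.map atom) T)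
      {g : (sigmaPi A).H (cons p x (cons q y T))}
      (hg : HEq g (sren (((SRen.mapCons atom q b S).trans (σ.cons q (atom b))).cons p (atom a))
        (saxCons u))) : Focused₂ p x q y g
  | main_left {T : Sequent (sigmaPi A).Obj} {g : (sigmaPi A).H (cons p x (cons q y T))}
      (o : ChanOp (sigmaPi A)) (ho : IsRule o)
      (f : ∀ k, (sigmaPi A).H (cons o.pol (o.X k) (cons q y T))) (hf : ∀ k, CutFree (f k))
      (hp : o.pol = p) (hx : o.z = x) (hg : HEq g (o.op f)) : Focused₂ p x q y g
  | main_right {T : Sequent (sigmaPi A).Obj} {g : (sigmaPi A).H (cons p x (cons q y T))}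
      (o : ChanOp (sigmaPi A)) (ho : IsRule o)
      (f : ∀ k, (sigmaPi A).H (cons o.pol (o.X k) (cons p x T))) (hf : ∀ k, CutFree (f k))
      (hp : o.pol = q) (hx : o.z = y) (hg : HEq (sren (SRen.swap p x q y T) g) (o.op f)) :
      Focused₂ p x q y g
  | ren {T T' : Sequent (sigmaPi A).Obj} (σ : SRen T T')
      {g : (sigmaPi A).H (cons p x (cons q y T))} :
      Focused₂ p x q y g → Focused₂ p x q y (sren ((σ.cons q y).cons p x) g)
  | side (o : ChanOp (sigmaPi A)) (ho : IsRule o) {T : Sequent (sigmaPi A).Obj}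
      (f : ∀ k, (sigmaPi A).H (cons p x (cons q y (cons o.pol (o.X k) T)))) :
      (∀ k, Focused₂ p x q y (f k)) →
      Focused₂ p x q y (sren ((SRen.swap o.pol o.z q y T).cons p x)
        (sren (SRen.swap o.pol o.z p x (cons q y T))
          (o.op fun k => sren (SRen.swap p x o.pol (o.X k) (cons q y T))
            (sren ((SRen.swap q y o.pol (o.X k) T).cons p x) (f k)))))

/-- Splitting the renaming twice shows whether the last rule acts on the first channel, on the
second, or on neither. In an axiom both channels are atoms and are exposed in `A`. -/
theorem CutFree.focused₂ {S : Sequent (sigmaPi A).Obj} {f : (sigmaPi A).H S} (hf : CutFree f)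
    {p q : Bool} {x y : (sigmaPi A).Obj} {T : Sequent (sigmaPi A).Obj}
    (σ : SRen S (cons p x (cons q y T))) : Focused₂ p x q y (sren σ f) := by
  induction hf generalizing T with
  | ax u =>
    obtain ⟨a, S₁, ρ, τ, rfl, h⟩ := σ.exists_map_cons
    obtain rfl := eq_of_heq h
    obtain ⟨b, S₂, ρ', τ', rfl, h⟩ := τ.exists_map_cons
    obtain rfl := eq_of_heq h
    refine .ax rfl rfl (sren (ρ'.cons p a) (sren ρ u)) τ' (heq_of_eq ?_)
    rw [saxCons, ← sren_sax, ← sren_sax]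
    simp only [sren_sren]
    refine sren_congr (forall_map.2 fun c => ?_) _
    simp only [SRen.app_trans, SRen.app_map]
    generalize ρ.app c = c
    revert c
    refine forall_cons.2 ⟨by simp, fun c => ?_⟩
    simp only [SRen.app_trans, SRen.app_map, SRen.app_cons_there, SRen.app_mapCons_there]
  | ren τ _ ih => rw [sren_sren]; exact ih _
  | op o ho f hf ih =>
    rcases σ.split with ⟨rfl, rfl, σ, h⟩ | ⟨W, τ, ρ, rfl⟩
    · obtain rfl := eq_of_heq h
      rw [o.sren_op]
      exact .main_left o ho _ (fun k => .ren _ (hf k)) rfl rfl HEq.rfl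
    · rcases ρ.split with ⟨rfl, rfl, ρ, h⟩ | ⟨V, ω, ρ, rfl⟩
      · obtain rfl := eq_of_heq h
        refine .main_right o ho (fun k => sren ((τ.trans (ρ.cons p x)).cons _ _) (f k))
          (fun k => .ren _ (hf k)) rfl rfl (heq_of_eq ?_)
        rw [← o.sren_op, sren_sren]
        refine sren_congr ?_ _
        simp only [forall_cons, SRen.app_trans, SRen.app_cons_here, SRen.app_cons_there]
        refine ⟨by simp, fun c => ?_⟩
        generalize τ.app c = c
        revert c
        simp
      · have := Focused₂.ren ρ (Focused₂.side o ho (T := V) (p := p) (x := x) (q := q) (y := y)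
          (fun k => sren ((SRen.swap o.pol (o.X k) q y V).cons p x)
            (sren (SRen.swap o.pol (o.X k) p x (cons q y V))
              (sren ((τ.trans (ω.cons p x)).cons _ _) (f k))))
          (fun k => by simp only [sren_sren]; exact ih k _))
        convert this using 1
        simp only [sren_sren]
        -- A trivial renaming gives the premises the form required by `sren_op_congr`.
        have e : f = fun k => sren (SRen.refl _) (f k) := funext fun k => (sren_refl _).symm
        conv_lhs => rw [e]
        refine o.sren_op_congr (τ.trans (ω.cons p x)) f ?_ fun k => ?_
        all_goals
          refine forall_cons.2 ⟨by simp, fun c => ?_⟩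
          simp only [SRen.app_trans, SRen.app_cons_there, SRen.app_refl]
          generalize τ.app c = c
          revert c
          simp

theorem IsRule.z_ne_atom {o : ChanOp (sigmaPi A)} (ho : IsRule o) (a : A.Obj) : o.z ≠ atom a := by
  cases ho <;> exact conn_ne_atom _ _ _

/-- A logical rule introduces a compound formula, so on an atomic channel only the axiom case
survives. -/
theorem Main.exists_ax {p : Bool} {x : (sigmaPi A).Obj} {S : Sequent (sigmaPi A).Obj}
    {f : (sigmaPi A).H (cons p x S)} (hf : Main p x f) {a : A.Obj} (hx : x = atom a) :
    ∃ (S₀ : Sequent A.Obj) (u : A.H (cons p a S₀)), S = S₀.map atom ∧ HEq f (saxCons u) := by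
  cases hf with
  | ax u => cases hx; exact ⟨_, u, rfl, HEq.rfl⟩
  | op o ho f hf => exact absurd hx (ho.z_ne_atom a)

theorem tup_scut_sel {p q : Bool} (h : p ≠ q) {I : Type} [Finite I] {X : I → (sigmaPi A).Obj}
    (k : I) {S T : Sequent (sigmaPi A).Obj} (f : ∀ i, (sigmaPi A).H (cons p (X i) S))
    (g : (sigmaPi A).H (cons q (X k) T)) :
    scut h (tup p X f) (sel h.symm k g) = scut h (f k) g := by
  rw [← scut_comm h.symm, sel_scut_tup, scut_comm]

/-- Both `f` and `g` introduce the compound formula `x`. On the left the cut of `f` with `g` reduces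
at once; on the right the rule of `g` first commutes with the cut against `h` and then meets `f`.
The results are the two sides of the law at an immediate subformula of `x`. -/
theorem scutAssocAt_main_left {x y : (sigmaPi A).Obj}
    (IH : ∀ x', Sub x' x → ∀ {S T U : Sequent (sigmaPi A).Obj} {p p' q q' : Bool} (hp : p ≠ p')
      (hq : q ≠ q') (f : (sigmaPi A).H (cons p x' S))
      (g : (sigmaPi A).H (cons p' x' (cons q y T))) (h : (sigmaPi A).H (cons q' y U)),
      ScutAssocAt hp hq f g h)
    {S T U : Sequent (sigmaPi A).Obj} {p p' q q' : Bool} (hp : p ≠ p')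
    (hq : q ≠ q') {f : (sigmaPi A).H (cons p x S)} (hf : Main p x f)
    {g : (sigmaPi A).H (cons p' x (cons q y T))} (hg : Main p' x g)
    (hx : ∀ a, x ≠ atom a) (h : (sigmaPi A).H (cons q' y U)) : ScutAssocAt hp hq f g h := by
  -- `Main.pair_elim` needs the rest of the sequent of `g` to be a variable, so that `y` is reached
  -- through a renaming `σ`.
  suffices ∀ {V : Sequent (sigmaPi A).Obj} (σ : SRen V (cons q y T))
      {g : (sigmaPi A).H (cons p' x V)}, Main p' x g →
      ScutAssocAt hp hq f (sren (σ.cons p' x) g) h by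
    have := this (SRen.refl _) hg
    rwa [sren_eq_self (by simp)] at this
  intro V σ g hg
  revert hx IH
  refine Main.pair_elim (motive := fun {x S V} f g => ∀ (σ : SRen V (cons q y T)),
    (∀ x', Sub x' x → ∀ {S T U : Sequent (sigmaPi A).Obj} {p p' q q' : Bool} (hp : p ≠ p')
      (hq : q ≠ q') (f : (sigmaPi A).H (cons p x' S))
      (g : (sigmaPi A).H (cons p' x' (cons q y T))) (h : (sigmaPi A).H (cons q' y U)),
      ScutAssocAt hp hq f g h) → (∀ a, x ≠ atom a) →
    ScutAssocAt hp hq f (sren (σ.cons p' x) g) h) hp ?_ ?_ ?_ hf hg σ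
  · intro a S T u w σ IH hx
    exact absurd rfl (hx a)
  · intro I _ X k S T f g hf hg σ IH hx
    have H := IH _ (sub_conn p' X k) hp hq f (sren (σ.cons p' _) (g k)) h
    have e1 := (SumProdData.tupOp sigmaPiSumProd_natural p' X).sren_op σ g
    have e2 := (SumProdData.tupOp sigmaPiSumProd_natural p' X).op_scut hq
      (fun k => sren (σ.cons p' _) (g k)) h
    simp only [SumProdData.tupOp] at e1 e2
    unfold ScutAssocAt at H ⊢
    rw [e1, sel_scut_tup, e2, sel_scut_tup, H]
  · intro I _ X k S T f g hf hg σ IH hx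
    have H := IH _ (sub_conn p X k) hp hq (f k) (sren (σ.cons p' _) g) h
    have e1 := (selOp hp.symm X k).sren_op σ fun _ => g
    have e2 := (selOp hp.symm X k).op_scut hq (fun _ => sren (σ.cons p' _) g) h
    simp only [selOp] at e1 e2
    unfold ScutAssocAt at H ⊢
    rw [e1, tup_scut_sel, e2, tup_scut_sel, H]

theorem sren_mapCons_sax {S : Sequent A.Obj} {p : Bool} {a : A.Obj} {T : Sequent A.Obj}
    (σ : SRen S (cons p a T)) (u : A.H S) :
    sren ((σ.map atom).trans (SRen.mapCons atom p a T)) (sax u) = saxCons (sren σ u) := by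
  rw [saxCons, ← sren_sax, sren_sren]

/-- All cuts are evaluated in `A`, where the law holds. This is the only place where the proof that
`ΣΠ_A` is a polycategory uses the laws of `A`. -/
theorem scutAssocAt_saxCons (hA : A.IsPolycategory) {p p' q q' : Bool} (hp : p ≠ p') (hq : q ≠ q')
    {a b : A.Obj} {S T U : Sequent A.Obj} (u : A.H (cons p a S))
    (v : A.H (cons p' a (cons q b T))) (w : A.H (cons q' b U)) :
    ScutAssocAt hp hq (saxCons u) (sren ((SRen.mapCons atom q b T).cons p' (atom a)) (saxCons v))
      (saxCons w) := by
  have := hA.renLaws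
  have H := hA.scutAssocAt hp hq u v w
  unfold ScutAssocAt at H ⊢
  have e1 : sren (SRen.appendCons q (atom b) (S.map atom) (T.map atom))
      (sren ((SRen.refl _).append (SRen.mapCons atom q b T))
        (sren (SRen.mapAppend atom S (cons q b T)) (sax (scut hp u v)))) =
      sren ((SRen.mapAppend atom S T).cons q (atom b))
        (saxCons (sren (SRen.appendCons q b S T) (scut hp u v))) := by
    rw [← sren_mapCons_sax]
    simp only [sren_sren]
    exact sren_congr (by simp) _
  have e2 : sren (SRen.swap p' (atom a) q (atom b) (T.map atom))
      (sren ((SRen.mapCons atom q b T).cons p' (atom a)) (saxCons v)) =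
      sren ((SRen.mapCons atom p' a T).cons q (atom b))
        (saxCons (sren (SRen.swap p' a q b T) v)) := by
    rw [← sren_mapCons_sax, saxCons]
    simp only [sren_sren]
    exact sren_congr (by simp) _
  have e3 : ∀ t, sren (SRen.consAppend p' (atom a) (T.map atom) (U.map atom))
      (sren ((SRen.mapCons atom p' a T).append (SRen.refl _))
        (sren (SRen.mapAppend atom (cons p' a T) U) (sax t))) =
      sren ((SRen.mapAppend atom T U).cons p' (atom a))
        (saxCons (sren (SRen.consAppend p' a T U) t)) := fun t => by
    rw [← sren_mapCons_sax]
    simp only [sren_sren]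
    exact sren_congr (by simp) _
  rw [scut_sren_right, scut_saxCons, e1, scut_sren_left, scut_saxCons, e2, scut_sren_left,
    scut_saxCons, e3, scut_sren_right, scut_saxCons, ← H, ← sren_sax]
  simp only [sren_sren]
  exact sren_congr (by simp) _

/-- With `f` and `h` ending on their cut channels, `g` decides. If it is an axiom, `x` and `y` are
atoms and all three are axioms. A rule on `x` reduces against `f`; a rule on `y` reduces against
`h`, by the reversed law; any other rule passes through. -/
theorem scutAssocAt_main (hA : A.IsPolycategory) {x y : (sigmaPi A).Obj}
    (IHx : ∀ x', Sub x' x → ∀ {S T U : Sequent (sigmaPi A).Obj} {p p' q q' : Bool} (hp : p ≠ p')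
      (hq : q ≠ q') (f : (sigmaPi A).H (cons p x' S))
      (g : (sigmaPi A).H (cons p' x' (cons q y T))) (h : (sigmaPi A).H (cons q' y U)),
      ScutAssocAt hp hq f g h)
    (IHy : ∀ y', Sub y' y → ∀ {S T U : Sequent (sigmaPi A).Obj} {p p' q q' : Bool} (hp : p ≠ p')
      (hq : q ≠ q') (f : (sigmaPi A).H (cons p x S))
      (g : (sigmaPi A).H (cons p' x (cons q y' T))) (h : (sigmaPi A).H (cons q' y' U)),
      ScutAssocAt hp hq f g h)
    {S T U : Sequent (sigmaPi A).Obj} {p p' q q' : Bool} (hp : p ≠ p') (hq : q ≠ q')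
    {f : (sigmaPi A).H (cons p x S)} (hf : Main p x f)
    {g : (sigmaPi A).H (cons p' x (cons q y T))} (hg : Focused₂ p' x q y g)
    {h : (sigmaPi A).H (cons q' y U)} (hh : Main q' y h) : ScutAssocAt hp hq f g h := by
  induction hg with
  | ax hx hy v σ hg =>
    obtain ⟨_, u, rfl, hu⟩ := hf.exists_ax hx
    obtain ⟨_, w, rfl, hw⟩ := hh.exists_ax hy
    subst hx hy
    obtain rfl := eq_of_heq hg
    obtain rfl := eq_of_heq hu
    obtain rfl := eq_of_heq hw
    have := (scutAssocAt_saxCons hA hp hq u v w).ren_mid σ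
    rw [sren_sren] at this
    convert this using 1
    exact sren_congr (by simp) _
  | main_left o ho e he hp' hx hg =>
    subst hp' hx
    obtain rfl := eq_of_heq hg
    exact scutAssocAt_main_left IHx hp hq hf (.op o ho e he) ho.z_ne_atom h
  | main_right o ho e he hp' hx hg =>
    subst hp' hx
    refine ScutAssocAt.symm_iff.1 ?_
    rw [eq_of_heq hg]
    exact scutAssocAt_main_left (fun y' hy' _ _ _ _ _ _ _ hp hq f g h => ScutAssocAt.symm_iff.1
      (IHy y' hy' hq.symm hp.symm h (sren (SRen.swap _ _ _ _ _) g) f)) hq.symm hp.symm hh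
      (.op o ho e he) ho.z_ne_atom f
  | ren σ _ ih => exact ih.ren_mid σ
  | side o ho f _ ih => exact ScutAssocAt.side_mid o ih

/-- Nested induction on `x` and `y`: a principal reduction shrinks one of the two cut formulas and
keeps the other. Inside it, `f` is analysed up to the rule on `x` and `h` up to the rule on `y`,
before `g`. -/
theorem scutAssocAt_sigmaPi (hA : A.IsPolycategory) : ∀ (x y : (sigmaPi A).Obj)
    {S T U : Sequent (sigmaPi A).Obj} {p p' q q' : Bool} (hp : p ≠ p') (hq : q ≠ q')
    (f : (sigmaPi A).H (cons p x S)) (g : (sigmaPi A).H (cons p' x (cons q y T)))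
    (h : (sigmaPi A).H (cons q' y U)), ScutAssocAt hp hq f g h := by
  intro x
  induction x using wf_sub.induction with
  | _ x IHx
  intro y
  induction y using wf_sub.induction with
  | _ y IHy
  intro S T U p p' q q' hp hq f g h
  induction (cutFree f).focused_cons with
  | ren σ _ ih => exact ih.ren_left σ
  | side o ho f _ ih => exact ScutAssocAt.side_left o ih
  | main hf =>
    induction (cutFree h).focused_cons with
    | ren σ _ ih => exact ih.ren_right σ
    | side o ho h _ ih => exact ScutAssocAt.side_right o ih
    | main hh =>
      have hg := (cutFree g).focused₂ (SRen.refl _)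
      rw [sren_refl] at hg
      exact scutAssocAt_main hA (fun x' hx' => IHx x' hx' y) IHy hp hq hf hg hh

end Associativity

end SigmaPi

namespace SigmaPi
open Renaming Sequent PolyData Deriv

/-! ### Identities of `ΣΠ_A` -/

section Identities

variable {A : PolyData.{u, v}}

theorem sren_swap_sid {P : PolyData.{u, v}} [P.RenLaws] {p q : Bool} (h : p ≠ q) (x : P.Obj) :
    sren (SRen.swap q x p x nil) (sid h.symm x) = sid h x := by
  match p, q, h with
  | true, false, _ => exact sren_refl (S := cons false x (cons true x nil)) _
  | false, true, _ => exact sren_refl (S := cons false x (cons true x nil)) _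
  | true, true, h => exact absurd rfl h
  | false, false, h => exact absurd rfl h

/-- The identity derivation on a sum, with its channels in a sequent. -/
theorem sren_id_sum {P : PolyData.{u, v}} [P.RenLaws] (h : true ≠ false) {I : Type} {X : I → P.Obj}
    {z : P.Obj} (φ : ∀ {S : Sequent P.Obj}, (∀ i, P.H (cons false (X i) S)) → P.H (cons false z S))
    (hφ : ∀ {S T : Sequent P.Obj} (σ : SRen S T) (f : ∀ i, P.H (cons false (X i) S)),
      sren (σ.cons false z) (φ f) = φ fun i => sren (σ.cons false (X i)) (f i))
    (ψ : ∀ i {S : Sequent P.Obj}, P.H (cons true (X i) S) → P.H (cons true z S))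
    (hψ : ∀ i {S T : Sequent P.Obj} (σ : SRen S T) (f : P.H (cons true (X i) S)),
      sren (σ.cons true z) (ψ i f) = ψ i (sren (σ.cons true (X i)) f)) :
    sren (⟨unit z, unit z⟩ : SRen ⟨Ctx.single z, Ctx.single z⟩ (cons true z (cons false z nil)))
      (sren (⟨(unit _).symm, refl _⟩ : SRen (cons false z ⟨Ctx.empty, Ctx.single z⟩)
          ⟨Ctx.single z, Ctx.single z⟩)
        (φ fun i => sren (⟨unit _, (unit _).symm⟩ : SRen (cons true z
              ⟨Ctx.single (X i), Ctx.empty⟩) (cons false (X i) ⟨Ctx.empty, Ctx.single z⟩))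
          (ψ i (sren (⟨refl _, unit _⟩ : SRen ⟨Ctx.single (X i), Ctx.single (X i)⟩
            (cons true (X i) ⟨Ctx.single (X i), Ctx.empty⟩)) (P.id (X i)))))) =
      sren (SRen.swap false z true z nil)
        (φ fun i => sren (SRen.swap true z false (X i) nil) (ψ i (sid h (X i)))) := by
  -- The identity derivation renames only the output of the identity on `X i` before injecting; the
  -- renaming of its input is split off here, to be moved outside the injection.
  have e2 : ∀ i, sid h (X i) = sren
      ((⟨unit _, refl _⟩ : SRen ⟨Ctx.single (X i), Ctx.empty⟩ (cons false (X i) nil)).cons true _)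
      (sren (⟨refl _, unit _⟩ : SRen ⟨Ctx.single (X i), Ctx.single (X i)⟩
          (cons true (X i) ⟨Ctx.single (X i), Ctx.empty⟩)) (P.id (X i))) := fun i => by
    rw [sren_sren]
    refine Eq.trans (b := sren (⟨unit _, unit _⟩ : SRen ⟨Ctx.single (X i), Ctx.single (X i)⟩
      (cons true (X i) (cons false (X i) nil))) (P.id (X i))) rfl (sren_congr ?_ _)
    rintro (c | c) <;> rfl
  have e3 : (⟨(unit _).symm, refl _⟩ : SRen (cons false z ⟨Ctx.empty, Ctx.single z⟩)
        ⟨Ctx.single z, Ctx.single z⟩).trans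
          (⟨unit z, unit z⟩ : SRen _ (cons true z (cons false z nil))) =
      (⟨refl _, unit _⟩ : SRen ⟨Ctx.empty, Ctx.single z⟩ (cons true z nil)).cons false _ := by
    refine SRen.ext_app.2 (forall_cons.2 ⟨rfl, ?_⟩)
    rintro (c | c) <;> first | rfl | exact c.elim
  refine ((sren_sren _ _ _).trans (congrArg (fun σ => sren (P := P) σ _) e3)).trans
    (Eq.trans ?_ (sren_refl _).symm)
  refine (hφ _ _).trans (congrArg φ (funext fun i => ?_))
  refine Eq.trans ?_ (congrArg (fun t => sren _ (ψ i t)) (e2 i).symm)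
  refine (sren_sren _ _ _).trans (Eq.trans ?_ (congrArg (sren _) (hψ i _ _)))
  refine Eq.trans ?_ (sren_sren _ _ _).symm
  refine sren_congr ?_ _
  refine forall_cons.2 ⟨rfl, ?_⟩
  rintro (c | c) <;> first | rfl | exact c.elim

/-- The identity derivation on a product, with its channels in a sequent. -/
theorem sren_id_prod {P : PolyData.{u, v}} [P.RenLaws] (h : false ≠ true) {I : Type} {X : I → P.Obj}
    {z : P.Obj} (φ : ∀ {S : Sequent P.Obj}, (∀ i, P.H (cons true (X i) S)) → P.H (cons true z S))
    (hφ : ∀ {S T : Sequent P.Obj} (σ : SRen S T) (f : ∀ i, P.H (cons true (X i) S)),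
      sren (σ.cons true z) (φ f) = φ fun i => sren (σ.cons true (X i)) (f i))
    (ψ : ∀ i {S : Sequent P.Obj}, P.H (cons false (X i) S) → P.H (cons false z S))
    (hψ : ∀ i {S T : Sequent P.Obj} (σ : SRen S T) (f : P.H (cons false (X i) S)),
      sren (σ.cons false z) (ψ i f) = ψ i (sren (σ.cons false (X i)) f)) :
    sren (⟨unit z, unit z⟩ : SRen ⟨Ctx.single z, Ctx.single z⟩ (cons false z (cons true z nil)))
      (sren (⟨refl _, (unit _).symm⟩ : SRen (cons true z ⟨Ctx.single z, Ctx.empty⟩)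
          ⟨Ctx.single z, Ctx.single z⟩)
        (φ fun i => sren (⟨(unit _).symm, unit _⟩ : SRen (cons false z
              ⟨Ctx.empty, Ctx.single (X i)⟩) (cons true (X i) ⟨Ctx.single z, Ctx.empty⟩))
          (ψ i (sren (⟨unit _, refl _⟩ : SRen ⟨Ctx.single (X i), Ctx.single (X i)⟩
            (cons false (X i) ⟨Ctx.empty, Ctx.single (X i)⟩)) (P.id (X i)))))) =
      sren (SRen.swap true z false z nil)
        (φ fun i => sren (SRen.swap false z true (X i) nil) (ψ i (sid h (X i)))) := by
  have e2 : ∀ i, sid h (X i) = sren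
      ((⟨refl _, unit _⟩ : SRen ⟨Ctx.empty, Ctx.single (X i)⟩ (cons true (X i) nil)).cons false _)
      (sren (⟨unit _, refl _⟩ : SRen ⟨Ctx.single (X i), Ctx.single (X i)⟩
          (cons false (X i) ⟨Ctx.empty, Ctx.single (X i)⟩)) (P.id (X i))) := fun i => by
    rw [sren_sren]
    refine Eq.trans (b := sren (⟨unit _, unit _⟩ : SRen ⟨Ctx.single (X i), Ctx.single (X i)⟩
      (cons false (X i) (cons true (X i) nil))) (P.id (X i))) rfl (sren_congr ?_ _)
    rintro (c | c) <;> rfl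
  have e3 : (⟨refl _, (unit _).symm⟩ : SRen (cons true z ⟨Ctx.single z, Ctx.empty⟩)
        ⟨Ctx.single z, Ctx.single z⟩).trans
          (⟨unit z, unit z⟩ : SRen _ (cons false z (cons true z nil))) =
      (⟨unit _, refl _⟩ : SRen ⟨Ctx.single z, Ctx.empty⟩ (cons false z nil)).cons true _ := by
    refine SRen.ext_app.2 (forall_cons.2 ⟨rfl, ?_⟩)
    rintro (c | c) <;> first | rfl | exact c.elim
  refine ((sren_sren _ _ _).trans (congrArg (fun σ => sren (P := P) σ _) e3)).trans
    (Eq.trans ?_ (sren_refl _).symm)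
  refine (hφ _ _).trans (congrArg φ (funext fun i => ?_))
  refine Eq.trans ?_ (congrArg (fun t => sren _ (ψ i t)) (e2 i).symm)
  refine (sren_sren _ _ _).trans (Eq.trans ?_ (congrArg (sren _) (hψ i _ _)))
  refine Eq.trans ?_ (sren_sren _ _ _).symm
  refine sren_congr ?_ _
  refine forall_cons.2 ⟨rfl, ?_⟩
  rintro (c | c) <;> first | rfl | exact c.elim

theorem sren_sel {p q : Bool} (h : p ≠ q) {I : Type} [Finite I] {X : I → (sigmaPi A).Obj} (k : I)
    {S T : Sequent (sigmaPi A).Obj} (σ : SRen S T) (f : (sigmaPi A).H (cons p (X k) S)) :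
    sren (σ.cons p _) (sel h k f) = sel h k (sren (σ.cons p (X k)) f) :=
  (selOp h X k).sren_op σ fun _ => f

theorem sren_tup (p : Bool) {I : Type} [Finite I] (X : I → (sigmaPi A).Obj)
    {S T : Sequent (sigmaPi A).Obj} (σ : SRen S T) (f : ∀ i, (sigmaPi A).H (cons p (X i) S)) :
    sren (σ.cons p _) (tup p X f) = tup p X fun i => sren (σ.cons p (X i)) (f i) :=
  (SumProdData.tupOp sigmaPiSumProd_natural p X).sren_op σ f

/-- The identity derivation on a sum. -/
theorem id_sum (h : true ≠ false) {I : Type} [Finite I] (X : I → (sigmaPi A).Obj) :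
    (sigmaPi A).id ((sigmaPiSumProd A).conn false X) = sren
        (⟨(unit _).symm, refl _⟩ : SRen (cons false ((sigmaPiSumProd A).conn false X)
            ⟨Ctx.empty, Ctx.single ((sigmaPiSumProd A).conn false X)⟩)
          ⟨Ctx.single ((sigmaPiSumProd A).conn false X),
            Ctx.single ((sigmaPiSumProd A).conn false X)⟩)
        (tup false X fun i => sren
          (⟨unit _, (unit _).symm⟩ : SRen (cons true ((sigmaPiSumProd A).conn false X)
              ⟨Ctx.single (X i), Ctx.empty⟩)
            (cons false (X i) ⟨Ctx.empty, Ctx.single ((sigmaPiSumProd A).conn false X)⟩))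
          (sel h i (sren (⟨refl _, unit _⟩ : SRen ⟨Ctx.single (X i), Ctx.single (X i)⟩
            (cons true (X i) ⟨Ctx.single (X i), Ctx.empty⟩)) ((sigmaPi A).id (X i))))) := by
  exact congrArg (sren (⟨(unit _).symm, refl _⟩ : SRen (cons false ((sigmaPiSumProd A).conn false X)
      ⟨Ctx.empty, Ctx.single ((sigmaPiSumProd A).conn false X)⟩)
      ⟨Ctx.single ((sigmaPiSumProd A).conn false X), Ctx.single ((sigmaPiSumProd A).conn false X)⟩))
    (cls_cotuple (X := X) (Γ := Ctx.empty) (Δ := Ctx.single (Fml.sum X)) fun i =>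
      exch (unit _) (unit _).symm (inj (Y := X) i (exchR (unit _) (idDeriv (X i)))))

/-- The identity derivation on a product. -/
theorem id_prod (h : false ≠ true) {I : Type} [Finite I] (X : I → (sigmaPi A).Obj) :
    (sigmaPi A).id ((sigmaPiSumProd A).conn true X) = sren
        (⟨refl _, (unit _).symm⟩ : SRen (cons true ((sigmaPiSumProd A).conn true X)
            ⟨Ctx.single ((sigmaPiSumProd A).conn true X), Ctx.empty⟩)
          ⟨Ctx.single ((sigmaPiSumProd A).conn true X),
            Ctx.single ((sigmaPiSumProd A).conn true X)⟩)
        (tup true X fun i => sren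
          (⟨(unit _).symm, unit _⟩ : SRen (cons false ((sigmaPiSumProd A).conn true X)
              ⟨Ctx.empty, Ctx.single (X i)⟩)
            (cons true (X i) ⟨Ctx.single ((sigmaPiSumProd A).conn true X), Ctx.empty⟩))
          (sel h i (sren (⟨unit _, refl _⟩ : SRen ⟨Ctx.single (X i), Ctx.single (X i)⟩
            (cons false (X i) ⟨Ctx.empty, Ctx.single (X i)⟩)) ((sigmaPi A).id (X i))))) := by
  exact congrArg (sren (⟨refl _, (unit _).symm⟩ : SRen (cons true ((sigmaPiSumProd A).conn true X)
      ⟨Ctx.single ((sigmaPiSumProd A).conn true X), Ctx.empty⟩)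
      ⟨Ctx.single ((sigmaPiSumProd A).conn true X), Ctx.single ((sigmaPiSumProd A).conn true X)⟩))
    (cls_tuple (X := X) (Δ := Ctx.empty) (Γ := Ctx.single (Fml.prod X)) fun i =>
      exch (unit _).symm (unit _) (proj (X := X) i (exchL (unit _) (idDeriv (X i)))))

/-- The identity on a compound formula. -/
theorem sid_conn {p q : Bool} (h : p ≠ q) {I : Type} [Finite I] (X : I → (sigmaPi A).Obj) :
    sid h ((sigmaPiSumProd A).conn q X) =
      sren (SRen.swap q ((sigmaPiSumProd A).conn q X) p ((sigmaPiSumProd A).conn q X) nil)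
        (tup q X fun i => sren (SRen.swap p ((sigmaPiSumProd A).conn q X) q (X i) nil)
          (sel h i (sid h (X i)))) := by
  match p, q, h with
  | true, false, h =>
    exact (congrArg (sren (⟨unit _, unit _⟩ : SRen ⟨Ctx.single _, Ctx.single _⟩
      (cons true _ (cons false _ nil)))) (id_sum h X)).trans
        (sren_id_sum h (tup false X) (sren_tup false X) (fun i => sel h i) fun i => sren_sel h i)
  | false, true, h =>
    exact (congrArg (sren (⟨unit _, unit _⟩ : SRen ⟨Ctx.single _, Ctx.single _⟩
      (cons false _ (cons true _ nil)))) (id_prod h X)).trans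
        (sren_id_prod h (tup true X) (sren_tup true X) (fun i => sel h i) fun i => sren_sel h i)
  | true, true, h => exact absurd rfl h
  | false, false, h => exact absurd rfl h

/-- Cutting with the identity on a compound formula. -/
theorem sid_conn_scut {p q : Bool} (h : p ≠ q) {I : Type} [Finite I] {X : I → (sigmaPi A).Obj}
    {S : Sequent (sigmaPi A).Obj} (f : (sigmaPi A).H (cons q ((sigmaPiSumProd A).conn q X) S)) :
    sren (SRen.consNilAppend q _ S) (scut h (sid h ((sigmaPiSumProd A).conn q X)) f) =
      tup q X fun k => sren (SRen.consNilAppend q (X k) S) (scut h (sel h k (sid h (X k))) f) := by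
  have e : scut h (sren (SRen.swap q ((sigmaPiSumProd A).conn q X) p _ nil) (tup q X fun i =>
      sren (SRen.swap p _ q (X i) nil) (sel h i (sid h (X i))))) f = _ :=
    (SumProdData.tupOp sigmaPiSumProd_natural q X).side_scut h
      (fun i : I => sel (I := I) (X := X) h i (sid h (X i))) f
  have := (SumProdData.tupOp sigmaPiSumProd_natural q X).sren_op_congr (SRen.nilAppend S)
    (e := (SRen.consAppend q ((sigmaPiSumProd A).conn q X) _ _).symm.trans
      (SRen.consNilAppend q _ _))
    (e' := SRen.refl (cons q ((sigmaPiSumProd A).conn q X) S))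
    (d := fun k => SRen.consAppend q (X k) nil S) (d' := fun k => SRen.consNilAppend q (X k) S)
    (fun k : I => scut h (sel (I := I) (X := X) h k (sid h (X k))) f)
    (by simp [SumProdData.tupOp]) (by simp [SumProdData.tupOp])
  rw [sid_conn h X, e]
  exact (sren_sren _ _ _).trans (this.trans (sren_refl _))

/-- Expanding the identity gives a tupling whose component at `k` cuts a selection at `k` against
`tup q X f`; the principal reduction leaves the identity law for `f k`. -/
theorem sidScutAt_tup {p q : Bool} (h : p ≠ q) {I : Type} [Finite I] {X : I → (sigmaPi A).Obj}
    {S : Sequent (sigmaPi A).Obj} (f : ∀ i, (sigmaPi A).H (cons q (X i) S))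
    (H : ∀ i, SidScutAt h (f i)) : SidScutAt h (tup q X f) :=
  (sid_conn_scut h (tup q X f)).trans (congrArg (tup q X) (funext fun k =>
    (congrArg (sren _) (sel_scut_tup h k _ f)).trans (H k)))

/-- Projections and injections are cuts. -/
theorem sel_sid_scut {p q : Bool} (h : p ≠ q) {I : Type} [Finite I] {X : I → (sigmaPi A).Obj}
    {S : Sequent (sigmaPi A).Obj} (k : I) (f : (sigmaPi A).H (cons q (X k) S))
    (H : SidScutAt h f) :
    sren (SRen.consNilAppend q ((sigmaPiSumProd A).conn p X) S)
      (scut h (sren (SRen.swap q ((sigmaPiSumProd A).conn p X) p (X k) nil)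
        (sel h.symm k (sid h.symm (X k)))) f) = sel h.symm k f := by
  have e : scut h (sren (SRen.swap q ((sigmaPiSumProd A).conn p X) p _ nil) (sel h.symm k
      (sren (SRen.swap p _ q (X k) nil) (sid h (X k))))) f = _ :=
    (selOp h.symm X k).side_scut h (fun _ => sid h (X k)) f
  have := (selOp h.symm X k).sren_op_congr (SRen.nilAppend S)
    (e := (SRen.consAppend q ((sigmaPiSumProd A).conn p X) _ _).symm.trans
      (SRen.consNilAppend q _ _))
    (e' := SRen.refl (cons q ((sigmaPiSumProd A).conn p X) S))
    (d := fun _ => SRen.consAppend q (X k) nil S) (d' := fun _ => SRen.consNilAppend q (X k) S)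
    (fun _ => scut h (sid h (X k)) f) (by simp [selOp]) (by simp [selOp])
  rw [← sren_swap_sid h.symm, e]
  exact (sren_sren _ _ _).trans (this.trans ((sren_refl _).trans (congrArg (sel h.symm k) H)))

/-- On the cut channel the identity is a tupling, so the selection picks its component at `k`; what
remains is `sel_sid_scut`. -/
theorem sidScutAt_sel {p q : Bool} (h : p ≠ q) {I : Type} [Finite I] {X : I → (sigmaPi A).Obj}
    {S : Sequent (sigmaPi A).Obj} (k : I) (f : (sigmaPi A).H (cons q (X k) S))
    (H : SidScutAt h f) : SidScutAt h (sel h.symm k f) := by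
  have e : sid h ((sigmaPiSumProd A).conn p X) = tup p X fun i =>
      sren (SRen.swap q ((sigmaPiSumProd A).conn p X) p (X i) nil)
        (sel h.symm i (sid h.symm (X i))) := by
    rw [← sren_swap_sid, sid_conn h.symm X, sren_sren, sren_eq_self (by simp)]
  unfold SidScutAt
  rw [e, tup_scut_sel]
  exact sel_sid_scut h k f H

/-- The analysis of cut elimination, applied to `f` alone. Side rules commute, a logical rule on the
cut channel leads to subformulas, and an axiom is covered by the reductions for atomic identities.
-/
theorem sidScutAt_sigmaPi {x : (sigmaPi A).Obj} : ∀ {S : Sequent (sigmaPi A).Obj} {p q : Bool}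
    (h : p ≠ q) (f : (sigmaPi A).H (cons q x S)), SidScutAt h f := by
  induction x using wf_sub.induction with
  | _ x IH
  intro S p q h f
  induction (cutFree f).focused_cons with
  | ren σ _ ih =>
    unfold SidScutAt at ih ⊢
    conv_rhs => rw [← ih]
    rw [scut_sren_right, sren_sren, sren_sren]
    exact sren_congr (by simp) _
  | side o ho f _ ih =>
    unfold SidScutAt at ih ⊢
    have e : (o.op fun k => sren (SRen.swap q x o.pol (o.X k) _) (f k)) = o.op fun k =>
        sren (SRen.swap q x o.pol (o.X k) _) (sren (SRen.consNilAppend q x _)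
          (scut h (sid h x) (f k))) := by simp only [ih]
    conv_rhs => rw [e]
    rw [o.scut_side]
    simp only [sren_sren]
    exact o.sren_op_congr (SRen.consNilAppend q x _) _ (by simp) (by simp)
  | main hf =>
    cases hf with
    | @ax q a S u =>
      match p, q, h with
      | true, false, _ =>
        refine (sidScutAt_true_iff _).2 ?_
        obtain ⟨d, hd⟩ := exists_cls (saxCons u)
        rw [← hd]
        exact cls_eq (S := cons false _ _) (Conv.idAtom_cut d)
      | false, true, _ =>
        refine (sidScutAt_false_iff _).2 ?_
        obtain ⟨d, hd⟩ := exists_cls (saxCons u)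
        rw [← hd]
        exact cls_eq (S := cons true _ _) (Conv.cut_idAtom d)
      | true, true, h => exact absurd rfl h
      | false, false, h => exact absurd rfl h
    | op o ho f hf =>
      cases ho with
      | tup q X => exact sidScutAt_tup (X := X) h f fun k => IH _ (sub_conn q X k) h (f k)
      | @sel q r h' _ _ X k =>
        obtain rfl := eq_of_ne_of_ne h h'
        exact sidScutAt_sel h k (f ()) (IH _ (sub_conn r X k) h (f ()))

end Identities

/-- `ΣΠ_A` is a polycategory. -/
theorem sigmaPi_isPolycategory {A : PolyData.{u, v}} (hA : A.IsPolycategory) :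
    (sigmaPi A).IsPolycategory :=
  isPolycategory_of_scut (scutAssocAt_sigmaPi hA _ _) sidScutAt_sigmaPi

end SigmaPi

namespace SigmaPi
open Renaming Sequent PolyData

/-! ### Poly-sums and poly-products in `ΣΠ_A` -/

variable {A : PolyData.{u, v}}

/-- Cutting with `sel h k (sid h (X k))` recovers the component at `k`, which gives injectivity;
expanding the identity on the compound formula shows that each polymorphism is the tupling of these
cuts. -/
theorem tup_bijective (q : Bool) {I : Type} [Finite I] (X : I → (sigmaPi A).Obj)
    (S : Sequent (sigmaPi A).Obj) : Function.Bijective (tup q X (S := S)) := by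
  have h : (!q) ≠ q := by cases q <;> decide
  constructor
  · intro f g e
    funext k
    have := congrArg (fun t => sren (SRen.consNilAppend q (X k) S)
      (scut h (sel h k (sid h (X k))) t)) e
    simp only [sel_scut_tup] at this
    exact (sidScutAt_sigmaPi h (f k)).symm.trans (this.trans (sidScutAt_sigmaPi h (g k)))
  · exact fun f => ⟨_, (sid_conn_scut h f).symm.trans (sidScutAt_sigmaPi h f)⟩

/-- `ΣΠ_A` has finite poly-sums and poly-products. -/
theorem sigmaPiSumProd_isFiniteSumProd : (sigmaPiSumProd A).IsFiniteSumProd where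
  isPolySum X :=
    { bijective := fun Γ Δ => tup_bijective false X ⟨Γ, Δ⟩
      ren_cot := sigmaPiSumProd_natural.ren_cot X
      cot_cut := sigmaPiSumProd_natural.cot_cut X
      cut_cot := sigmaPiSumProd_natural.cut_cot X }
  isPolyProd X :=
    { bijective := fun Γ Δ => tup_bijective true X ⟨Γ, Δ⟩
      ren_tup := sigmaPiSumProd_natural.ren_tup X
      cut_tup := sigmaPiSumProd_natural.cut_tup X
      tup_cut := sigmaPiSumProd_natural.tup_cut X }

end SigmaPi

namespace SigmaPi
open Renaming Sequent PolyData

/-! ### Projections and injections in a polycategory with poly-sums and poly-products -/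

namespace SumProdData

variable {P : PolyData.{u, v}} {T : SumProdData P}

theorem IsFiniteSumProd.tup_bijective (hT : T.IsFiniteSumProd) (p : Bool) {I : Type} [Finite I]
    (X : I → P.Obj) (S : Sequent P.Obj) : Function.Bijective (T.tup p X (S := S)) := by
  cases p
  · exact (hT.isPolySum X).bijective S.L S.R
  · exact (hT.isPolyProd X).bijective S.L S.R

/-- The projections from a poly-product and the injections into a poly-sum. -/
noncomputable def leg (hT : T.IsFiniteSumProd) {p q : Bool} (h : p ≠ q) {I : Type} [Finite I]
    (X : I → P.Obj) : ∀ k, P.H (cons q (X k) (cons p (T.conn q X) nil)) :=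
  ((hT.tup_bijective q X _).surjective (sid h.symm (T.conn q X))).choose

theorem tup_leg (hT : T.IsFiniteSumProd) {p q : Bool} (h : p ≠ q) {I : Type} [Finite I]
    (X : I → P.Obj) : T.tup q X (leg hT h X) = sid h.symm (T.conn q X) :=
  ((hT.tup_bijective q X _).surjective (sid h.symm (T.conn q X))).choose_spec

variable [P.RenLaws]

/-- Composition with a projection or injection. -/
noncomputable def sel (hT : T.IsFiniteSumProd) {p q : Bool} (h : p ≠ q) {I : Type} [Finite I]
    {X : I → P.Obj} (k : I) {S : Sequent P.Obj} (f : P.H (cons p (X k) S)) :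
    P.H (cons p (T.conn q X) S) :=
  sren (SRen.consNilAppend p (T.conn q X) S) (scut h.symm (leg hT h X k) f)

/-- Composition with a projection or injection as an operation on a channel. -/
noncomputable def selOp (hP : P.IsPolycategory) (hT : T.IsFiniteSumProd) {p q : Bool} (h : p ≠ q)
    {I : Type} [Finite I] (X : I → P.Obj) (k : I) : ChanOp P :=
  ChanOp.ofScut p Unit (fun _ => X k) (T.conn q X) (fun f => sel hT h k (f ()))
    (fun {S S'} σ f => by
      unfold sel
      rw [scut_sren_right, sren_sren, sren_sren]
      exact sren_congr (by simp) _)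
    (fun {r r' S S' x} hr f g => by
      unfold sel
      rw [← hP.scutAssocAt h.symm hr (leg hT h X k) (f ()) g, sren_sren,
        show (SRen.consNilAppend p (T.conn q X) (cons r x S)).trans (SRen.swap p _ r x S) =
          (SRen.appendCons r x (cons p (T.conn q X) nil) S).trans
            ((SRen.consNilAppend p (T.conn q X) S).cons r x) by simp [SRen.ext_app],
        ← sren_sren, scut_sren_left, sren_sren, sren_sren]
      exact sren_congr (by simp) _)

/-- The component at `k` of a polymorphism into a poly-product or out of a poly-sum. -/
theorem leg_scut_tup (hP : P.IsPolycategory) (hT : T.IsFiniteSumProd) {p q : Bool} (h : p ≠ q)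
    {I : Type} [Finite I] {X : I → P.Obj} {S : Sequent P.Obj} (f : ∀ i, P.H (cons q (X i) S))
    (k : I) : sren (SRen.consNilAppend q (X k) S) (scut h
      (sren (SRen.swap q (X k) p (T.conn q X) nil) (leg hT h X k)) (T.tup q X f)) = f k := by
  -- The identity is the tupling of the legs. Taking this tupling out of the cut of the identity
  -- with `T.tup q X f` presents the latter as the tupling of its cuts with the legs, and
  -- injectivity compares components.
  have e := (tupOp hT.natural q X).op_scut h (leg hT h X) (T.tup q X f)
  have e' : T.tup q X f = T.tup q X fun k => sren (SRen.consNilAppend q (X k) S) (scut h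
      (sren (SRen.swap q (X k) p (T.conn q X) nil) (leg hT h X k)) (T.tup q X f)) := by
    conv_lhs => rw [← hP.sidScutAt h (T.tup q X f), ← sren_swap_sid, ← tup_leg hT h X]
    have e2 := (congrArg (sren ((SRen.nilAppend S).cons q (T.conn q X))) e).trans
      ((tupOp hT.natural q X).sren_op (SRen.nilAppend S) _)
    exact (sren_sren _ _ _).symm.trans
      (e2.trans (congrArg (T.tup q X) (funext fun k => sren_sren _ _ _)))
  exact (congrFun ((hT.tup_bijective q X S).injective e') k).symm

/-- The principal reduction. -/
theorem sel_scut_tup (hP : P.IsPolycategory) (hT : T.IsFiniteSumProd) {p q : Bool} (h : p ≠ q)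
    {I : Type} [Finite I] {X : I → P.Obj} (k : I) {S S' : Sequent P.Obj}
    (f : P.H (cons p (X k) S)) (g : ∀ i, P.H (cons q (X i) S')) :
    scut h (sel hT h k f) (T.tup q X g) = scut h f (g k) := by
  -- Associativity moves the leg from `f` to the tupling, where it extracts `g k`.
  have e := hP.scutAssocAt h h f (leg hT h X k) (T.tup q X g)
  unfold ScutAssocAt at e
  conv_rhs => rw [← leg_scut_tup hP hT h g k, SRen.consNilAppend, ← sren_sren, scut_sren_right, ← e]
  unfold sel
  rw [← scut_comm h f, sren_sren, sren_sren,
    show (SRen.comm S (cons p (T.conn q X) nil)).trans (SRen.consNilAppend p (T.conn q X) S) =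
      (SRen.appendCons p (T.conn q X) S nil).trans
        (((SRen.comm S nil).trans (SRen.nilAppend S)).cons p _) by simp [SRen.ext_app],
    ← sren_sren, scut_sren_left]
  exact sren_congr (by simp) _

/-- The projection or injection obtained from an identity. -/
theorem sel_sid (hP : P.IsPolycategory) (hT : T.IsFiniteSumProd) {p q : Bool} (h : p ≠ q)
    {I : Type} [Finite I] {X : I → P.Obj} (k : I) :
    sel hT h k (sid h (X k)) = sren (SRen.swap q (X k) p (T.conn q X) nil) (leg hT h X k) := by
  have e := hP.sidScutAt h (leg hT h X k)
  unfold SidScutAt at e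
  unfold sel
  conv_rhs => rw [← e]
  rw [← scut_comm h, sren_sren, sren_sren]
  exact sren_congr (by simp) _

/-- The identity on a poly-sum or poly-product. -/
theorem sid_conn (hP : P.IsPolycategory) (hT : T.IsFiniteSumProd) {p q : Bool} (h : p ≠ q)
    {I : Type} [Finite I] (X : I → P.Obj) :
    sid h (T.conn q X) = sren (SRen.swap q (T.conn q X) p (T.conn q X) nil)
      (T.tup q X fun i => sren (SRen.swap p (T.conn q X) q (X i) nil)
        (sel hT h i (sid h (X i)))) := by
  have e : ∀ i, sren (SRen.swap p (T.conn q X) q (X i) nil) (sel hT h i (sid h (X i))) =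
      leg hT h X i := fun i => by
    rw [sel_sid hP, sren_sren, sren_eq_self (by simp)]
  simp only [e]
  rw [tup_leg, sren_swap_sid]

/-- A selection is a cut with a leg, and `o` commutes with cuts on other channels. This yields the
permuting conversions that move a selection past a tupling or another selection on the same side. -/
theorem sel_op_comm (hT : T.IsFiniteSumProd) {p q : Bool} (h : p ≠ q)
    {I : Type} [Finite I] {X : I → P.Obj} (k : I) (o : ChanOp P) {S : Sequent P.Obj}
    (f : ∀ l, P.H (cons p (X k) (cons o.pol (o.X l) S))) :
    sel hT h k (sren (SRen.swap o.pol o.z p (X k) S)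
      (o.op fun l => sren (SRen.swap p (X k) o.pol (o.X l) S) (f l))) =
    sren (SRen.swap o.pol o.z p (T.conn q X) S) (o.op fun l =>
      sren (SRen.swap p (T.conn q X) o.pol (o.X l) S) (sel hT h k (f l))) := by
  unfold sel
  rw [o.scut_side]
  simp only [sren_sren]
  exact o.sren_op_congr (SRen.consNilAppend p (T.conn q X) S) _ (by simp) (by simp)

/-- By surjectivity the right side is a tupling. Its component at `i` is obtained by cutting with
the `i`-th leg, and this cut commutes with `o`. -/
theorem tup_op_comm (hP : P.IsPolycategory) (hT : T.IsFiniteSumProd) (q : Bool)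
    {I : Type} [Finite I] {X : I → P.Obj} (o : ChanOp P) {S : Sequent P.Obj}
    (f : ∀ i l, P.H (cons q (X i) (cons o.pol (o.X l) S))) :
    (T.tup q X fun i => sren (SRen.swap o.pol o.z q (X i) S)
      (o.op fun l => sren (SRen.swap q (X i) o.pol (o.X l) S) (f i l))) =
    sren (SRen.swap o.pol o.z q (T.conn q X) S) (o.op fun l =>
      sren (SRen.swap q (T.conn q X) o.pol (o.X l) S) (T.tup q X fun i => f i l)) := by
  have h : (!q) ≠ q := by cases q <;> decide
  obtain ⟨g, hg⟩ := (hT.tup_bijective q X _).surjective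
    (sren (SRen.swap o.pol o.z q (T.conn q X) S) (o.op fun l =>
      sren (SRen.swap q (T.conn q X) o.pol (o.X l) S) (T.tup q X fun i => f i l)))
  rw [← hg]
  congr 1
  funext i
  rw [← leg_scut_tup hP hT h g i, hg, o.scut_side]
  simp only [← leg_scut_tup hP hT h (fun i => f i _) i, sren_sren]
  exact (o.sren_op_congr (SRen.consNilAppend q (X i) S) _ (by simp) (by simp)).symm

/-- Conversions between a rule on the left and one on the right are stated without swaps. For
opposite polarities the swaps of the general commutation are identities, and this lemma removes
them. -/
theorem comm_of_false_true {P : PolyData.{u, v}} [P.RenLaws] {K L : Type} {X : K → P.Obj}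
    {Y : L → P.Obj} {z w : P.Obj} {S : Sequent P.Obj}
    (φ : ∀ {S : Sequent P.Obj}, (∀ k, P.H (cons false (X k) S)) → P.H (cons false z S))
    (ψ : ∀ {S : Sequent P.Obj}, (∀ l, P.H (cons true (Y l) S)) → P.H (cons true w S))
    (f : ∀ k l, P.H (cons false (X k) (cons true (Y l) S)))
    (h : φ (fun k => sren (SRen.swap true w false (X k) S)
        (ψ fun l => sren (SRen.swap false (X k) true (Y l) S) (f k l))) =
      sren (SRen.swap true w false z S)
        (ψ fun l => sren (SRen.swap false z true (Y l) S) (φ fun k => f k l))) :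
    φ (S := cons true w S) (fun k => ψ (S := cons false (X k) S) (f k)) =
      ψ (S := cons false z S) fun l => φ (S := cons true (Y l) S) fun k => f k l := by
  have a : ∀ (x y : P.Obj) (t : P.H (cons false x (cons true y S))),
    sren (SRen.swap false x true y S) t = t := fun x y t =>
      sren_refl (S := cons false x (cons true y S)) t
  have b : ∀ (x y : P.Obj) (t : P.H (cons true y (cons false x S))),
    sren (SRen.swap true y false x S) t = t := fun x y t =>
      sren_refl (S := cons false x (cons true y S)) t
  have e : ∀ k, ψ (S := cons false (X k) S) (f k) = sren (SRen.swap true w false (X k) S)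
      (ψ fun l => sren (SRen.swap false (X k) true (Y l) S) (f k l)) := fun k =>
    (congrArg (ψ (S := cons false (X k) S)) (funext fun l => (a _ _ (f k l)).symm)).trans
      (b _ _ _).symm
  have e' : sren (SRen.swap true w false z S)
      (ψ fun l => sren (SRen.swap false z true (Y l) S) (φ fun k => f k l)) =
      ψ (S := cons false z S) fun l => φ (S := cons true (Y l) S) fun k => f k l :=
    (b _ _ _).trans (congrArg (ψ (S := cons false z S)) (funext fun l => a _ _ _))
  exact (congrArg φ (funext e)).trans (h.trans e')

theorem cotuple_inj_comm (hP : P.IsPolycategory) (hT : T.IsFiniteSumProd)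
    {I J : Type} [Finite I] [Finite J] {X : I → P.Obj} {Y : J → P.Obj} (k : J) {S : Sequent P.Obj}
    (f : ∀ i, P.H (cons false (X i) (cons true (Y k) S))) :
    (T.tup false X (S := cons true (T.conn false Y) S) fun i =>
      sel hT (p := true) (q := false) (by decide) k (S := cons false (X i) S) (f i)) =
    sel hT (p := true) (q := false) (by decide) k (S := cons false (T.conn false X) S)
      (T.tup false X (S := cons true (Y k) S) f) :=
  comm_of_false_true (S := S) (K := I) (L := Unit) (X := X) (Y := fun _ => Y k)
    (T.tup false X) (fun f => sel hT (p := true) (q := false) (by decide) k (f ()))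
    (fun i _ => f i) (tup_op_comm hP hT false
      (selOp hP hT (p := true) (q := false) (by decide) Y k) (S := S) fun i _ => f i)

theorem cotuple_tuple_comm (hP : P.IsPolycategory) (hT : T.IsFiniteSumProd)
    {I J : Type} [Finite I] [Finite J] {X : I → P.Obj} {Y : J → P.Obj} {S : Sequent P.Obj}
    (f : ∀ i j, P.H (cons false (X i) (cons true (Y j) S))) :
    (T.tup false X (S := cons true (T.conn true Y) S) fun i =>
      T.tup true Y (S := cons false (X i) S) (f i)) =
    T.tup true Y (S := cons false (T.conn false X) S) fun j =>
      T.tup false X (S := cons true (Y j) S) fun i => f i j :=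
  comm_of_false_true (S := S) (K := I) (L := J) (X := X) (Y := Y) (T.tup false X) (T.tup true Y) f
    (tup_op_comm hP hT false (tupOp hT.natural true Y) (S := S) f)

theorem proj_tuple_comm (hT : T.IsFiniteSumProd)
    {I J : Type} [Finite I] [Finite J] {X : I → P.Obj} {Y : J → P.Obj} (k : I) {S : Sequent P.Obj}
    (f : ∀ j, P.H (cons false (X k) (cons true (Y j) S))) :
    sel hT (p := false) (q := true) (by decide) k (S := cons true (T.conn true Y) S)
      (T.tup true Y (S := cons false (X k) S) f) =
    T.tup true Y (S := cons false (T.conn true X) S) fun j =>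
      sel hT (p := false) (q := true) (by decide) k (S := cons true (Y j) S) (f j) :=
  comm_of_false_true (S := S) (K := Unit) (L := J) (X := fun _ => X k) (Y := Y)
    (fun f => sel hT (p := false) (q := true) (by decide) k (f ())) (T.tup true Y) (fun _ => f)
    (sel_op_comm hT (p := false) (q := true) (by decide) k (tupOp hT.natural true Y) (S := S) f)

theorem proj_inj_comm (hP : P.IsPolycategory) (hT : T.IsFiniteSumProd)
    {I J : Type} [Finite I] [Finite J] {X : I → P.Obj} {Y : J → P.Obj} (k : I) (l : J)
    {S : Sequent P.Obj} (f : P.H (cons false (X k) (cons true (Y l) S))) :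
    sel hT (p := false) (q := true) (by decide) k (S := cons true (T.conn false Y) S)
      (sel hT (p := true) (q := false) (by decide) l (S := cons false (X k) S) f) =
    sel hT (p := true) (q := false) (by decide) l (S := cons false (T.conn true X) S)
      (sel hT (p := false) (q := true) (by decide) k (S := cons true (Y l) S) f) :=
  comm_of_false_true (S := S) (K := Unit) (L := Unit) (X := fun _ => X k) (Y := fun _ => Y l)
    (fun f => sel hT (p := false) (q := true) (by decide) k (f ()))
    (fun f => sel hT (p := true) (q := false) (by decide) l (f ())) (fun _ _ => f)
    (sel_op_comm hT (p := false) (q := true) (by decide) k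
      (selOp hP hT (p := true) (q := false) (by decide) Y l) (S := S) fun _ => f)

end SumProdData

end SigmaPi

namespace SigmaPi
open Renaming Sequent PolyData

/-! ### Pulling a polycategory back along a map on objects -/

namespace SRen

variable {O : Type u} {O' : Type u'} {S : Sequent O} {p : Bool} {x y : O}

/-- Nothing changes in the empty sequent. -/
protected def mapNil (F : O → O') : SRen (nil.map F) nil :=
  ⟨⟨Equiv.refl Empty, fun i => i.elim⟩, ⟨Equiv.refl Empty, fun i => i.elim⟩⟩

/-- Replace the object on the distinguished channel by an equal one. -/
protected def castCons (p : Bool) (h : x = y) (S : Sequent O) : SRen (cons p x S) (cons p y S) :=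
  match p with
  | false => ⟨(single h).append (Renaming.refl _), Renaming.refl _⟩
  | true => ⟨Renaming.refl _, (single h).append (Renaming.refl _)⟩

@[simp] theorem app_castCons_here (h : x = y) : (SRen.castCons p h S).app here = here := by
  cases p <;> rfl

@[simp] theorem app_castCons_there (h : x = y) (c : S.Chan) :
    (SRen.castCons p h S).app (there c) = there c := by
  cases p <;> rcases c with c | c <;> rfl

@[simp] theorem app_symm_mapAppend_inL {F : O → O'} {S T : Sequent O} (c : S.Chan) :
    (SRen.mapAppend F S T).symm.app (inL (mapChan F c)) = mapChan F (inL c) :=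
  app_symm_eq _ (by simp)

@[simp] theorem app_symm_mapAppend_inR {F : O → O'} {S T : Sequent O} (c : T.Chan) :
    (SRen.mapAppend F S T).symm.app (inR (mapChan F c)) = mapChan F (inR c) :=
  app_symm_eq _ (by simp)

end SRen

/-- The polycategory with the objects `O` and the polymorphisms of `B` between their images. -/
def PolyData.pull (B : PolyData.{u', v'}) {O : Type u} (o : O → B.Obj) : PolyData.{u, v'} where
  Obj := O
  Hom Γ Δ := B.Hom (Γ.map o) (Δ.map o)
  ren σ τ f := B.ren (σ.map o) (τ.map o) f
  id x := B.id (o x)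
  cut {Γ Δ Γ' Δ' x} f g := B.ren (mapAppend o Γ Γ').symm (mapAppend o Δ Δ').symm
    (B.cut (B.renR (mapCons o x Δ) f) (B.renL (mapCons o x Γ') g))

/-- The given map on objects. -/
def pullObj {B : PolyData.{u', v'}} {O : Type u} (o : O → B.Obj) : (B.pull o).Obj → B.Obj := o

/-- A polymorphism of the pull-back as a polymorphism of `B`. -/
def push {B : PolyData.{u', v'}} {O : Type u} {o : O → B.Obj} {S : Sequent (B.pull o).Obj}
    (f : (B.pull o).H S) : B.H (S.map (pullObj o)) := f

section Pull

variable {B : PolyData.{u', v'}} {O : Type u} {o : O → B.Obj} {S T : Sequent (B.pull o).Obj}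
  {p q : Bool} {x : (B.pull o).Obj}

theorem push_injective : Function.Injective (push (o := o) (S := S)) := fun _ _ h => h

theorem push_sren (σ : SRen S T) (f : (B.pull o).H S) :
    push (sren σ f) = sren (σ.map (pullObj o)) (push f) := rfl

variable [B.RenLaws]

instance : (B.pull o).RenLaws where
  ren_refl f := RenLaws.ren_refl (P := B) f
  ren_trans _ _ _ _ f := RenLaws.ren_trans (P := B) _ _ _ _ f
  ren_cut {Γ₁ Γ₁' Δ₁ Δ₁' Γ₂ Γ₂' Δ₂ Δ₂' x} σ₁ τ₁ σ₂ τ₂ f g := by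
    let S : Sequent (B.pull o).Obj := ⟨Γ₁, Δ₁⟩
    let S' : Sequent (B.pull o).Obj := ⟨Γ₁', Δ₁'⟩
    let T : Sequent (B.pull o).Obj := ⟨Γ₂, Δ₂⟩
    let T' : Sequent (B.pull o).Obj := ⟨Γ₂', Δ₂'⟩
    let σ : SRen S S' := ⟨σ₁, τ₁⟩
    let τ : SRen T T' := ⟨σ₂, τ₂⟩
    have key : ∀ (f : B.H ((cons true x S).map (pullObj o))) (g : B.H ((cons false x T).map (pullObj o))),
        sren ((σ.append τ).map (pullObj o)) (sren (SRen.mapAppend (pullObj o) S T).symm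
          (rcut (sren (SRen.mapCons (pullObj o) true x S) f) (sren (SRen.mapCons (pullObj o) false x T) g))) =
        sren (SRen.mapAppend (pullObj o) S' T').symm
          (rcut (sren (SRen.mapCons (pullObj o) true x S') (sren ((σ.cons true x).map (pullObj o)) f))
            (sren (SRen.mapCons (pullObj o) false x T') (sren ((τ.cons false x).map (pullObj o)) g))) := fun f g => by
      have e : ∀ (p : Bool) {S S' : Sequent (B.pull o).Obj} (σ : SRen S S')
          (f : B.H ((cons p x S).map (pullObj o))),
          sren (SRen.mapCons (pullObj o) p x S') (sren ((σ.cons p x).map (pullObj o)) f) =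
          sren ((σ.map (pullObj o)).cons p (pullObj o x)) (sren (SRen.mapCons (pullObj o) p x S) f) := fun p S S' σ f => by
        rw [sren_sren, sren_sren]
        exact sren_congr (by simp) _
      rw [e, e, ← sren_rcut, sren_sren, sren_sren]
      exact sren_congr (by simp) _
    exact key f g

theorem push_scut (h : p ≠ q) (f : (B.pull o).H (cons p x S)) (g : (B.pull o).H (cons q x T)) :
    push (scut h f g) = sren (SRen.mapAppend (pullObj o) S T).symm
      (scut h (sren (SRen.mapCons (pullObj o) p x S) (push f))
        (sren (SRen.mapCons (pullObj o) q x T) (push g))) := by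
  match p, q, h with
  | true, false, _ => rfl
  | false, true, _ =>
    have : ∀ u : B.H ((T.map (pullObj o)).append (S.map (pullObj o))),
        sren (P := B) ((SRen.comm T S).map (pullObj o)) (sren (P := B) (SRen.mapAppend (pullObj o) T S).symm u) =
        sren (P := B) (SRen.mapAppend (pullObj o) S T).symm (sren (P := B) (SRen.comm _ _) u) := fun u => by
      rw [sren_sren, sren_sren]
      exact sren_congr (by simp) _
    exact this _
  | true, true, h => exact absurd rfl h
  | false, false, h => exact absurd rfl h

/-- Both sides are the identity of `B` with its two channels renamed, and the renamings agree on
channels. -/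
theorem push_sid (h : p ≠ q) (x : (B.pull o).Obj) :
    sren (SRen.mapCons (pullObj o) p x _) (push (sid h x)) = sren
      ((((SRen.mapNil (pullObj o)).symm.cons q (pullObj o x)).trans
        (SRen.mapCons (pullObj o) q x nil).symm).cons p (pullObj o x)) (sid h (pullObj o x)) := by
  match p, q, h with
  | true, false, _ =>
    refine (sren_sren (P := B) (S := ⟨Ctx.single (pullObj o x), Ctx.single (pullObj o x)⟩)
      (⟨(unit x).map (pullObj o), (unit x).map (pullObj o)⟩ : SRen _ ((cons true x (cons false x nil)).map (pullObj o))) _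
      (B.id (pullObj o x))).trans
      (Eq.trans (sren_congr ?_ _) (sren_sren (P := B) (S := ⟨Ctx.single (pullObj o x), Ctx.single (pullObj o x)⟩)
        (⟨unit (pullObj o x), unit (pullObj o x)⟩ : SRen _ (cons true _ (cons false _ nil))) _ (B.id (pullObj o x))).symm)
    rintro (c | c) <;> rfl
  | false, true, _ =>
    refine (sren_sren (P := B) (S := ⟨Ctx.single (pullObj o x), Ctx.single (pullObj o x)⟩)
      (⟨(unit x).map (pullObj o), (unit x).map (pullObj o)⟩ : SRen _ ((cons false x (cons true x nil)).map (pullObj o))) _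
      (B.id (pullObj o x))).trans
      (Eq.trans (sren_congr ?_ _) (sren_sren (P := B) (S := ⟨Ctx.single (pullObj o x), Ctx.single (pullObj o x)⟩)
        (⟨unit (pullObj o x), unit (pullObj o x)⟩ : SRen _ (cons false _ (cons true _ nil))) _ (B.id (pullObj o x))).symm)
    rintro (c | c) <;> rfl
  | true, true, h => exact absurd rfl h
  | false, false, h => exact absurd rfl h

end Pull

/-- The pull-back of a polycategory is a polycategory. -/
theorem pull_isPolycategory {B : PolyData.{u', v'}} (hB : B.IsPolycategory) {O : Type u}
    (o : O → B.Obj) : (B.pull o).IsPolycategory := by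
  have := hB.renLaws
  refine isPolycategory_of_scut ?_ ?_
  · intro S T U p p' q q' x y hp hq f g h
    -- `G` is `g` seen in `B` with both cut channels exposed; `hg` and `hg'` present `g` through `G`
    -- with either channel in front. The law in `B` is applied to `G`.
    obtain ⟨G, hG⟩ : ∃ G, G = sren (((SRen.mapCons (pullObj o) p' x (cons q y T))).trans
        ((SRen.mapCons (pullObj o) q y T).cons p' (pullObj o x))) (push g) := ⟨_, rfl⟩
    have hg : sren (SRen.mapCons (pullObj o) p' x (cons q y T)) (push g) =
        sren ((SRen.mapCons (pullObj o) q y T).symm.cons p' (pullObj o x)) G := by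
      rw [hG, sren_sren]
      exact sren_congr (by simp) _
    have hg' : sren (SRen.mapCons (pullObj o) q y (cons p' x T))
        (sren ((SRen.swap p' x q y T).map (pullObj o)) (push g)) =
        sren ((SRen.mapCons (pullObj o) p' x T).symm.cons q (pullObj o y))
          (sren (SRen.swap p' (pullObj o x) q (pullObj o y) _) G) := by
      simp only [hG, sren_sren]
      exact sren_congr (by simp) _
    have e1 : ∀ u, sren (SRen.mapCons (pullObj o) q y (S.append T))
        (sren ((SRen.appendCons q y S T).map (pullObj o))
          (sren (SRen.mapAppend (pullObj o) S (cons q y T)).symm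
            (sren ((SRen.refl _).append (SRen.mapCons (pullObj o) q y T).symm) u))) =
        sren ((SRen.mapAppend (pullObj o) S T).symm.cons q (pullObj o y))
          (sren (P := B) (SRen.appendCons q (pullObj o y) _ _) u) := fun u => by
      simp only [sren_sren]
      exact sren_congr (by simp) _
    have e2 : ∀ u, sren (SRen.mapCons (pullObj o) p' x (T.append U))
        (sren ((SRen.consAppend p' x T U).map (pullObj o))
          (sren (SRen.mapAppend (pullObj o) (cons p' x T) U).symm
            (sren ((SRen.mapCons (pullObj o) p' x T).symm.append (SRen.refl _)) u))) =
        sren ((SRen.mapAppend (pullObj o) T U).symm.cons p' (pullObj o x))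
          (sren (P := B) (SRen.consAppend p' (pullObj o x) _ _) u) := fun u => by
      simp only [sren_sren]
      exact sren_congr (by simp) _
    have e := hB.scutAssocAt hp hq (sren (SRen.mapCons (pullObj o) p x S) (push f)) G
      (sren (SRen.mapCons (pullObj o) q' y U) (push h))
    unfold ScutAssocAt at e ⊢
    apply push_injective
    rw [push_sren, push_scut, push_sren, push_scut, push_scut, push_sren, push_scut, push_sren,
      hg, scut_sren_right, e1, scut_sren_left, hg', scut_sren_left, e2, scut_sren_right, ← e]
    simp only [sren_sren]
    exact sren_congr (by simp) _
  · intro S p q x h f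
    unfold SidScutAt
    have e := hB.sidScutAt h (sren (SRen.mapCons (pullObj o) q x S) (push f))
    unfold SidScutAt at e
    apply push_injective
    apply sren_injective (SRen.mapCons (pullObj o) q x S)
    rw [push_sren, push_scut, push_sid, scut_sren_left]
    conv_rhs => rw [← e]
    simp only [sren_sren]
    exact sren_congr (by simp) _

end SigmaPi

/-! ### Poly-sums and poly-products of a pull-back -/

namespace SigmaPi
open Renaming Sequent PolyData

namespace SRen

variable {O : Type u} {O' : Type u'} {F : O → O'} {S : Sequent O} {p : Bool} {x : O} {y : O'}

/-- Apply a function to the objects and replace the object on the distinguished channel. -/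
protected def mapConsCast (F : O → O') (p : Bool) {x : O} {y : O'} (h : F x = y) (S : Sequent O) :
    SRen ((cons p x S).map F) (cons p y (S.map F)) :=
  (SRen.mapCons F p x S).trans (SRen.castCons p h _)

@[simp] theorem app_mapConsCast_here (h : F x = y) :
    (SRen.mapConsCast F p h S).app (mapChan F here) = here := by simp [SRen.mapConsCast]

@[simp] theorem app_mapConsCast_there (h : F x = y) (c : S.Chan) :
    (SRen.mapConsCast F p h S).app (mapChan F (there c)) = there (mapChan F c) := by
  simp [SRen.mapConsCast]

@[simp] theorem app_symm_mapConsCast_here (h : F x = y) :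
    (SRen.mapConsCast F p h S).symm.app here = mapChan F here := app_symm_eq _ (by simp)

@[simp] theorem app_symm_mapConsCast_there (h : F x = y) (c : S.Chan) :
    (SRen.mapConsCast F p h S).symm.app (there (mapChan F c)) = mapChan F (there c) :=
  app_symm_eq _ (by simp)

end SRen

namespace SumProdData

/-- `ChanOp.ofScut` derives cuts on one side from cuts on the other. For `cot_cut` and `cut_tup` the
channels have opposite polarity, and the swap in the general law has to be removed. -/
theorem natural_of_scut {P : PolyData.{u, v}} [P.RenLaws] {T : SumProdData P}
    (hren : ∀ (p : Bool) {I : Type} [Finite I] (X : I → P.Obj) {S S' : Sequent P.Obj}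
      (σ : SRen S S') (f : ∀ i, P.H (cons p (X i) S)),
      sren (σ.cons p _) (T.tup p X f) = T.tup p X fun i => sren (σ.cons p (X i)) (f i))
    (hcut : ∀ (p : Bool) {I : Type} [Finite I] (X : I → P.Obj) {q r : Bool} {S S' : Sequent P.Obj}
      {x : P.Obj} (h : q ≠ r) (f : ∀ i, P.H (cons p (X i) (cons q x S))) (g : P.H (cons r x S')),
      sren (SRen.consAppend p _ S S') (scut h (sren (SRen.swap p _ q x S) (T.tup p X f)) g) =
        T.tup p X fun i => sren (SRen.consAppend p (X i) S S')
          (scut h (sren (SRen.swap p (X i) q x S) (f i)) g)) : T.Natural := by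
  let o := fun (p : Bool) {I : Type} [Finite I] (X : I → P.Obj) =>
    ChanOp.ofScut p I X (T.conn p X) (T.tup p X) (hren p X) (hcut p X)
  exact
  { ren_cot := fun {I _} X Γ Γ' Δ Δ' σ τ f =>
      hren false X (S := ⟨Γ, Δ⟩) (S' := ⟨Γ', Δ'⟩) ⟨σ, τ⟩ f
    ren_tup := fun {I _} X Γ Γ' Δ Δ' σ τ f =>
      hren true X (S := ⟨Γ, Δ⟩) (S' := ⟨Γ', Δ'⟩) ⟨σ, τ⟩ f
    cut_cot := fun {I _} X Γ Δ Γ' Δ' z h f =>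
      (o false X).rcut_op (S := ⟨Γ', Δ'⟩) (T := ⟨Γ, Δ⟩) h f
    tup_cut := fun {I _} X Γ Δ Γ' Δ' z f h =>
      (o true X).op_rcut (S := ⟨Γ, Δ⟩) (T := ⟨Γ', Δ'⟩) f h
    cot_cut := fun {I _} X Γ Δ Γ' Δ' z f h => by
      have e : ∀ (w : P.Obj) (f : P.H (cons false w (cons true z ⟨Γ, Δ⟩))),
        sren (SRen.swap false w true z ⟨Γ, Δ⟩) f = f := fun w f => sren_refl f
      have := (o false X).op_rcut (S := ⟨Γ, Δ⟩) (T := ⟨Γ', Δ'⟩) f h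
      exact (congrArg (fun t => sren (SRen.consAppend false (T.conn false X) ⟨Γ, Δ⟩ ⟨Γ', Δ'⟩)
        (rcut t h)) (e (T.conn false X) (T.tup false X f)).symm).trans
        (this.trans (congrArg (T.tup false X) (funext fun i => congrArg (fun t =>
          sren (SRen.consAppend false (X i) ⟨Γ, Δ⟩ ⟨Γ', Δ'⟩) (rcut t h)) (e (X i) (f i)))))
    cut_tup := fun {I _} X Γ Δ Γ' Δ' z h f => by
      have e : ∀ (w : P.Obj) (f : P.H (cons true w (cons false z ⟨Γ', Δ'⟩))),
        sren (SRen.swap true w false z ⟨Γ', Δ'⟩) f = f := fun w f => sren_refl f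
      have := (o true X).rcut_op (S := ⟨Γ', Δ'⟩) (T := ⟨Γ, Δ⟩) h f
      exact (congrArg (fun t => sren (SRen.appendCons true (T.conn true X) ⟨Γ, Δ⟩ ⟨Γ', Δ'⟩)
        (rcut h t)) (e (T.conn true X) (T.tup true X f)).symm).trans
        (this.trans (congrArg (T.tup true X) (funext fun i => congrArg (fun t =>
          sren (SRen.appendCons true (X i) ⟨Γ, Δ⟩ ⟨Γ', Δ'⟩) (rcut h t)) (e (X i) (f i))))) }

theorem isFiniteSumProd_of_natural {P : PolyData.{u, v}} {T : SumProdData P} (hT : T.Natural)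
    (hb : ∀ (p : Bool) {I : Type} [Finite I] (X : I → P.Obj) (S : Sequent P.Obj),
      Function.Bijective (T.tup p X (S := S))) : T.IsFiniteSumProd where
  isPolySum X :=
    { bijective := fun Γ Δ => hb false X ⟨Γ, Δ⟩
      ren_cot := hT.ren_cot X
      cot_cut := hT.cot_cut X
      cut_cot := hT.cut_cot X }
  isPolyProd X :=
    { bijective := fun Γ Δ => hb true X ⟨Γ, Δ⟩
      ren_tup := hT.ren_tup X
      cut_tup := hT.cut_tup X
      tup_cut := hT.tup_cut X }

/-- Poly-sums and poly-products in a pull-back. -/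
def pull {B : PolyData.{u', v'}} (T : SumProdData B) {O : Type u} (o : O → B.Obj)
    (s t : ∀ {I : Type} [Finite I], (I → O) → O)
    (hs : ∀ {I : Type} [Finite I] (X : I → O), o (s X) = T.sum fun i => o (X i))
    (ht : ∀ {I : Type} [Finite I] (X : I → O), o (t X) = T.prod fun i => o (X i)) :
    SumProdData (B.pull o) where
  sum X := s X
  prod X := t X
  cotuple X Γ Δ f := sren (P := B) (SRen.mapConsCast o false (hs X) ⟨Γ, Δ⟩).symm (T.tup false (fun i => o (X i)) fun i =>
      sren (P := B) (SRen.mapCons o false (X i) ⟨Γ, Δ⟩) (f i))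
  tuple X Γ Δ f := sren (P := B) (SRen.mapConsCast o true (ht X) ⟨Γ, Δ⟩).symm (T.tup true (fun i => o (X i)) fun i =>
      sren (P := B) (SRen.mapCons o true (X i) ⟨Γ, Δ⟩) (f i))

section Pull

variable {B : PolyData.{u', v'}} {T : SumProdData B} {O : Type u} {o : O → B.Obj}
  {s t : ∀ {I : Type} [Finite I], (I → O) → O}
  {hs : ∀ {I : Type} [Finite I] (X : I → O), o (s X) = T.sum fun i => o (X i)}
  {ht : ∀ {I : Type} [Finite I] (X : I → O), o (t X) = T.prod fun i => o (X i)}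

/-- This equality is only propositional in general. It is used through the renaming `castCons`, so
polymorphisms are never transported along it. -/
theorem pullObj_conn (p : Bool) {I : Type} [Finite I] (X : I → (B.pull o).Obj) :
    pullObj o ((T.pull o s t hs ht).conn p X) = T.conn p fun i => pullObj o (X i) := by
  cases p
  · exact hs X
  · exact ht X

theorem push_tup (p : Bool) {I : Type} [Finite I] (X : I → (B.pull o).Obj)
    {S : Sequent (B.pull o).Obj} (f : ∀ i, (B.pull o).H (cons p (X i) S)) :
    push ((T.pull o s t hs ht).tup p X f) =
      sren (SRen.mapConsCast (pullObj o) p (pullObj_conn p X) S).symm (T.tup p (fun i => pullObj o (X i)) fun i =>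
          sren (SRen.mapCons (pullObj o) p (X i) S) (push (f i))) := by
  cases p <;> rfl

variable [B.RenLaws]

theorem pull_natural (hT : T.Natural) : (T.pull o s t hs ht).Natural := by
  apply natural_of_scut
  · intro p I _ X S S' σ f
    apply push_injective
    have e : ∀ i, sren (SRen.mapCons (pullObj o) p (X i) S')
        (sren ((σ.cons p (X i)).map (pullObj o)) (push (f i))) =
        sren ((σ.map (pullObj o)).cons p (pullObj o (X i)))
          (sren (SRen.mapCons (pullObj o) p (X i) S) (push (f i))) := fun i => by
      rw [sren_sren, sren_sren]
      exact sren_congr (by simp) _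
    simp only [push_sren, push_tup, e]
    have := (tupOp hT p fun i => pullObj o (X i)).sren_op (σ.map (pullObj o))
      (fun i => sren (SRen.mapCons (pullObj o) p (X i) S) (push (f i)))
    refine Eq.trans ?_ (congrArg (sren _) this)
    simp only [tupOp, sren_sren]
    exact sren_congr (by simp) _
  · intro p I _ X q r S S' x h f g
    apply push_injective
    have e1 : ∀ i, sren (SRen.mapCons (pullObj o) p (X i) (cons q x S)) (push (f i)) =
        sren ((SRen.mapCons (pullObj o) q x S).symm.cons p _)
          (sren ((SRen.mapCons (pullObj o) p (X i) (cons q x S)).trans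
            ((SRen.mapCons (pullObj o) q x S).cons p _)) (push (f i))) := fun i => by
      rw [sren_sren]
      exact sren_congr (by simp) _
    have e2 := (tupOp hT p fun i => pullObj o (X i)).op_scut h
      (fun i => sren ((SRen.mapCons (pullObj o) p (X i) (cons q x S)).trans
        ((SRen.mapCons (pullObj o) q x S).cons p _)) (push (f i)))
      (sren (SRen.mapCons (pullObj o) r x S') (push g))
    have e3 := (tupOp hT p fun i => pullObj o (X i)).sren_op (SRen.mapCons (pullObj o) q x S).symm
      (fun i => sren ((SRen.mapCons (pullObj o) p (X i) (cons q x S)).trans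
        ((SRen.mapCons (pullObj o) q x S).cons p _)) (push (f i)))
    have e4 := (tupOp hT p fun i => pullObj o (X i)).sren_op (SRen.mapAppend (pullObj o) S S').symm
      (fun i => sren (SRen.consAppend p _ _ _) (scut h
        (sren (SRen.swap p (pullObj o (X i)) q (pullObj o x) _)
          (sren ((SRen.mapCons (pullObj o) p (X i) (cons q x S)).trans
            ((SRen.mapCons (pullObj o) q x S).cons p _)) (push (f i))))
        (sren (SRen.mapCons (pullObj o) r x S') (push g))))
    dsimp only [tupOp] at e2 e3 e4
    -- The object `w'` is kept apart from the image of `w` because for a sum or product they are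
    -- related only by the equality `hw`.
    have e5 : ∀ (w : (B.pull o).Obj) (w' : B.Obj) (hw : pullObj o w = w') u,
        sren (SRen.mapCons (pullObj o) q x (cons p w S))
          (sren ((SRen.swap p w q x S).map (pullObj o))
            (sren (SRen.mapConsCast (pullObj o) p hw (cons q x S)).symm
              (sren ((SRen.mapCons (pullObj o) q x S).symm.cons p w') u))) =
        sren ((SRen.mapConsCast (pullObj o) p hw S).symm.cons q (pullObj o x))
          (sren (P := B) (SRen.swap p w' q (pullObj o x) (S.map (pullObj o))) u) := fun w w' hw u => by
      simp only [sren_sren]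
      exact sren_congr (by simp) _
    have e6 : ∀ (w : (B.pull o).Obj) (w' : B.Obj) (hw : pullObj o w = w') u,
        sren ((SRen.consAppend p w S S').map (pullObj o))
          (sren (SRen.mapAppend (pullObj o) (cons p w S) S').symm
            (sren ((SRen.mapConsCast (pullObj o) p hw S).symm.append (SRen.refl _)) u)) =
        sren (SRen.mapConsCast (pullObj o) p hw (S.append S')).symm
          (sren ((SRen.mapAppend (pullObj o) S S').symm.cons p w')
            (sren (P := B) (SRen.consAppend p w' _ _) u)) := fun w w' hw u => by
      simp only [sren_sren]
      exact sren_congr (by simp) _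
    simp only [push_sren, push_tup, push_scut]
    simp only [e1]
    rw [← e3, e5, scut_sren_left, e6, e2, e4]
    congr 2
    funext i
    have e7 : ∀ u, sren (SRen.mapCons (pullObj o) p (X i) (S.append S'))
        (sren ((SRen.consAppend p (X i) S S').map (pullObj o))
          (sren (SRen.mapAppend (pullObj o) (cons p (X i) S) S').symm u)) =
        sren ((SRen.mapAppend (pullObj o) S S').symm.cons p (pullObj o (X i)))
          (sren (P := B) (SRen.consAppend p (pullObj o (X i)) _ _)
            (sren ((SRen.mapCons (pullObj o) p (X i) S).append (SRen.refl _)) u)) := fun u => by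
      simp only [sren_sren]
      exact sren_congr (by simp) _
    rw [e7, ← scut_sren_left]
    congr 3
    simp only [sren_sren]
    exact sren_congr (by simp) _

/-- Tupling in the pull-back is tupling in `B` between renamings, and these are bijections. -/
theorem pull_tup_bijective (hT : T.IsFiniteSumProd) (p : Bool) {I : Type} [Finite I]
    (X : I → (B.pull o).Obj) (S : Sequent (B.pull o).Obj) :
    Function.Bijective ((T.pull o s t hs ht).tup p X (S := S)) := by
  have inj : Function.Injective ((T.pull o s t hs ht).tup p X (S := S)) := fun f g h => by
    have h' := congrArg push h
    rw [push_tup, push_tup] at h'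
    have h2 := (hT.tup_bijective p _ _).injective (sren_injective _ h')
    exact funext fun i => sren_injective (P := B) (SRen.mapCons (pullObj o) p (X i) S)
      (congrFun h2 i)
  refine ⟨inj, fun f => ?_⟩
  obtain ⟨g, hg⟩ := (hT.tup_bijective p (fun i => pullObj o (X i)) (S.map (pullObj o))).surjective
    (sren (SRen.mapConsCast (pullObj o) p (pullObj_conn p X) S) (push f))
  obtain ⟨g', hg'⟩ : ∃ g' : ∀ i, (B.pull o).H (cons p (X i) S),
      ∀ i, sren (SRen.mapCons (pullObj o) p (X i) S) (push (g' i)) = g i :=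
    ⟨fun i => sren (P := B) (SRen.mapCons (pullObj o) p (X i) S).symm (g i), fun i =>
      (sren_sren (P := B) _ _ _).trans (sren_eq_self (by simp) _)⟩
  refine ⟨g', push_injective ?_⟩
  simp only [push_tup, hg', hg]
  rw [sren_sren, sren_eq_self (by simp)]

theorem pull_isFiniteSumProd (hT : T.IsFiniteSumProd) :
    (T.pull o s t hs ht).IsFiniteSumProd :=
  isFiniteSumProd_of_natural (pull_natural hT.natural) (pull_tup_bijective hT)

end Pull

end SumProdData

end SigmaPi

namespace SigmaPi
open Renaming Sequent PolyData Deriv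

/-! ### Interpretation of derivations -/

section Eval

variable {A : PolyData.{u, v}} {B : PolyData.{u', v'}}

/-- The object that interprets a formula. -/
def evalObj (T : SumProdData B) (F : A.Obj → B.Obj) : Fml A.Obj → B.Obj
  | .atom a => F a
  | @Fml.sum _ _ _ X => T.sum fun i => evalObj T F (X i)
  | @Fml.prod _ _ _ X => T.prod fun i => evalObj T F (X i)

/-- Poly-sums and poly-products of formulas in the pull-back along the interpretation. -/
abbrev evalSumProd (T : SumProdData B) (F : A.Obj → B.Obj) :
    SumProdData (B.pull (evalObj T F)) :=
  T.pull (evalObj T F) (fun X => Fml.sum X) (fun X => Fml.prod X) (fun _ => rfl) (fun _ => rfl)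

variable [B.RenLaws]

theorem evalSumProd_isFiniteSumProd {T : SumProdData B} (hT : T.IsFiniteSumProd)
    (F : A.Obj → B.Obj) : (evalSumProd T F).IsFiniteSumProd :=
  SumProdData.pull_isFiniteSumProd (s := fun X => Fml.sum X) (t := fun X => Fml.prod X)
    (hs := fun _ => rfl) (ht := fun _ => rfl) hT

/-- The polymorphism that interprets a derivation. -/
noncomputable def eval {T : SumProdData B} (hT : T.IsFiniteSumProd) (F : Morphism A B) :
    ∀ {Γ Δ : Ctx (Fml A.Obj)}, Deriv A Γ Δ → (B.pull (evalObj T F.obj)).Hom Γ Δ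
  | _, _, ax f => F.map f
  | _, _, exch σ τ f => (B.pull (evalObj T F.obj)).ren σ τ (eval hT F f)
  | _, _, cotuple (X := X) f => (evalSumProd T F.obj).cotuple X fun i => eval hT F (f i)
  | _, _, tuple (Y := Y) f => (evalSumProd T F.obj).tuple Y fun i => eval hT F (f i)
  | _, _, proj (X := X) (Γ := Γ) (Δ := Δ) k f =>
    SumProdData.sel (T := evalSumProd T F.obj) (p := false) (q := true) (S := ⟨Γ, Δ⟩)
      (evalSumProd_isFiniteSumProd hT F.obj) (by decide) (X := X) k (eval hT F f)
  | _, _, inj (Y := X) (Γ := Γ) (Δ := Δ) k f =>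
    SumProdData.sel (T := evalSumProd T F.obj) (p := true) (q := false) (S := ⟨Γ, Δ⟩)
      (evalSumProd_isFiniteSumProd hT F.obj) (by decide) (X := X) k (eval hT F f)
  | _, _, Deriv.cut f g => (B.pull (evalObj T F.obj)).cut (eval hT F f) (eval hT F g)

end Eval

/-! ### Soundness of the interpretation -/

section Sound

variable {A : PolyData.{u, v}} {B : PolyData.{u', v'}} [B.RenLaws]

/-- Every generating conversion is a law of the pull-back: the polycategory laws, the naturality of
tuplings and selections, the principal reduction `sel_scut_tup`, and the commutations `tup_op_comm`
and `sel_op_comm`. For axioms the laws of the morphism `F` are used. -/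
theorem eval_eq_of_conv (hB : B.IsPolycategory) {T : SumProdData B} (hT : T.IsFiniteSumProd)
    (F : Morphism A B) {Γ Δ : Ctx (Fml A.Obj)} {d e : Deriv A Γ Δ} (h : Conv A d e) :
    eval hT F d = eval hT F e := by
  have hP := pull_isPolycategory hB (evalObj T F.obj)
  have hT' : (evalSumProd T F.obj).IsFiniteSumProd :=
    evalSumProd_isFiniteSumProd hT F.obj
  induction h with
  | rfl f => rfl
  | symm _ ih => exact ih.symm
  | trans _ _ ih ih' => exact ih.trans ih'
  | congr_exch σ τ _ ih => exact congrArg ((B.pull (evalObj T F.obj)).ren σ τ) ih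
  | congr_cotuple _ ih => exact congrArg ((evalSumProd T F.obj).cotuple _) (funext ih)
  | congr_tuple _ ih => exact congrArg ((evalSumProd T F.obj).tuple _) (funext ih)
  | @congr_proj I _ X Γ Δ k f g _ ih =>
    exact congrArg (SumProdData.sel (T := evalSumProd T F.obj) (p := false) (q := true)
      (S := ⟨Γ, Δ⟩) hT' (by decide) (X := X) k) ih
  | @congr_inj I _ X Γ Δ k f g _ ih =>
    exact congrArg (SumProdData.sel (T := evalSumProd T F.obj) (p := true) (q := false)
      (S := ⟨Γ, Δ⟩) hT' (by decide) (X := X) k) ih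
  | congr_cut _ _ ih ih' => exact congrArg₂ (B.pull (evalObj T F.obj)).cut ih ih'
  | exch_refl f => exact hP.ren_refl _
  | exch_trans => exact hP.ren_trans _ _ _ _ _
  | exch_ax σ τ f => exact (F.map_ren σ τ f).symm
  | exch_cotuple => exact (hT'.isPolySum _).ren_cot _ _ _
  | exch_tuple => exact (hT'.isPolyProd _).ren_tup _ _ _
  | @exch_proj I _ X Γ Γ' Δ Δ' k σ τ f =>
    exact (SumProdData.selOp hP hT' (p := false) (q := true) (by decide) X k).sren_op
      (S := ⟨Γ, Δ⟩) (T := ⟨Γ', Δ'⟩) ⟨σ, τ⟩ fun _ => eval hT F f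
  | @exch_inj I _ X Γ Γ' Δ Δ' k σ τ f =>
    exact (SumProdData.selOp hP hT' (p := true) (q := false) (by decide) X k).sren_op
      (S := ⟨Γ, Δ⟩) (T := ⟨Γ', Δ'⟩) ⟨σ, τ⟩ fun _ => eval hT F f
  | exch_cut => exact hP.ren_cut _ _ _ _ _ _
  | @ax_cut Γ Δ Γ' Δ' a f g =>
    -- Cut in the pull-back ends with the inverse of `mapAppend`, so `F.map_cut` is renamed along
    -- that inverse before it is compared.
    have e := congrArg (B.ren (mapAppend (evalObj T F.obj) (Γ.map Fml.atom) (Γ'.map Fml.atom)).symm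
      (mapAppend (evalObj T F.obj) (Δ.map Fml.atom) (Δ'.map Fml.atom)).symm) (F.map_cut f g)
    refine Eq.trans ?_ (e.symm.trans (hB.ren_trans _ _ _ _ _))
    exact congrArg₂ (fun s t => B.ren
      (mapAppend (evalObj T F.obj) (Γ.map Fml.atom) (Γ'.map Fml.atom)).symm
      (mapAppend (evalObj T F.obj) (Δ.map Fml.atom) (Δ'.map Fml.atom)).symm
        (B.cut s t)) (hB.ren_trans _ _ _ _ _) (hB.ren_trans _ _ _ _ _)
  | cut_idAtom f =>
    exact (congrArg (fun t => (B.pull (evalObj T F.obj)).ren (appendEmpty _) (comm _ _)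
      ((B.pull (evalObj T F.obj)).cut (eval hT F f) ((B.pull (evalObj T F.obj)).renL (unit _) t)))
        (F.map_id _)).trans (hP.cut_id (eval hT F f))
  | idAtom_cut f =>
    exact (congrArg (fun t => (B.pull (evalObj T F.obj)).renR (emptyAppend _)
      ((B.pull (evalObj T F.obj)).cut ((B.pull (evalObj T F.obj)).renR (unit _) t) (eval hT F f)))
        (F.map_id _)).trans (hP.id_cut (eval hT F f))
  | cotuple_cut => exact (hT'.isPolySum _).cot_cut _ _
  | cut_tuple => exact (hT'.isPolyProd _).cut_tup _ _
  | @inj_cut I _ X Z Γ Δ Γ' Δ' k f g =>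
    exact (SumProdData.selOp hP hT' (p := true) (q := false) (by decide) X k).op_rcut
      (S := ⟨Γ, Δ⟩) (T := ⟨Γ', Δ'⟩) (fun _ => eval hT F f) (eval hT F g)
  | @cut_proj I _ X Z Γ Δ Γ' Δ' k f g =>
    exact (SumProdData.selOp hP hT' (p := false) (q := true) (by decide) X k).rcut_op
      (S := ⟨Γ', Δ'⟩) (T := ⟨Γ, Δ⟩) (eval hT F f) (fun _ => eval hT F g)
  | @proj_cut I _ X Z Γ Δ Γ' Δ' k f g =>
    have e : ∀ (w : (B.pull (evalObj T F.obj)).Obj)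
        (t : (B.pull (evalObj T F.obj)).H (cons false w (cons true Z ⟨Γ, Δ⟩))),
      sren (SRen.swap false w true Z ⟨Γ, Δ⟩) t = t := fun w t => sren_refl t
    have := (SumProdData.selOp hP hT' (p := false) (q := true) (by decide) X k).op_rcut
      (S := ⟨Γ, Δ⟩) (T := ⟨Γ', Δ'⟩) (fun _ => eval hT F f) (eval hT F g)
    exact (congrArg (fun t => sren _ (rcut t _)) (e _ _).symm).trans (this.trans
      (congrArg (fun t => SumProdData.sel hT' (p := false) (q := true) (by decide) (X := X) k
        (sren _ (rcut t _))) (e _ _)))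
  | @cut_inj I _ X Z Γ Δ Γ' Δ' k f g =>
    have e : ∀ (w : (B.pull (evalObj T F.obj)).Obj)
        (t : (B.pull (evalObj T F.obj)).H (cons true w (cons false Z ⟨Γ', Δ'⟩))),
      sren (SRen.swap true w false Z ⟨Γ', Δ'⟩) t = t := fun w t => sren_refl t
    have := (SumProdData.selOp hP hT' (p := true) (q := false) (by decide) X k).rcut_op
      (S := ⟨Γ', Δ'⟩) (T := ⟨Γ, Δ⟩) (eval hT F f) (fun _ => eval hT F g)
    exact (congrArg (fun t => sren _ (rcut _ t)) (e _ _).symm).trans (this.trans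
      (congrArg (fun t => SumProdData.sel hT' (p := true) (q := false) (by decide) (X := X) k
        (sren _ (rcut _ t))) (e _ _)))
  | tuple_cut => exact (hT'.isPolyProd _).tup_cut _ _
  | cut_cotuple => exact (hT'.isPolySum _).cut_cot _ _
  | @inj_cut_cotuple I _ X Γ Δ Γ' Δ' k f g =>
    exact SumProdData.sel_scut_tup hP hT' (p := true) (q := false) (by decide) (X := X) k
      (S := ⟨Γ, Δ⟩) (S' := ⟨Γ', Δ'⟩) (eval hT F f) fun i => eval hT F (g i)
  | @tuple_cut_proj I _ X Γ Δ Γ' Δ' k f g =>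
    -- With the projection as first premise, `scut` is the cut followed by an exchange of the parts;
    -- injectivity strips that exchange.
    exact sren_injective _ (SumProdData.sel_scut_tup hP hT' (p := false) (q := true) (by decide)
      (X := X) k (S' := ⟨Γ, Δ⟩) (S := ⟨Γ', Δ'⟩) (eval hT F g) fun i => eval hT F (f i))
  | @cotuple_cotuple I J _ _ X Y Γ Δ f =>
    exact SumProdData.tup_op_comm hP hT' false (X := X)
      (SumProdData.tupOp hT'.natural false Y) (S := ⟨Γ, Δ⟩) fun i j => eval hT F (f i j)
  | @tuple_tuple I J _ _ X Y Γ Δ f =>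
    exact SumProdData.tup_op_comm hP hT' true (X := X)
      (SumProdData.tupOp hT'.natural true Y) (S := ⟨Γ, Δ⟩) fun i j => eval hT F (f i j)
  | @cotuple_proj I J _ _ X Y Γ Δ k f =>
    exact SumProdData.tup_op_comm hP hT' false (X := X) (S := ⟨Γ, Δ⟩)
      (SumProdData.selOp hP hT' (p := false) (q := true) (by decide) Y k) fun i _ => eval hT F (f i)
  | @inj_tuple I J _ _ X Y Γ Δ k g =>
    exact SumProdData.sel_op_comm hT' (p := true) (q := false) (by decide) (X := X) k
      (SumProdData.tupOp hT'.natural true Y) (S := ⟨Γ, Δ⟩) fun j => eval hT F (g j)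
  | @inj_inj I J _ _ X Y Γ Δ k l f =>
    exact SumProdData.sel_op_comm hT' (p := true) (q := false) (by decide) (X := X) k
      (SumProdData.selOp hP hT' (p := true) (q := false) (by decide) Y l) (S := ⟨Γ, Δ⟩)
      fun _ => eval hT F f
  | @proj_proj I J _ _ X Y Γ Δ k l f =>
    exact SumProdData.sel_op_comm hT' (p := false) (q := true) (by decide) (X := X) k
      (SumProdData.selOp hP hT' (p := false) (q := true) (by decide) Y l) (S := ⟨Γ, Δ⟩)
      fun _ => eval hT F f
  | @cotuple_inj I J _ _ X Y Γ Δ k f =>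
    exact SumProdData.cotuple_inj_comm hP hT' (X := X) (Y := Y) k (S := ⟨Γ, Δ⟩)
      fun i => eval hT F (f i)
  | @cotuple_tuple I J _ _ X Y Γ Δ f =>
    exact SumProdData.cotuple_tuple_comm hP hT' (X := X) (Y := Y) (S := ⟨Γ, Δ⟩)
      fun i j => eval hT F (f i j)
  | @proj_tuple I J _ _ X Y Γ Δ k g =>
    exact SumProdData.proj_tuple_comm hT' (X := X) (Y := Y) k (S := ⟨Γ, Δ⟩)
      fun j => eval hT F (g j)
  | @inj_proj I J _ _ X Y Γ Δ k l f =>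
    exact (SumProdData.proj_inj_comm hP hT' (X := Y) (Y := X) l k (S := ⟨Γ, Δ⟩)
      (eval hT F f)).symm

end Sound
end SigmaPi

namespace SigmaPi
open Renaming Sequent PolyData Deriv

/-! ### The morphism induced by an interpretation of the atoms -/

section Extension

variable {A : PolyData.{u, v}} {B : PolyData.{u', v'}} [B.RenLaws] {T : SumProdData B}

/-- By the inductive hypothesis the identity derivation is interpreted as the tupling of the
selections from identities, which is the identity by `SumProdData.sid_conn`. The two are compared
after their channels have been arranged as in `sid`. -/
theorem eval_idDeriv (hB : B.IsPolycategory) (hT : T.IsFiniteSumProd) (F : Morphism A B)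
    (x : Fml A.Obj) : eval hT F (idDeriv x) = (B.pull (evalObj T F.obj)).id x := by
  have hP := pull_isPolycategory hB (evalObj T F.obj)
  have hT' : (evalSumProd T F.obj).IsFiniteSumProd := evalSumProd_isFiniteSumProd hT F.obj
  induction x with
  | atom a => exact F.map_id a
  | @sum I _ X ih =>
    have h : true ≠ false := by decide
    have e := (sren_id_sum h ((evalSumProd T F.obj).tup false X)
      (SumProdData.tupOp hT'.natural false X).sren_op (fun i => SumProdData.sel hT' h i)
      fun i {S S'} σ f => (SumProdData.selOp hP hT' h X i).sren_op (S := S) (T := S') σ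
        fun _ => f).trans
      (SumProdData.sid_conn hP hT' h X).symm
    refine Eq.trans ?_ (sren_injective (P := B.pull (evalObj T F.obj))
      (⟨unit _, unit _⟩ : SRen ⟨Ctx.single _, Ctx.single _⟩ (cons true _ (cons false _ nil))) e)
    exact congrArg (fun u : ∀ i, (B.pull (evalObj T F.obj)).Hom (Ctx.single (X i))
        (Ctx.single (X i)) =>
      (B.pull (evalObj T F.obj)).renL (unit _).symm
        ((evalSumProd T F.obj).cotuple X fun i =>
          (B.pull (evalObj T F.obj)).ren (unit _) (unit _).symm
            (SumProdData.sel hT' (p := true) (q := false) (S := ⟨Ctx.single (X i), Ctx.empty⟩) h i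
              ((B.pull (evalObj T F.obj)).renR (unit _) (u i))))) (funext ih)
  | @prod I _ X ih =>
    have h : false ≠ true := by decide
    have e := (sren_id_prod h ((evalSumProd T F.obj).tup true X)
      (SumProdData.tupOp hT'.natural true X).sren_op (fun i => SumProdData.sel hT' h i)
      fun i {S S'} σ f => (SumProdData.selOp hP hT' h X i).sren_op (S := S) (T := S') σ
        fun _ => f).trans
      (SumProdData.sid_conn hP hT' h X).symm
    refine Eq.trans ?_ (sren_injective (P := B.pull (evalObj T F.obj))
      (⟨unit _, unit _⟩ : SRen ⟨Ctx.single _, Ctx.single _⟩ (cons false _ (cons true _ nil))) e)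
    exact congrArg (fun u : ∀ i, (B.pull (evalObj T F.obj)).Hom (Ctx.single (X i))
        (Ctx.single (X i)) =>
      (B.pull (evalObj T F.obj)).renR (unit _).symm
        ((evalSumProd T F.obj).tuple X fun i =>
          (B.pull (evalObj T F.obj)).ren (unit _).symm (unit _)
            (SumProdData.sel hT' (p := false) (q := true) (S := ⟨Ctx.empty, Ctx.single (X i)⟩) h i
              ((B.pull (evalObj T F.obj)).renL (unit _) (u i))))) (funext ih)

/-- The extension of a morphism on the atoms to `ΣΠ_A`. -/
noncomputable def extend (hB : B.IsPolycategory) (hT : T.IsFiniteSumProd) (F : Morphism A B) :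
    Morphism (sigmaPi A) B where
  obj := evalObj T F.obj
  map {Γ Δ} f := Quotient.lift (s := convSetoid A Γ Δ) (eval hT F)
    (fun _ _ h => eval_eq_of_conv hB hT F h) f
  map_id := eval_idDeriv hB hT F
  map_ren := by
    rintro Γ Γ' Δ Δ' σ τ ⟨d⟩
    rfl
  map_cut := by
    rintro Γ Δ Γ' Δ' x ⟨d⟩ ⟨e⟩
    -- The renaming `mapAppend` cancels the inverse contained in the cut of the pull-back.
    exact (hB.ren_trans _ _ _ _ _).trans (hB.ren_refl _)

theorem extend_comp (hB : B.IsPolycategory) (hT : T.IsFiniteSumProd) (F : Morphism A B) :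
    (inclusion A).comp hB (extend hB hT F) = F := rfl

/-- On representatives the tupling in the pull-back carries the inverse of the renaming in the
definition of preservation, and the two cancel on every channel. -/
theorem extend_preservesSumProd (hB : B.IsPolycategory) (hT : T.IsFiniteSumProd)
    (F : Morphism A B) : (extend hB hT F).PreservesSumProd (sigmaPiSumProd A) T where
  obj_sum _ := rfl
  obj_prod _ := rfl
  map_cotuple {I _} X Γ Δ f := by
    obtain ⟨d, rfl⟩ := exists_cls_family (S := fun i => ⟨X i ∷ Γ, Δ⟩) f
    refine (congrArg (fun t => B.renL _ ((extend hB hT F).map t))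
      (sigmaPiSumProd_cotuple_mk A X d)).trans ?_
    refine (hB.ren_trans _ _ _ _ _).trans (Eq.trans ?_ (hB.ren_refl _))
    refine congrArg₂ (fun σ τ => B.ren σ τ _) (ext_equiv ?_) rfl
    rintro (c | c) <;> rfl
  map_tuple {I _} X Γ Δ f := by
    obtain ⟨d, rfl⟩ := exists_cls_family (S := fun i => ⟨Γ, X i ∷ Δ⟩) f
    refine (congrArg (fun t => B.renR _ ((extend hB hT F).map t))
      (sigmaPiSumProd_tuple_mk A X d)).trans ?_
    refine (hB.ren_trans _ _ _ _ _).trans (Eq.trans ?_ (hB.ren_refl _))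
    refine congrArg₂ (fun σ τ => B.ren σ τ _) rfl (ext_equiv ?_)
    rintro (c | c) <;> rfl

end Extension

/-! ### Uniqueness -/

section Uniqueness

variable {A : PolyData.{u, v}} {B : PolyData.{u', v'}} [B.RenLaws] {T : SumProdData B}

/-- A morphism that preserves poly-sums and poly-products is determined by its effect on `A`. -/
theorem eq_of_comp_inclusion_eq (hB : B.IsPolycategory) (hT : T.IsFiniteSumProd)
    (G G' : Morphism (sigmaPi A) B) (hG : G.PreservesSumProd (sigmaPiSumProd A) T)
    (hG' : G'.PreservesSumProd (sigmaPiSumProd A) T)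
    (h : (inclusion A).comp hB G = (inclusion A).comp hB G') : G = G' := by
  have ho : ∀ x : Fml A.Obj, G.obj x = G'.obj x := fun x => by
    induction x with
    | atom a => exact congrFun (congrArg Morphism.obj h) a
    | sum X ih =>
      exact (hG.obj_sum X).trans ((congrArg T.sum (funext ih)).trans (hG'.obj_sum X).symm)
    | prod X ih =>
      exact (hG.obj_prod X).trans ((congrArg T.prod (funext ih)).trans (hG'.obj_prod X).symm)
  -- The actions on polymorphisms have comparable types only once the object maps are identified, so
  -- the structures are unpacked.
  obtain ⟨o, m, h1, h2, h3⟩ := G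
  obtain ⟨o', m', h1', h2', h3'⟩ := G'
  obtain rfl : o = o' := funext ho
  have aren : ∀ {S S' : Sequent (sigmaPi A).Obj} (σ : SRen S S') {f : (sigmaPi A).H S},
      m f = m' f → m (sren σ f) = m' (sren σ f) := fun σ f e =>
    (h2 σ.l σ.r f).trans ((congrArg _ e).trans (h2' σ.l σ.r f).symm)
  have arcut : ∀ {S S' : Sequent (sigmaPi A).Obj} {x : (sigmaPi A).Obj}
      {f : (sigmaPi A).H (cons true x S)} {g : (sigmaPi A).H (cons false x S')},
      m f = m' f → m g = m' g → m (rcut f g) = m' (rcut f g) := fun {S S' x f g} ef eg => by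
    refine sren_injective (P := B) (SRen.mapAppend o S S') ?_
    refine (h3 (Γ := S.L) (Δ := S.R) (Γ' := S'.L) (Δ' := S'.R) f g).trans (Eq.trans ?_
      (h3' (Γ := S.L) (Δ := S.R) (Γ' := S'.L) (Δ' := S'.R) f g).symm)
    exact congrArg₂ (fun s t => B.cut (B.renR (mapCons o x S.R) s) (B.renL (mapCons o x S'.L) t))
      ef eg
  have ascut : ∀ {p q : Bool} (h : p ≠ q) {S S' : Sequent (sigmaPi A).Obj} {x : (sigmaPi A).Obj}
      {f : (sigmaPi A).H (cons p x S)} {g : (sigmaPi A).H (cons q x S')},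
      m f = m' f → m g = m' g → m (scut h f g) = m' (scut h f g) :=
    fun {p q} h {S S' x f g} ef eg => by
      match p, q, h with
      | true, false, _ => exact arcut ef eg
      | false, true, _ => exact aren _ (arcut eg ef)
      | true, true, h => exact absurd rfl h
      | false, false, h => exact absurd rfl h
  have asid : ∀ {p q : Bool} (h : p ≠ q) (x : (sigmaPi A).Obj), m (sid h x) = m' (sid h x) :=
    fun {p q} h x => by
      match p, q, h with
      | true, false, _ =>
        exact aren (⟨unit _, unit _⟩ : SRen ⟨Ctx.single _, Ctx.single _⟩
          (cons true x (cons false x nil))) ((h1 x).trans (h1' x).symm)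
      | false, true, _ =>
        exact aren (⟨unit _, unit _⟩ : SRen ⟨Ctx.single _, Ctx.single _⟩
          (cons false x (cons true x nil))) ((h1 x).trans (h1' x).symm)
      | true, true, h => exact absurd rfl h
      | false, false, h => exact absurd rfl h
  -- The direction from tuplings to components rests on injectivity of the operations of `T` and is
  -- what reaches the injections and projections below.
  have atup : ∀ (p : Bool) {I : Type} [Finite I] {X : I → (sigmaPi A).Obj}
      {S : Sequent (sigmaPi A).Obj} {f : ∀ i, (sigmaPi A).H (cons p (X i) S)},
      (m (tup p X f) = m' (tup p X f)) ↔ ∀ i, m (f i) = m' (f i) := fun p {I _ X S f} => by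
    cases p
    · have c := hG.map_cotuple X (Γ := S.L) (Δ := S.R) f
      have c' := hG'.map_cotuple X (Γ := S.L) (Δ := S.R) f
      constructor
      · intro e i
        have := ((hT.isPolySum _).bijective _ _).injective
          (c.symm.trans ((congrArg _ e).trans c'))
        exact sren_injective (P := B) (SRen.mapCons o false (X i) S) (congrFun this i)
      · intro e
        refine sren_injective (P := B) (SRen.mapConsCast o false (hG.obj_sum X) S)
          (c.trans (Eq.trans ?_ c'.symm))
        exact congrArg (T.cotuple _) (funext fun i => congrArg _ (e i))
    · have c := hG.map_tuple X (Γ := S.L) (Δ := S.R) f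
      have c' := hG'.map_tuple X (Γ := S.L) (Δ := S.R) f
      constructor
      · intro e i
        have := ((hT.isPolyProd _).bijective _ _).injective
          (c.symm.trans ((congrArg _ e).trans c'))
        exact sren_injective (P := B) (SRen.mapCons o true (X i) S) (congrFun this i)
      · intro e
        refine sren_injective (P := B) (SRen.mapConsCast o true (hG.obj_prod X) S)
          (c.trans (Eq.trans ?_ c'.symm))
        exact congrArg (T.tuple _) (funext fun i => congrArg _ (e i))
  -- Preservation of injections and projections is not part of the assumptions. Both morphisms agree
  -- on the identity of the compound formula, which is a tupling of selections, hence on these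
  -- components; a general selection is a cut with one of them.
  have asel : ∀ {p q : Bool} (h : p ≠ q) {I : Type} [Finite I] {X : I → (sigmaPi A).Obj} (k : I)
      {S : Sequent (sigmaPi A).Obj} {f : (sigmaPi A).H (cons p (X k) S)},
      m f = m' f → m (sel h k f) = m' (sel h k f) := fun {p q} h {I _ X} k {S f} ef => by
    have e := asid h ((sigmaPiSumProd A).conn q X)
    rw [sid_conn h X] at e
    have e1 := aren (SRen.swap p ((sigmaPiSumProd A).conn q X) q _ nil) e
    rw [sren_sren, sren_eq_self (by simp)] at e1
    have e2 := (atup q).1 e1 k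
    rw [← sel_sid_scut h.symm k f (sidScutAt_sigmaPi h.symm f)]
    exact aren _ (ascut h.symm e2 ef)
  have key : ∀ {Γ Δ : Ctx (Fml A.Obj)} (d : Deriv A Γ Δ),
      m (cls (S := ⟨Γ, Δ⟩) d) = m' (cls (S := ⟨Γ, Δ⟩) d) := fun d => by
    induction d with
    | @ax Γ Δ f =>
      have := eq_of_heq (Morphism.ext_iff.1 h).2
      exact congrFun (congrFun (congrFun this Γ) Δ) f
    | @exch Γ Γ' Δ Δ' σ τ d ih =>
      exact aren (S := ⟨Γ, Δ⟩) (S' := ⟨Γ', Δ'⟩) ⟨σ, τ⟩ ih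
    | @cotuple I _ X Γ Δ d ih =>
      have e := cls_cotuple (X := X) (Γ := Γ) (Δ := Δ) d
      exact (congrArg m e).trans (((atup false (S := ⟨Γ, Δ⟩)).2 ih).trans (congrArg m' e).symm)
    | @tuple I _ X Γ Δ d ih =>
      have e := cls_tuple (X := X) (Γ := Γ) (Δ := Δ) d
      exact (congrArg m e).trans (((atup true (S := ⟨Γ, Δ⟩)).2 ih).trans (congrArg m' e).symm)
    | @proj I _ X Γ Δ k d ih =>
      exact asel (p := false) (q := true) (by decide) (X := X) k (S := ⟨Γ, Δ⟩) ih
    | @inj I _ X Γ Δ k d ih =>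
      exact asel (p := true) (q := false) (by decide) (X := X) k (S := ⟨Γ, Δ⟩) ih
    | @cut Z Γ Δ Γ' Δ' d e ih ih' =>
      exact arcut (S := ⟨Γ, Δ⟩) (S' := ⟨Γ', Δ'⟩) ih ih'
  have hm : @m = @m' := by
    funext Γ Δ f
    obtain ⟨d, rfl⟩ := exists_cls (S := ⟨Γ, Δ⟩) f
    exact key d
  subst hm
  rfl

end Uniqueness

end SigmaPi

/-! ### The free polycategory with finite poly-sums and poly-products -/

theorem mainTheorem3 (A : PolyData.{u, v}) (hA : A.IsPolycategory) :
    (sigmaPi A).IsPolycategory ∧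
    (sigmaPiSumProd A).IsFiniteSumProd ∧
    ∀ (B : PolyData.{u', v'}) (hB : B.IsPolycategory)
      (T : SumProdData B) (_ : T.IsFiniteSumProd) (F : Morphism A B),
      ∃! G : Morphism (sigmaPi A) B,
        (inclusion A).comp hB G = F ∧ G.PreservesSumProd (sigmaPiSumProd A) T := by
  refine ⟨sigmaPi_isPolycategory hA, sigmaPiSumProd_isFiniteSumProd, fun B hB T hT F => ?_⟩
  have := hB.renLaws
  refine ⟨extend hB hT F, ⟨extend_comp hB hT F, extend_preservesSumProd hB hT F⟩, ?_⟩
  exact fun G ⟨hG, hG'⟩ => eq_of_comp_inclusion_eq hB hT G _ hG'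
    (extend_preservesSumProd hB hT F) (hG.trans (extend_comp hB hT F).symm)
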